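/- **Model.** Algorithms are deterministic programs of a random access machine that has integer registers and integer arrays, the operations $+,-,\cdot$, integer division with remainder, indirect access to array cells, tests $0<x$ and while-loops. Time is logarithmic cost: each elementary operation costs one unit plus the bit lengths of the numbers (operands, addresses, results) that it handles. All memory outside the input is initially $0$, and one program has to handle all instances. **Problems.** In the last three problems, the input items are integers $0<a_0<a_1<\dots<a_n$ ($n \ge 0$) with $\gcd(a_0,\dots,a_n)=1$, given as a sorted array; $t\in\mathbb Z_{\ge 0}$ is called *feasible* if $a_0x_0+\dots+a_nx_n=t$ for some $x\in\mathbb Z_{\ge 0}^{n+1}$. - **MinConv.** Input: integer sequences $(a[i])_{i=0}^{n-1}$, $(b[i])_{i=0}^{n-1}$ with $n\ge 1$. Output: $c[k]=\min_{i+j=k}(a[i]+b[j])$ for $0\le k<n$. Let $W$ be the largest absolute value of an entry. - **Unbounded SubsetSum.** Input: items and a target $t\in\mathbb Z_{\ge 0}$. Decide whether $t$ is feasible. Let $W=\max(a_n,t)$. - **Frobenius.** Input: items with $a_0\ge 2$. Output: the largest infeasible $t\in\mathbb Z_{\ge 0}$. Let $W=a_n$. - **AllTargets.** Input: items. Output: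 the residue table $a[0],\dots,a[a_0-1]$, where $a[i]$ is the least feasible $t$ with $t\equiv i \pmod {a_0}$. Let $W=a_n$. **Theorem.** The following four statements are equivalent. 1. For some $\varepsilon>0$, MinConv can be solved in time $O\big(n^{2-\varepsilon}\cdot\operatorname{polylog}(W)\big)$. 2. For some $\varepsilon>0$, Unbounded SubsetSum can be solved in time $O\big((n+a_0^{2-\varepsilon})\cdot\operatorname{polylog}(W)\big)$. 3. For some $\varepsilon>0$, Frobenius can be solved in time $O\big((n+a_0^{2-\varepsilon})\cdot\operatorname{polylog}(W)\big)$. 4. For some $\varepsilon>0$, AllTargets can be solved in time $O\big((n+a_0^{2-\varepsilon})\cdot\operatorname{polylog}(W)\big)$. Here $O(f\cdot\operatorname{polylog}(W))$ means: at most $C\cdot f\cdot(1+\log(1+W))^k$ on every instance, for some constants $C,k$. The constant $\varepsilon$ may differ from statement to statement. (In particular, on instances with $n<a_0$, for example when the items are pairwise incongruent modulo $a_0$, the bounds in 2–4 are $O(a_0^{2-\varepsilon}\operatorname{polylog}(W))$ for $\varepsilon \le 1$.) -/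

import Mathlib

/-! ### A random access machine with logarithmic cost

A machine has integer registers and integer arrays (a program mentions only finitely many
of them). Programs are structured, and every elementary operation is charged one
unit plus the bit lengths of all the numbers (operands, addresses and results) it handles. -/

/-- The contents of the registers and of the arrays of the machine. -/
structure State where
  reg : ℕ → ℤ
  arr : ℕ → ℤ → ℤ

/-- The bit length of the absolute value of an integer. -/
def bitLength (z : ℤ) : ℕ := z.natAbs.size

/-- The arithmetic operations of the machine. -/
inductive ArithOp
  | add
  | sub
  | mul
  | div
  | mod

/-- Value of an arithmetic operation; `div` and `mod` are division with remainder. -/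
def ArithOp.apply : ArithOp → ℤ → ℤ → ℤ
  | .add, y, z => y + z
  | .sub, y, z => y - z
  | .mul, y, z => y * z
  | .div, y, z => y / z
  | .mod, y, z => y % z

/-- Arithmetic expressions: constants, registers, array cells, operations. -/
inductive Expr
  | lit (c : ℤ)
  | var (x : ℕ)
  | get (A : ℕ) (e : Expr)
  | op (o : ArithOp) (e f : Expr)

/-- The value of an expression. -/
def Expr.eval (s : State) : Expr → ℤ
  | .lit c => c
  | .var x => s.reg x
  | .get A e => s.arr A (e.eval s)
  | .op o e f => o.apply (e.eval s) (f.eval s)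

/-- The logarithmic cost of evaluating an expression. -/
def Expr.cost (s : State) : Expr → ℕ
  | .lit c => 1 + bitLength c
  | .var x => 1 + bitLength (s.reg x)
  | .get A e => e.cost s + 1 + bitLength (e.eval s) + bitLength (s.arr A (e.eval s))
  | .op o e f => e.cost s + f.cost s + 1 + bitLength (e.eval s) + bitLength (f.eval s)
      + bitLength (o.apply (e.eval s) (f.eval s))

/-- Programs: `set x e` is the assignment `x := e`, `put A i e` is `A[i] := e`,
`ifPos e p q` runs `p` if `0 < e` and `q` otherwise, and `loop e p` is the loop
"while `0 < e` do `p`". -/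
inductive Program
  | skip
  | set (x : ℕ) (e : Expr)
  | put (A : ℕ) (i e : Expr)
  | seq (p q : Program)
  | ifPos (e : Expr) (p q : Program)
  | loop (e : Expr) (p : Program)

/-- Store `v` in register `x`. -/
def State.setReg (s : State) (x : ℕ) (v : ℤ) : State :=
  { s with reg := Function.update s.reg x v }

/-- Store `v` in cell `i` of array `A`. -/
def State.setArr (s : State) (A : ℕ) (i v : ℤ) : State :=
  { s with arr := Function.update s.arr A (Function.update (s.arr A) i v) }

/-- `Exec p s T s'`: the program `p`, started in the state `s`, halts in the state `s'`
after time exactly `T`. -/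
inductive Exec : Program → State → ℕ → State → Prop
  | skip (s : State) : Exec .skip s 1 s
  | set (x : ℕ) (e : Expr) (s : State) :
      Exec (.set x e) s (e.cost s + 1) (s.setReg x (e.eval s))
  | put (A : ℕ) (i e : Expr) (s : State) :
      Exec (.put A i e) s (i.cost s + e.cost s + 1) (s.setArr A (i.eval s) (e.eval s))
  | seq (p q : Program) (s s' s'' : State) (T T' : ℕ) :
      Exec p s T s' → Exec q s' T' s'' → Exec (.seq p q) s (T + T') s''
  | ifTrue (e : Expr) (p q : Program) (s s' : State) (T : ℕ) :
      0 < e.eval s → Exec p s T s' → Exec (.ifPos e p q) s (e.cost s + 1 + T) s'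
  | ifFalse (e : Expr) (p q : Program) (s s' : State) (T : ℕ) :
      e.eval s ≤ 0 → Exec q s T s' → Exec (.ifPos e p q) s (e.cost s + 1 + T) s'
  | loopStop (e : Expr) (p : Program) (s : State) :
      e.eval s ≤ 0 → Exec (.loop e p) s (e.cost s + 1) s
  | loopStep (e : Expr) (p : Program) (s s' s'' : State) (T T' : ℕ) :
      0 < e.eval s → Exec p s T s' → Exec (.loop e p) s' T' s'' →
      Exec (.loop e p) s (e.cost s + 1 + T + T') s''

/-! ### Computational problems and their solvability within a time bound -/

/-- A computational problem: its instances, the initial state of the machine that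
presents an instance, and the final states that carry a correct answer. -/
structure Problem where
  Instance : Type
  input : Instance → State
  Correct : Instance → State → Prop

/-- One program answers every instance correctly within the time bound. -/
def Problem.SolvableInTime (Q : Problem) (bound : Q.Instance → ℝ) : Prop :=
  ∃ p : Program, ∀ I : Q.Instance, ∃ (T : ℕ) (s : State),
    Exec p (Q.input I) T s ∧ (T : ℝ) ≤ bound I ∧ Q.Correct I s

/-- The array that holds a finite sequence in its cells `0, …, n - 1`, and `0` elsewhere. -/
def arrayOf {n : ℕ} (a : Fin n → ℤ) : ℤ → ℤ := fun z =>
  if h : 0 ≤ z ∧ z < n then a ⟨z.toNat, by omega⟩ else 0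

/-- The polylogarithmic factor `(1 + log (1 + W)) ^ k`. -/
noncomputable def polylog (k W : ℕ) : ℝ := (1 + Real.log (1 + (W : ℝ))) ^ k

/-! ### (min,+)-convolution -/

/-- Two integer sequences of the same positive length. -/
structure SequencePair where
  n : ℕ
  pos : 0 < n
  a : Fin n → ℤ
  b : Fin n → ℤ

/-- The largest absolute value of an entry. -/
def SequencePair.maxAbs (I : SequencePair) : ℕ :=
  Finset.univ.sup fun i : Fin I.n => max (I.a i).natAbs (I.b i).natAbs

/-- Register 0 holds the length, arrays 0 and 1 hold the sequences; the answer
`c[0], …, c[n-1]` is left in array 2. -/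
def minConv : Problem where
  Instance := SequencePair
  input I :=
    { reg := fun x => if x = 0 then (I.n : ℤ) else 0
      arr := fun A => if A = 0 then arrayOf I.a else if A = 1 then arrayOf I.b else fun _ => 0 }
  Correct I s := ∀ k : Fin I.n,
    IsLeast {v : ℤ | ∃ i j : Fin I.n, (i : ℕ) + (j : ℕ) = (k : ℕ) ∧ v = I.a i + I.b j}
      (s.arr 2 ((k : ℕ) : ℤ))

/-! ### Unbounded subset sum, Frobenius and the residue table -/

/-- Item sizes `0 < a 0 < a 1 < … < a n` with greatest common divisor `1`. -/
structure Items where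
  n : ℕ
  a : Fin (n + 1) → ℕ
  pos : 0 < a 0
  strictMono : StrictMono a
  gcd_eq_one : Finset.univ.gcd a = 1

/-- The largest item size. -/
def Items.largest (S : Items) : ℕ := S.a (Fin.last S.n)

/-- `t` is a nonnegative integer combination of the item sizes. -/
def Items.Feasible (S : Items) (t : ℕ) : Prop :=
  ∃ x : Fin (S.n + 1) → ℕ, ∑ i, S.a i * x i = t

/-- The state that presents item sizes and a further number: register 0 holds the number
of items, array 0 holds the items, and register 1 holds the further number. -/
def Items.state (S : Items) (t : ℕ) : State where
  reg := fun x => if x = 0 then (S.n : ℤ) + 1 else if x = 1 then (t : ℤ) else 0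
  arr := fun A => if A = 0 then arrayOf (fun i => (S.a i : ℤ)) else fun _ => 0

/-- Given items and a target, leave `1` in register 0 if the target is feasible, and `0`
if it is not. -/
def unboundedSubsetSum : Problem where
  Instance := Items × ℕ
  input I := I.1.state I.2
  Correct I s := (I.1.Feasible I.2 ∧ s.reg 0 = 1) ∨ (¬ I.1.Feasible I.2 ∧ s.reg 0 = 0)

/-- Given items, leave the largest infeasible target in register 0. (If the smallest item
is `1`, every target is feasible; these instances are excluded.) -/
def frobeniusProblem : Problem where
  Instance := {S : Items // 2 ≤ S.a 0}
  input S := S.1.state 0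
  Correct S s := ∃ F : ℕ, IsGreatest {t : ℕ | ¬ S.1.Feasible t} F ∧ s.reg 0 = F

/-- Given items, leave in cell `i` of array 1, for every residue `i` modulo the smallest
item, the least feasible target in that residue class. -/
def allTargets : Problem where
  Instance := Items
  input S := S.state 0
  Correct S s := ∀ i : ℕ, i < S.a 0 → ∃ m : ℕ,
    IsLeast {t : ℕ | t ≡ i [MOD S.a 0] ∧ S.Feasible t} m ∧ s.arr 1 (i : ℤ) = m

/-!
The implications proved are from (min,+)-convolution to the residue table, from the table to
targets and to the Frobenius number, and from each of these two back to (min,+)-convolution.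

*From convolution to the residue table.* A least feasible target in its residue class modulo
`N = a 0` is a sum of fewer than `N` items (`Items.length_lt`). A table that is correct for sums of
at most `k` items becomes correct for sums of at most `2 * k` items by a cyclic convolution with
itself, which is part of an ordinary convolution of length `2 * N` (`Items.Table.double`). About
`log N` convolutions suffice.

*From the residue table to targets and Frobenius numbers.* A target is feasible iff it is at least
the table entry of its class, and the largest infeasible target is the largest entry minus `N`.

*Back to convolution.* Both problems give the largest infeasible target `F` if its residue modulo
`N` is known: a program for targets does so by binary search for the quotient
(`frobeniusBySearch_solves`). Such Frobenius numbers encode a three-term minimum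
`μ = min {raw i + raw j + raw k | i + j + k = T}`: entry `r` becomes an item with residue `2 * R + r`
modulo `N = 10 * R` and with a large common height, so that the sums of three items with index sum
`T` lie in a residue class of their own that sums of fewer items miss and sums of more items reach
only much later; one further item in each other class makes these classes harmless. Then
`F = floor + N * μ - N` (`TripleSum.isGreatest_infeasible`). The least value of `a i + b j - d (i + j)`
over a pair of blocks of length `m` is such a minimum, so that one Frobenius number tells whether
some threshold satisfies `a i + b j < d (i + j)`, and exhibits one (`BlockQuery.exists_frobenius`).
Cut sequences of length `n` into about `√n` blocks of length `m ≈ √n`, and determine all entries of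
the convolution by simultaneous binary searches: in each round every query either clears one of the
`n` thresholds or finishes one of the about `n` pairs of blocks (`Convolution.queryRound_runs`).
This is `O(n)` queries per round, each in time `m ^ (2 - ε)` up to logarithms, in total about
`n ^ (2 - ε / 2)`. Logarithms of `n` are not covered by `polylog W` when the entries are small; they
are absorbed by a smaller exponent, `2 - ε / 4`.

*Machine programs.* A subprogram works in private memory: its registers and arrays are relocated to
arrays from number `10` on, in one of many interleaved slots, so that every call finds memory full of
zeros (`Exec.reloc`). Time is counted in units of the word length of a bound for all numbers outside
these private slots (`Program.Runs`).
-/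

/-! ### Bit lengths and the cost of expressions -/

theorem bitLength_le_iff (z : ℤ) (m : ℕ) : bitLength z ≤ m ↔ z.natAbs < 2 ^ m :=
  Nat.size_le

theorem natAbs_lt_two_pow_bitLength (z : ℤ) : z.natAbs < 2 ^ bitLength z :=
  Nat.lt_size_self _

theorem bitLength_apply_le (o : ArithOp) (y z : ℤ) :
    bitLength (o.apply y z) ≤ bitLength y + bitLength z + 1 := by
  rw [bitLength_le_iff]
  have hy := natAbs_lt_two_pow_bitLength y
  have hz := natAbs_lt_two_pow_bitLength z
  have h1 : 2 ^ bitLength y ≤ 2 ^ (bitLength y + bitLength z) :=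
    Nat.pow_le_pow_right (by norm_num) (by omega)
  have h2 : 2 ^ bitLength z ≤ 2 ^ (bitLength y + bitLength z) :=
    Nat.pow_le_pow_right (by norm_num) (by omega)
  have h3 : 2 ^ (bitLength y + bitLength z + 1) = 2 * 2 ^ (bitLength y + bitLength z) := by ring
  cases o with
  | add => have := Int.natAbs_add_le y z; simp only [ArithOp.apply]; omega
  | sub => have := Int.natAbs_sub_le y z; simp only [ArithOp.apply]; omega
  | mul =>
    simp only [ArithOp.apply, Int.natAbs_mul]
    have h4 := Nat.mul_lt_mul'' hy hz
    rw [← pow_add] at h4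
    omega
  | div =>
    have := Int.natAbs_ediv_le_natAbs y z
    simp only [ArithOp.apply]; omega
  | mod =>
    simp only [ArithOp.apply]
    rcases eq_or_ne z 0 with rfl | hz0
    · rw [Int.emod_zero]; omega
    · have h5 := Int.emod_nonneg y hz0
      have h6 := Int.emod_lt_abs y hz0
      rw [Int.abs_eq_natAbs] at h6
      omega

/-- The number of nodes of an expression, a literal counting with its bit length. -/
def Expr.size : Expr → ℕ
  | .lit c => 1 + bitLength c
  | .var _ => 1
  | .get _ e => e.size + 1
  | .op _ e f => e.size + f.size + 1

/-- The cost of evaluating an expression is at most its weight times the word length. -/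
def Expr.weight (e : Expr) : ℕ := 4 * e.size ^ 2

/-- The registers and the arrays `0, …, 9` hold numbers of absolute value at most `X`. The arrays
from `10` on are the memory of subprograms, and nothing is required of them. -/
structure State.Bounded (X : ℕ) (s : State) : Prop where
  reg : ∀ x, (s.reg x).natAbs ≤ X
  arr : ∀ A < 10, ∀ i, (s.arr A i).natAbs ≤ X

/-- The array cells at or above array `10` that an expression reads hold numbers of absolute value
at most `X`. -/
def Expr.Readable (X : ℕ) (s : State) : Expr → Prop
  | .lit _ => True
  | .var _ => True
  | .get A e => e.Readable X s ∧ (10 ≤ A → (s.arr A (e.eval s)).natAbs ≤ X)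
  | .op _ e f => e.Readable X s ∧ f.Readable X s

theorem Expr.size_pos (e : Expr) : 0 < e.size := by
  cases e <;> simp [Expr.size]

theorem Expr.bitLength_get_le {X : ℕ} {s : State} (hs : s.Bounded X) {A : ℕ} {e : Expr}
    (he : (Expr.get A e).Readable X s) : bitLength (s.arr A (e.eval s)) ≤ X.size := by
  apply Nat.size_le_size
  rcases Nat.lt_or_ge A 10 with h | h
  · exact hs.arr A h _
  · exact he.2 h

theorem Expr.bitLength_eval_le {X : ℕ} {s : State} (hs : s.Bounded X) (e : Expr)
    (he : e.Readable X s) : bitLength (e.eval s) ≤ e.size * (X.size + 1) := by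
  induction e with
  | lit c =>
    simp only [Expr.eval, Expr.size]
    nlinarith [Nat.zero_le (bitLength c * X.size), Nat.zero_le X.size]
  | var x =>
    have : bitLength (s.reg x) ≤ X.size := Nat.size_le_size (hs.reg x)
    simp only [Expr.eval, Expr.size]; omega
  | get A e ih =>
    have := Expr.bitLength_get_le hs he
    simp only [Expr.eval, Expr.size]; nlinarith [Nat.zero_le (e.size * (X.size + 1))]
  | op o e f ihe ihf =>
    have h1 := ihe he.1
    have h2 := ihf he.2
    have h3 := bitLength_apply_le o (e.eval s) (f.eval s)
    simp only [Expr.eval, Expr.size]; nlinarith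

theorem Expr.cost_le {X : ℕ} {s : State} (hs : s.Bounded X) (e : Expr)
    (he : e.Readable X s) : e.cost s ≤ e.weight * (X.size + 1) := by
  unfold Expr.weight
  induction e with
  | lit c =>
    simp only [Expr.cost, Expr.size]
    have : 1 + bitLength c ≤ (1 + bitLength c) ^ 2 * (X.size + 1) := by
      calc 1 + bitLength c ≤ (1 + bitLength c) ^ 2 := Nat.le_self_pow two_ne_zero _
        _ ≤ _ := Nat.le_mul_of_pos_right _ (by omega)
    linarith
  | var x =>
    have : bitLength (s.reg x) ≤ X.size := Nat.size_le_size (hs.reg x)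
    simp only [Expr.cost, Expr.size]; omega
  | get A e ih =>
    have h1 := Expr.bitLength_get_le hs he
    have h2 := ih he.1
    have h3 := Expr.bitLength_eval_le hs e he.1
    have h4 := e.size_pos
    simp only [Expr.cost, Expr.size]
    have h5 : 4 * (e.size + 1) ^ 2 * (X.size + 1)
      = 4 * e.size ^ 2 * (X.size + 1) + 8 * (e.size * (X.size + 1)) + 4 * (X.size + 1) := by ring
    omega
  | op o e f ihe ihf =>
    have h1 := ihe he.1
    have h2 := ihf he.2
    have h3 := bitLength_apply_le o (e.eval s) (f.eval s)
    have h4 := Expr.bitLength_eval_le hs e he.1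
    have h5 := Expr.bitLength_eval_le hs f he.2
    simp only [Expr.cost, Expr.size]
    have h6 : 4 * (e.size + f.size + 1) ^ 2 * (X.size + 1)
      = 4 * e.size ^ 2 * (X.size + 1) + 4 * f.size ^ 2 * (X.size + 1)
        + 8 * (e.size * (X.size + 1)) + 8 * (f.size * (X.size + 1))
        + 8 * (e.size * f.size * (X.size + 1)) + 4 * (X.size + 1) := by ring
    have h7 := Nat.zero_le (e.size * f.size * (X.size + 1))
    omega

/-! ### Correctness of programs with time bounds -/

/-- Started in `s`, the program `p` halts within `N * (X.size + 1)` units of time in a state with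
property `Q`, provided that the memory of `s` is bounded by `X`; this bound is preserved. -/
def Program.Runs (X : ℕ) (p : Program) (s : State) (N : ℕ) (Q : State → Prop) : Prop :=
  s.Bounded X → ∃ T s', Exec p s T s' ∧ T ≤ N * (X.size + 1) ∧ s'.Bounded X ∧ Q s'

/-- An upper bound for the running time of loop-free programs, in units of the word length. -/
def Program.weight : Program → ℕ
  | .skip => 1
  | .set _ e => e.weight + 1
  | .put _ i e => i.weight + e.weight + 1
  | .seq p q => p.weight + q.weight
  | .ifPos e p q => e.weight + 1 + p.weight + q.weight
  | .loop e p => e.weight + 1 + p.weight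

/-- The weakest precondition of a loop-free program for the postcondition `Q`, including the
demand that the memory stays bounded by `X`. -/
def Program.wp (X : ℕ) : Program → State → (State → Prop) → Prop
  | .skip, s, Q => Q s
  | .set x e, s, Q => e.Readable X s ∧ (e.eval s).natAbs ≤ X ∧ Q (s.setReg x (e.eval s))
  | .put A i e, s, Q => i.Readable X s ∧ e.Readable X s ∧ (A < 10 → (e.eval s).natAbs ≤ X) ∧
      Q (s.setArr A (i.eval s) (e.eval s))
  | .seq p q, s, Q => p.wp X s (fun s' => q.wp X s' Q)
  | .ifPos e p q, s, Q => e.Readable X s ∧ (0 < e.eval s → p.wp X s Q) ∧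
      (e.eval s ≤ 0 → q.wp X s Q)
  | .loop _ _, _, _ => False

theorem State.Bounded.setReg {X : ℕ} {s : State} (hs : s.Bounded X) (x : ℕ) {v : ℤ}
    (hv : v.natAbs ≤ X) : (s.setReg x v).Bounded X where
  reg y := by
    simp only [State.setReg, Function.update_apply]
    split_ifs
    exacts [hv, hs.reg y]
  arr := hs.arr

theorem State.Bounded.setArr {X : ℕ} {s : State} (hs : s.Bounded X) (A : ℕ) (i : ℤ) {v : ℤ}
    (hv : A < 10 → v.natAbs ≤ X) : (s.setArr A i v).Bounded X where
  reg := hs.reg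
  arr B hB z := by
    simp only [State.setArr, Function.update_apply]
    split_ifs with h
    · rw [Function.update_apply]
      split_ifs
      exacts [hv (h ▸ hB), hs.arr A (h ▸ hB) z]
    · exact hs.arr B hB z

theorem Program.Runs.mono {X : ℕ} {p : Program} {s : State} {N N' : ℕ} {Q Q' : State → Prop}
    (h : p.Runs X s N Q) (hN : N ≤ N') (hQ : ∀ s', s'.Bounded X → Q s' → Q' s') :
    p.Runs X s N' Q' := by
  intro hs
  obtain ⟨T, s', h1, h2, h3, h4⟩ := h hs
  exact ⟨T, s', h1, h2.trans (Nat.mul_le_mul_right _ hN), h3, hQ s' h3 h4⟩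

theorem Program.Runs.seq {X : ℕ} {p q : Program} {s : State} {N N' : ℕ} {Q Q' : State → Prop}
    (h : p.Runs X s N Q') (h' : ∀ s', Q' s' → q.Runs X s' N' Q) :
    (Program.seq p q).Runs X s (N + N') Q := by
  intro hs
  obtain ⟨T, s', h1, h2, h3, h4⟩ := h hs
  obtain ⟨T', s'', h5, h6, h7, h8⟩ := h' s' h4 h3
  exact ⟨T + T', s'', .seq _ _ _ _ _ _ _ h1 h5, by rw [add_mul]; omega, h7, h8⟩

theorem Program.Runs.of_wp {X : ℕ} {p : Program} {s : State} {Q : State → Prop}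
    (h : p.wp X s Q) : p.Runs X s p.weight Q := by
  induction p generalizing s Q with
  | skip =>
    exact fun hs => ⟨1, s, .skip s, by simp [Program.weight], hs, h⟩
  | set x e =>
    intro hs
    refine ⟨_, _, .set x e s, ?_, hs.setReg x h.2.1, h.2.2⟩
    have := e.cost_le hs h.1
    simp only [Program.weight, add_mul] at this ⊢; omega
  | put A i e =>
    intro hs
    refine ⟨_, _, .put A i e s, ?_, hs.setArr A _ h.2.2.1, h.2.2.2⟩
    have := e.cost_le hs h.2.1
    have := i.cost_le hs h.1
    simp only [Program.weight, add_mul] at *; omega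
  | seq p q ihp ihq => exact Program.Runs.seq (ihp h) fun s' hs' => ihq hs'
  | ifPos e p q ihp ihq =>
    intro hs
    have hc := e.cost_le hs h.1
    rcases lt_or_ge 0 (e.eval s) with he | he
    · obtain ⟨T, s', h1, h2, h3, h4⟩ := ihp (h.2.1 he) hs
      refine ⟨_, s', .ifTrue e p q s s' T he h1, ?_, h3, h4⟩
      simp only [Program.weight, add_mul] at *; omega
    · obtain ⟨T, s', h1, h2, h3, h4⟩ := ihq (h.2.2 he) hs
      refine ⟨_, s', .ifFalse e p q s s' T he h1, ?_, h3, h4⟩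
      simp only [Program.weight, add_mul] at *; omega
  | loop e p => exact h.elim

theorem Program.Runs.block {X : ℕ} {p : Program} {s : State} {N : ℕ} {Q : State → Prop}
    (hN : p.weight ≤ N) (h : p.wp X s Q) : p.Runs X s N Q :=
  (Program.Runs.of_wp h).mono hN fun _ _ h => h

/-- Loops with invariant `I` and variant `f`. -/
theorem Program.Runs.loop {X : ℕ} {e : Expr} {p : Program} {N : ℕ} (I : State → Prop)
    (f : State → ℕ) (hI : ∀ s, I s → s.Bounded X → e.Readable X s)
    (hp : ∀ s, I s → 0 < e.eval s → p.Runs X s N fun s' => I s' ∧ f s' < f s)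
    {s : State} (hs : I s) :
    (Program.loop e p).Runs X s (f s * (N + e.weight + 1) + e.weight + 1)
      fun s' => I s' ∧ e.eval s' ≤ 0 := by
  induction hk : f s using Nat.strong_induction_on generalizing s with
  | _ k ih =>
    intro hB
    have hc := e.cost_le hB (hI s hs hB)
    rcases lt_or_ge 0 (e.eval s) with he | he
    · obtain ⟨T, s', h1, h2, h3, h4, h5⟩ := hp s hs he hB
      obtain ⟨T', s'', h6, h7, h8, h9⟩ := ih (f s') (hk ▸ h5) h4 rfl h3
      refine ⟨_, s'', .loopStep e p s s' s'' T T' he h1 h6, ?_, h8, h9⟩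
      have h10 : (f s' + 1) * (N + e.weight + 1) ≤ k * (N + e.weight + 1) :=
        Nat.mul_le_mul_right _ (by omega)
      have h11 := Nat.mul_le_mul_right (X.size + 1) h10
      simp only [add_mul, one_mul] at *; omega
    · refine ⟨_, s, .loopStop e p s he, ?_, hB, hs, he⟩
      simp only [add_mul, one_mul] at *; omega

/-- `for c = 0, 1, …, n - 1 do p`, where the number `n` is held in register `n`. -/
def Program.forLoop (c n : ℕ) (p : Program) : Program :=
  .seq (.set c (.lit 0)) (.loop (.op .sub (.var n) (.var c))
    (.seq p (.set c (.op .add (.var c) (.lit 1)))))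

/-- The time bound for a loop of `M` rounds of time `N` each, up to a constant that absorbs the
loop control. -/
def forTime (M N : ℕ) : ℕ := M * (N + 200) + 200

theorem Program.Runs.forLoop {X : ℕ} {c n : ℕ} {p : Program} {N M : ℕ} (hX : M ≤ X)
    (I : ℕ → State → Prop) {s : State} (hcn : c ≠ n) (hn : s.reg n = M)
    (h0 : I 0 (s.setReg c 0))
    (hp : ∀ i < M, ∀ s : State, s.reg n = (M : ℤ) → s.reg c = (i : ℤ) → I i s → p.Runs X s N fun s' =>
      s'.reg c = i ∧ s'.reg n = M ∧ I (i + 1) (s'.setReg c (i + 1))) :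
    (Program.forLoop c n p).Runs X s (forTime M N) fun s' =>
      s'.reg n = M ∧ s'.reg c = M ∧ I M s' := by
  have key := Program.Runs.loop (X := X) (e := .op .sub (.var n) (.var c))
    (p := .seq p (.set c (.op .add (.var c) (.lit 1)))) (N := N + 101)
    (I := fun s => s.reg n = M ∧ ∃ i ≤ M, s.reg c = i ∧ I i s)
    (f := fun s => M - (s.reg c).toNat) (fun _ _ _ => ⟨trivial, trivial⟩) ?_
    (s := s.setReg c 0) ?_
  · have h := Program.Runs.seq (Program.Runs.of_wp (X := X) (s := s) (p := .set c (.lit 0))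
      (Q := fun s' => s' = s.setReg c 0) ⟨trivial, by simp [Expr.eval], rfl⟩)
      (fun s' (hs' : s' = _) => by rw [hs']; exact key)
    refine h.mono ?_ ?_
    · simp [Program.weight, Expr.weight, Expr.size, forTime, State.setReg, bitLength]
      nlinarith
    · rintro s' - ⟨⟨h1, i, hi, h2, h3⟩, h4⟩
      simp only [Expr.eval, ArithOp.apply, h1, h2] at h4
      obtain rfl : i = M := by omega
      exact ⟨h1, h2, h3⟩
  · rintro s ⟨h1, i, hi, h2, h3⟩ h4
    simp only [Expr.eval, ArithOp.apply, h1, h2] at h4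
    have hi : i < M := by omega
    refine (Program.Runs.seq (hp i hi s h1 h2 h3) (N' := 101) ?_).mono le_rfl fun _ _ h => h
    rintro s' ⟨h5, h6, h7⟩
    refine Program.Runs.block (by
      simp [Program.weight, Expr.weight, Expr.size, bitLength]) ⟨⟨trivial, trivial⟩, ?_, ?_⟩
    · simp only [Expr.eval, ArithOp.apply, h5]; omega
    · simp only [Expr.eval, ArithOp.apply, h5]
      refine ⟨⟨?_, i + 1, hi, ?_, h7⟩, ?_⟩
      · simp [State.setReg, hcn.symm, h6]
      · simp [State.setReg]
      · simp [State.setReg, h2]; omega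
  · refine ⟨by simp [State.setReg, hcn.symm, hn], 0, Nat.zero_le _, by simp [State.setReg], h0⟩

/-! ### Subprograms in private memory -/

/-- Register `8` holds the number `L` of memory slots, register `9` the current slot `j`; the
index `i` of a private array is translated to `i * L + j`. -/
def Expr.addr (e : Expr) : Expr := .op .add (.op .mul e (.var 8)) (.var 9)

/-- The expression with its registers relocated to array `10` and its array `A` to array `11 + A`,
in the current slot. -/
def Expr.reloc : Expr → Expr
  | .lit c => .lit c
  | .var x => .get 10 (.addr (.lit x))
  | .get A e => .get (11 + A) (.addr e.reloc)
  | .op o e f => .op o e.reloc f.reloc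

/-- The program that works in the private memory of the current slot. -/
def Program.reloc : Program → Program
  | .skip => .skip
  | .set x e => .put 10 (.addr (.lit x)) e.reloc
  | .put A i e => .put (11 + A) (.addr i.reloc) e.reloc
  | .seq p q => .seq p.reloc q.reloc
  | .ifPos e p q => .ifPos e.reloc p.reloc q.reloc
  | .loop e p => .loop e.reloc p.reloc

/-- The state that a relocated program sees in slot `j` of `L`. -/
def State.view (s : State) (L j : ℕ) : State where
  reg x := s.arr 10 (x * L + j)
  arr A i := s.arr (11 + A) (i * L + j)

/-- The state in which all memory is `0`. -/
def State.zero : State := ⟨fun _ => 0, fun _ _ => 0⟩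

@[ext] theorem State.ext' {s t : State} (h : s.reg = t.reg) (h' : s.arr = t.arr) : s = t := by
  cases s; cases t; simp_all

theorem slot_eq_iff {L j j' : ℕ} (hj : j < L) (hj' : j' < L) (i i' : ℤ) :
    i * L + j = i' * L + j' ↔ i = i' ∧ j = j' := by
  constructor
  · intro h
    have hL : (L : ℤ) ≠ 0 := by omega
    have h0 : (j + i * L : ℤ) = j' + i' * L := by linarith
    have h1 : (j + i * L : ℤ) % L = (j' + i' * L) % L := by rw [h0]
    have h2 : (j + i * L : ℤ) / L = (j' + i' * L) / L := by rw [h0]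
    simp only [Int.add_mul_emod_self_right, Int.add_mul_ediv_right _ _ hL] at h1 h2
    rw [Int.emod_eq_of_lt (by omega) (by omega), Int.emod_eq_of_lt (by omega) (by omega)] at h1
    rw [Int.ediv_eq_zero_of_lt (by omega) (by omega), Int.ediv_eq_zero_of_lt (by omega)
      (by omega)] at h2
    omega
  · rintro ⟨rfl, rfl⟩; rfl

theorem State.view_setReg (s : State) (x : ℕ) (v : ℤ) (L j : ℕ) :
    (s.setReg x v).view L j = s.view L j := rfl

theorem State.view_setArr_reg (s : State) {L j j' : ℕ} (hj : j < L) (hj' : j' < L) (x : ℕ) (v : ℤ) :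
    (s.setArr 10 (x * L + j) v).view L j' =
      if j' = j then (s.view L j').setReg x v else s.view L j' := by
  split_ifs with h
  · subst h
    ext y i
    · simp only [State.view, State.setArr, State.setReg, Function.update_apply, if_true,
        slot_eq_iff hj' hj', and_true, Nat.cast_inj]
    · simp [State.view, State.setArr, State.setReg, Function.update_apply,
        show 11 + y ≠ 10 by omega]
  · ext y i
    · simp [State.view, State.setArr, Function.update_apply, slot_eq_iff hj' hj, h]
    · simp [State.view, State.setArr, Function.update_apply, show 11 + y ≠ 10 by omega]

theorem State.view_setArr (s : State) {L j j' : ℕ} (hj : j < L) (hj' : j' < L) (A : ℕ) (i v : ℤ) :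
    (s.setArr (11 + A) (i * L + j) v).view L j' =
      if j' = j then (s.view L j').setArr A i v else s.view L j' := by
  split_ifs with h
  · subst h
    ext y k
    · simp [State.view, State.setArr, Function.update_apply, show 10 ≠ 11 + A by omega]
    · simp only [State.view, State.setArr, Function.update_apply, Nat.add_left_cancel_iff]
      split_ifs with h1
      · subst h1
        simp only [Function.update_apply, slot_eq_iff hj' hj', and_true]
      · rfl
  · ext y k
    · simp [State.view, State.setArr, Function.update_apply, show 10 ≠ 11 + A by omega]
    · simp only [State.view, State.setArr, Function.update_apply, Nat.add_left_cancel_iff]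
      split_ifs with h1
      · subst h1
        simp [slot_eq_iff hj' hj, h]
      · rfl

/-- The factor by which relocation slows down the evaluation of an expression, up to the bit
lengths of the slot parameters. -/
def Expr.slowdown : Expr → ℕ
  | .lit _ => 1
  | .var x => 15 + 6 * bitLength x
  | .get _ e => e.slowdown + 15
  | .op _ e f => e.slowdown + f.slowdown

/-- The factor by which relocation slows down a program, up to the bit lengths of the slot
parameters. -/
def Program.slowdown : Program → ℕ
  | .skip => 1
  | .set x e => e.slowdown + 15 + 6 * bitLength x
  | .put _ i e => i.slowdown + e.slowdown + 15
  | .seq p q => p.slowdown + q.slowdown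
  | .ifPos e p q => e.slowdown + 1 + p.slowdown + q.slowdown
  | .loop e p => e.slowdown + 1 + p.slowdown

theorem Expr.eval_addr {s : State} {L j : ℕ} (h8 : s.reg 8 = L) (h9 : s.reg 9 = j) (e : Expr) :
    e.addr.eval s = e.eval s * L + j := by
  simp [Expr.addr, Expr.eval, ArithOp.apply, h8, h9]

theorem Expr.eval_reloc {s : State} {L j : ℕ} (h8 : s.reg 8 = L) (h9 : s.reg 9 = j) (e : Expr) :
    e.reloc.eval s = e.eval (s.view L j) := by
  induction e with
  | lit c => rfl
  | var x => simp [Expr.reloc, Expr.eval, Expr.eval_addr h8 h9, State.view]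
  | get A e ih => simp [Expr.reloc, Expr.eval, Expr.eval_addr h8 h9, State.view, ih]
  | op o e f ihe ihf => simp [Expr.reloc, Expr.eval, ihe, ihf]

theorem Expr.cost_addr_le {s : State} {L j : ℕ} (h8 : s.reg 8 = L) (h9 : s.reg 9 = j) (e : Expr) :
    e.addr.cost s + bitLength (e.addr.eval s) ≤
      e.cost s + 5 * bitLength (e.eval s) + 6 * (1 + bitLength L + bitLength j) + 4 := by
  simp only [Expr.addr, Expr.cost, Expr.eval, ArithOp.apply, h8, h9]
  have h1 := bitLength_apply_le .mul (e.eval s) L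
  have h2 := bitLength_apply_le .add (e.eval s * L) j
  simp only [ArithOp.apply] at h1 h2
  omega

theorem Expr.bitLength_eval_lt_cost (s : State) (e : Expr) : bitLength (e.eval s) < e.cost s := by
  cases e <;> simp only [Expr.eval, Expr.cost] <;> omega

theorem Expr.cost_reloc_le {s : State} {L j : ℕ} (h8 : s.reg 8 = L) (h9 : s.reg 9 = j) (e : Expr) :
    e.reloc.cost s ≤ e.slowdown * (1 + bitLength L + bitLength j) * e.cost (s.view L j) := by
  generalize hβ : 1 + bitLength L + bitLength j = β
  have hβ1 : 1 ≤ β := by omega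
  induction e with
  | lit c =>
    simp only [Expr.reloc, Expr.cost, Expr.slowdown, one_mul]
    exact Nat.le_mul_of_pos_left _ hβ1
  | var x =>
    have h1 := Expr.cost_addr_le h8 h9 (.lit x)
    have h2 := Expr.eval_reloc h8 h9 (.var x)
    simp only [Expr.reloc, Expr.cost, Expr.slowdown, Expr.eval, hβ] at *
    rw [h2]
    generalize bitLength ((s.view L j).reg x) = v
    generalize bitLength x = w at *
    have h3 : (15 + 6 * w) * β * (1 + v) = 15 * β + 6 * (w * β) + 15 * (β * v) + 6 * (w * β * v) := by
      ring
    have h4 := Nat.mul_le_mul_left w hβ1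
    have h5 := Nat.mul_le_mul_right v hβ1
    omega
  | get A e ih =>
    have h1 := Expr.cost_addr_le h8 h9 e.reloc
    have h2 := Expr.eval_reloc h8 h9 (.get A e)
    have h3 := Expr.bitLength_eval_lt_cost (s.view L j) e
    simp only [Expr.reloc, Expr.cost, Expr.slowdown, Expr.eval, hβ] at *
    rw [h2]
    rw [Expr.eval_reloc h8 h9 e] at h1
    generalize bitLength ((s.view L j).arr A (e.eval (s.view L j))) = v
    generalize bitLength (e.eval (s.view L j)) = u at *
    generalize e.cost (s.view L j) = c at *
    have h5 : (e.slowdown + 15) * β * (c + 1 + u + v)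
      = e.slowdown * β * c + e.slowdown * β * (1 + u + v) + 15 * (β * (c + u)) + 15 * (β * v)
        + 15 * β := by ring
    have h6 := Nat.mul_le_mul_right v hβ1
    have h7 := Nat.mul_le_mul_right (c + u) hβ1
    have h8 := Nat.zero_le (e.slowdown * β * (1 + u + v))
    omega
  | op o e f ihe ihf =>
    simp only [Expr.reloc, Expr.cost, Expr.slowdown]
    rw [Expr.eval_reloc h8 h9, Expr.eval_reloc h8 h9]
    generalize e.cost (s.view L j) = c at *
    generalize f.cost (s.view L j) = d at *
    obtain ⟨r, hr⟩ : ∃ r, r = 1 + bitLength (e.eval (s.view L j)) +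
      bitLength (f.eval (s.view L j)) +
      bitLength (o.apply (e.eval (s.view L j)) (f.eval (s.view L j))) := ⟨_, rfl⟩
    have hs : 1 ≤ e.slowdown := by
      clear * -
      induction e <;> simp only [Expr.slowdown] <;> omega
    have h5 : (e.slowdown + f.slowdown) * β * (c + d + r) = e.slowdown * β * c + f.slowdown * β * d
      + e.slowdown * β * d + f.slowdown * β * (c + r) + e.slowdown * β * r := by ring
    have h6 := Nat.zero_le (e.slowdown * β * d)
    have h7 := Nat.zero_le (f.slowdown * β * (c + r))
    have h8 : 1 * 1 * r ≤ e.slowdown * β * r :=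
      Nat.mul_le_mul_right _ (Nat.mul_le_mul hs hβ1)
    have h9 : c + d + 1 + bitLength (e.eval (s.view L j)) + bitLength (f.eval (s.view L j)) +
      bitLength (o.apply (e.eval (s.view L j)) (f.eval (s.view L j))) = c + d + r := by omega
    rw [h9, h5]
    omega

/-- The part of the memory that a relocated program leaves alone: the registers, the arrays
`0, …, 9` and the other slots. -/
structure State.SameOutside (L j : ℕ) (s s' : State) : Prop where
  reg : s'.reg = s.reg
  arr : ∀ A < 10, s'.arr A = s.arr A
  view : ∀ j' < L, j' ≠ j → s'.view L j' = s.view L j'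

theorem State.SameOutside.trans {L j : ℕ} {s s' s'' : State} (h : s.SameOutside L j s')
    (h' : s'.SameOutside L j s'') : s.SameOutside L j s'' where
  reg := h'.reg.trans h.reg
  arr A hA := (h'.arr A hA).trans (h.arr A hA)
  view j' h1 h2 := (h'.view j' h1 h2).trans (h.view j' h1 h2)

theorem State.sameOutside_refl (L j : ℕ) (s : State) : s.SameOutside L j s :=
  ⟨rfl, fun _ _ => rfl, fun _ _ _ => rfl⟩

/-- A relocated program does in the current slot what the original program does in its memory. -/
theorem Exec.reloc {p : Program} {t t' : State} {T : ℕ} (h : Exec p t T t') {L j : ℕ} (hj : j < L)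
    {s : State} (h8 : s.reg 8 = L) (h9 : s.reg 9 = j) (hv : s.view L j = t) :
    ∃ T' s', Exec p.reloc s T' s' ∧ T' ≤ p.slowdown * (1 + bitLength L + bitLength j) * T ∧
      s'.view L j = t' ∧ s.SameOutside L j s' := by
  generalize hβ : 1 + bitLength L + bitLength j = β
  have hβ1 : 1 ≤ β := by omega
  have hpos : ∀ p : Program, 1 ≤ p.slowdown := fun p => by
    induction p <;> simp only [Program.slowdown] <;> omega
  induction h generalizing s with
  | skip t =>
    exact ⟨1, s, .skip s, by simpa [Program.slowdown] using hβ1, hv, s.sameOutside_refl L j⟩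
  | set x e t =>
    subst hv
    have h1 := Expr.cost_addr_le h8 h9 (.lit x)
    have h2 := Expr.cost_reloc_le h8 h9 e
    refine ⟨_, _, .put 10 (.addr (.lit x)) e.reloc s, ?_, ?_, ?_⟩
    · simp only [Expr.cost, Expr.eval, Program.slowdown, hβ] at *
      generalize e.cost (s.view L j) = c at *
      generalize bitLength x = w at *
      have h3 : (e.slowdown + 15 + 6 * w) * β * (c + 1) = e.slowdown * β * c + e.slowdown * β
        + 15 * (β * c) + 15 * β + 6 * (w * β) + 6 * (w * β * c) := by ring
      have h4 := Nat.mul_le_mul_left w hβ1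
      omega
    · rw [Expr.eval_addr h8 h9, Expr.eval, State.view_setArr_reg _ hj hj, if_pos rfl,
        Expr.eval_reloc h8 h9]
    · refine ⟨rfl, fun A hA => ?_, fun j' h3 h4 => ?_⟩
      · simp [State.setArr, show A ≠ 10 by omega]
      · rw [Expr.eval_addr h8 h9, Expr.eval, State.view_setArr_reg _ hj h3, if_neg h4]
  | put A i e t =>
    subst hv
    have h1 := Expr.cost_addr_le h8 h9 i.reloc
    have h2 := Expr.cost_reloc_le h8 h9 e
    have h3 := Expr.cost_reloc_le h8 h9 i
    have h4 := Expr.bitLength_eval_lt_cost (s.view L j) i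
    rw [Expr.eval_reloc h8 h9] at h1
    refine ⟨_, _, .put (11 + A) (.addr i.reloc) e.reloc s, ?_, ?_, ?_⟩
    · simp only [Program.slowdown, hβ] at *
      generalize e.cost (s.view L j) = c at *
      generalize i.cost (s.view L j) = d at *
      have h3 : (i.slowdown + e.slowdown + 15) * β * (d + c + 1) = e.slowdown * β * c
        + e.slowdown * β * (d + 1) + i.slowdown * β * d + i.slowdown * β * (c + 1)
        + 15 * (β * c) + 15 * (β * d) + 15 * β := by ring
      have h5 := Nat.mul_le_mul_right d hβ1
      omega
    · rw [Expr.eval_addr h8 h9, State.view_setArr _ hj hj, if_pos rfl,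
        Expr.eval_reloc h8 h9, Expr.eval_reloc h8 h9]
    · refine ⟨rfl, fun A' hA => ?_, fun j' h3 h4 => ?_⟩
      · simp [State.setArr, show A' ≠ 11 + A by omega]
      · rw [Expr.eval_addr h8 h9, State.view_setArr _ hj h3, if_neg h4]
  | seq p q t t' t'' T T' _ _ ihp ihq =>
    obtain ⟨T1, s1, h1, h2, h3, h4⟩ := ihp h8 h9 hv
    obtain ⟨T2, s2, h5, h6, h7, h10⟩ := ihq (h4.reg ▸ h8) (h4.reg ▸ h9) h3
    refine ⟨_, s2, .seq _ _ _ _ _ _ _ h1 h5, ?_, h7, h4.trans h10⟩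
    simp only [Program.slowdown]
    have : (p.slowdown + q.slowdown) * β * (T + T') = p.slowdown * β * T + q.slowdown * β * T'
      + p.slowdown * β * T' + q.slowdown * β * T := by ring
    omega
  | ifTrue e p q t t' T he _ ih =>
    obtain ⟨T1, s1, h1, h2, h3, h4⟩ := ih h8 h9 hv
    have h5 := Expr.cost_reloc_le h8 h9 e
    refine ⟨_, s1, .ifTrue _ _ _ _ _ _ (by rwa [Expr.eval_reloc h8 h9, hv]) h1, ?_, h3, h4⟩
    simp only [Program.slowdown, hβ, hv] at *
    generalize e.cost t = c at *
    have : (e.slowdown + 1 + p.slowdown + q.slowdown) * β * (c + 1 + T)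
      = e.slowdown * β * c + β + p.slowdown * β * T + (e.slowdown * β * (1 + T) + β * (c + T)
      + p.slowdown * β * (c + 1) + q.slowdown * β * (c + 1 + T)) := by ring
    omega
  | ifFalse e p q t t' T he _ ih =>
    obtain ⟨T1, s1, h1, h2, h3, h4⟩ := ih h8 h9 hv
    have h5 := Expr.cost_reloc_le h8 h9 e
    refine ⟨_, s1, .ifFalse _ _ _ _ _ _ (by rwa [Expr.eval_reloc h8 h9, hv]) h1, ?_, h3, h4⟩
    simp only [Program.slowdown, hβ, hv] at *
    generalize e.cost t = c at *
    have : (e.slowdown + 1 + p.slowdown + q.slowdown) * β * (c + 1 + T)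
      = e.slowdown * β * c + β + q.slowdown * β * T + (e.slowdown * β * (1 + T) + β * (c + T)
      + q.slowdown * β * (c + 1) + p.slowdown * β * (c + 1 + T)) := by ring
    omega
  | loopStop e p t he =>
    have h5 := Expr.cost_reloc_le h8 h9 e
    refine ⟨_, s, .loopStop _ _ _ (by rwa [Expr.eval_reloc h8 h9, hv]), ?_, hv,
      s.sameOutside_refl L j⟩
    simp only [Program.slowdown, hβ, hv] at *
    generalize e.cost t = c at *
    have : (e.slowdown + 1 + p.slowdown) * β * (c + 1)
      = e.slowdown * β * c + β + (e.slowdown * β + β * c + p.slowdown * β * (c + 1)) := by ring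
    omega
  | loopStep e p t t' t'' T T' he _ _ ihp ihq =>
    obtain ⟨T1, s1, h1, h2, h3, h4⟩ := ihp h8 h9 hv
    obtain ⟨T2, s2, h5, h6, h7, h10⟩ := ihq (h4.reg ▸ h8) (h4.reg ▸ h9) h3
    have h11 := Expr.cost_reloc_le h8 h9 e
    refine ⟨_, s2, .loopStep _ _ _ _ _ _ _ (by rwa [Expr.eval_reloc h8 h9, hv]) h1 h5, ?_, h7,
      h4.trans h10⟩
    simp only [Program.slowdown, hβ, hv] at *
    generalize e.cost t = c at *
    have : (e.slowdown + 1 + p.slowdown) * β * (c + 1 + T + T')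
      = e.slowdown * β * c + β + p.slowdown * β * T + (e.slowdown + 1 + p.slowdown) * β * T' +
        (e.slowdown * β * (1 + T) + β * (c + T) + p.slowdown * β * (c + 1)) := by ring
    omega

/-- A call of a program that solves the problem `P`, on an instance that has been set up in the
current slot. -/
theorem Program.Runs.call {P : Problem} {p : Program} {X : ℕ} {I : P.Instance} {T L j : ℕ}
    (hp : ∃ T' s', Exec p (P.input I) T' s' ∧ T' ≤ T ∧ P.Correct I s')
    (hj : j < L) (hL : L ≤ X) {s : State} (h8 : s.reg 8 = L) (h9 : s.reg 9 = j)
    (hv : s.view L j = P.input I) :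
    p.reloc.Runs X s (2 * p.slowdown * T) fun s' =>
      P.Correct I (s'.view L j) ∧ s.SameOutside L j s' := by
  intro hs
  obtain ⟨T', t, h1, h2, h3⟩ := hp
  obtain ⟨T1, s1, h4, h5, h6, h7⟩ := h1.reloc hj h8 h9 hv
  refine ⟨T1, s1, h4, h5.trans ?_, ⟨?_, ?_⟩, by rwa [h6], h7⟩
  · have ha : bitLength (L : ℤ) ≤ X.size := Nat.size_le_size (by simpa using hL)
    have hb : bitLength (j : ℤ) ≤ X.size := Nat.size_le_size (by simpa using (by omega))
    calc _ ≤ p.slowdown * (2 * (X.size + 1)) * T :=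
          Nat.mul_le_mul (Nat.mul_le_mul_left _ (by omega)) h2
      _ = _ := by ring
  · rw [h7.reg]; exact hs.reg
  · intro A hA i
    rw [h7.arr A hA]; exact hs.arr A hA i

/-! ### Feasible targets -/

theorem Items.feasible_iff_list (S : Items) (t : ℕ) :
    S.Feasible t ↔ ∃ l : List (Fin (S.n + 1)), (l.map S.a).sum = t := by
  constructor
  · rintro ⟨x, rfl⟩
    refine ⟨(List.finRange (S.n + 1)).flatMap fun i => List.replicate (x i) i, ?_⟩
    rw [List.map_flatMap, List.flatMap, List.sum_flatten, List.map_map, ← List.ofFn_eq_map,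
      List.sum_ofFn]
    simp [mul_comm]
  · rintro ⟨l, rfl⟩
    refine ⟨fun i => l.count i, ?_⟩
    rw [Finset.sum_list_map_count]
    simp only [smul_eq_mul, mul_comm]
    refine (Finset.sum_subset (Finset.subset_univ _) fun i _ hi => ?_).symm
    rw [List.count_eq_zero_of_not_mem (by simpa using hi), zero_mul]

theorem Items.Feasible.add {S : Items} {t u : ℕ} (ht : S.Feasible t) (hu : S.Feasible u) :
    S.Feasible (t + u) := by
  rw [Items.feasible_iff_list] at *
  obtain ⟨l, rfl⟩ := ht
  obtain ⟨m, rfl⟩ := hu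
  exact ⟨l ++ m, by simp⟩

theorem Items.feasible_zero (S : Items) : S.Feasible 0 := ⟨0, by simp⟩

theorem Items.feasible_item (S : Items) (i : Fin (S.n + 1)) : S.Feasible (S.a i) :=
  (S.feasible_iff_list _).2 ⟨[i], by simp⟩

theorem Items.Feasible.add_mul {S : Items} {t : ℕ} (ht : S.Feasible t) (q : ℕ) :
    S.Feasible (t + S.a 0 * q) := by
  induction q with
  | zero => simpa
  | succ q ih => rw [mul_add, mul_one, ← add_assoc]; exact ih.add (S.feasible_item 0)

theorem Items.Feasible.of_modEq {S : Items} {t u : ℕ} (ht : S.Feasible t) (h : t ≤ u)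
    (hm : t ≡ u [MOD S.a 0]) : S.Feasible u := by
  obtain ⟨q, hq⟩ := (Nat.modEq_iff_dvd' h).1 hm
  have := ht.add_mul q
  rwa [← hq, Nat.add_sub_cancel' h] at this

theorem Items.exists_feasible_modEq (S : Items) (i : ℕ) :
    ∃ t, t ≡ i [MOD S.a 0] ∧ S.Feasible t := by
  have hspan : (1 : ℤ) ∈ Ideal.span (Set.range fun j => (S.a j : ℤ)) := by
    have h1 : Submodule.IsPrincipal (Ideal.span (Set.range fun j => (S.a j : ℤ))) := inferInstance
    obtain ⟨g, hg⟩ := h1.principal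
    have h2 : ∀ j, g ∣ (S.a j : ℤ) := fun j => by
      rw [← Ideal.mem_span_singleton]
      have : (S.a j : ℤ) ∈ Ideal.span (Set.range fun j => (S.a j : ℤ)) :=
        Ideal.subset_span ⟨j, rfl⟩
      rw [hg] at this
      exact this
    have h3 : g.natAbs ∣ Finset.univ.gcd S.a :=
      Finset.dvd_gcd fun j _ => Int.natAbs_dvd_natAbs.2 (h2 j)
    rw [S.gcd_eq_one, Nat.dvd_one] at h3
    rw [hg]
    exact Ideal.mem_span_singleton.2 (Int.isUnit_iff_natAbs_eq.2 h3).dvd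
  obtain ⟨c, hc⟩ := (Submodule.mem_span_range_iff_exists_fun ℤ).1 hspan
  have h0 : (0 : ℤ) < S.a 0 := by exact_mod_cast S.pos
  refine ⟨_, ?_, fun j => (i * c j % S.a 0).toNat, rfl⟩
  rw [← Int.natCast_modEq_iff]
  push_cast
  have h4 : (i : ℤ) = ∑ j, S.a j * (i * c j) := by
    calc (i : ℤ) = i * ∑ j, c j • (S.a j : ℤ) := by rw [hc, mul_one]
      _ = _ := Finset.mul_sum ..
      _ = _ := ?_
    refine Finset.sum_congr rfl fun j _ => ?_
    simp only [smul_eq_mul]; ring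
  conv_rhs => rw [h4]
  refine Int.ModEq.sum fun j _ => ?_
  rw [Int.toNat_of_nonneg (Int.emod_nonneg _ h0.ne')]
  exact (Int.mod_modEq _ _).mul_left _

/-- The least feasible target that is congruent to `i` modulo the smallest item. -/
noncomputable def Items.least (S : Items) (i : ℕ) : ℕ :=
  sInf {t : ℕ | t ≡ i [MOD S.a 0] ∧ S.Feasible t}

theorem Items.isLeast_least (S : Items) (i : ℕ) :
    IsLeast {t : ℕ | t ≡ i [MOD S.a 0] ∧ S.Feasible t} (S.least i) :=
  ⟨Nat.sInf_mem (S.exists_feasible_modEq i), fun _ h => Nat.sInf_le h⟩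

theorem Items.feasible_iff_least_le (S : Items) (t : ℕ) :
    S.Feasible t ↔ S.least (t % S.a 0) ≤ t := by
  have h := S.isLeast_least (t % S.a 0)
  constructor
  · intro ht
    exact h.2 ⟨(Nat.mod_modEq _ _).symm, ht⟩
  · intro ht
    exact h.1.2.of_modEq ht (h.1.1.trans (Nat.mod_modEq _ _))

/-- The largest infeasible target is the largest entry of the residue table minus the smallest
item. -/
theorem Items.isGreatest_infeasible (S : Items) (h2 : 2 ≤ S.a 0) {m : ℕ}
    (hm : ∀ i < S.a 0, S.least i ≤ m) (hm' : ∃ i < S.a 0, S.least i = m) :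
    S.a 0 ≤ m ∧ IsGreatest {t : ℕ | ¬ S.Feasible t} (m - S.a 0) := by
  have hle : S.a 0 ≤ m := by
    obtain ⟨h3, x, h4⟩ := (S.isLeast_least 1).1
    refine le_trans ?_ (hm 1 (by omega))
    have h5 : S.least 1 ≠ 0 := fun h => by
      rw [h] at h3
      have := Nat.ModEq.symm h3
      rw [Nat.modEq_zero_iff_dvd, Nat.dvd_one] at this
      omega
    obtain ⟨i, -, hi⟩ := Finset.exists_ne_zero_of_sum_ne_zero (h4 ▸ h5)
    calc S.a 0 ≤ S.a i := S.strictMono.monotone (Fin.zero_le _)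
      _ ≤ S.a i * x i := Nat.le_mul_of_pos_right _ (Nat.pos_of_ne_zero fun h => hi (by simp [h]))
      _ ≤ ∑ i, S.a i * x i := Finset.single_le_sum (f := fun i => S.a i * x i)
        (fun _ _ => Nat.zero_le _) (Finset.mem_univ i)
      _ = _ := h4
  refine ⟨hle, fun h => ?_, fun t ht => ?_⟩
  · obtain ⟨i, hi, rfl⟩ := hm'
    have h6 := (S.isLeast_least i).1.1
    have : S.least i ≤ S.least i - S.a 0 := by
      refine (S.isLeast_least i).2 ⟨?_, h⟩
      refine Nat.ModEq.trans ?_ h6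
      refine (Nat.modEq_iff_dvd' (Nat.sub_le _ _)).2 ?_
      rw [Nat.sub_sub_self hle]
    have := S.pos
    omega
  · by_contra! h
    refine ht ((S.feasible_iff_least_le t).2 ?_)
    have h7 := hm (t % S.a 0) (Nat.mod_lt _ S.pos)
    have h8 := (S.isLeast_least (t % S.a 0)).1.1.trans (Nat.mod_modEq _ _)
    by_contra! h9
    obtain ⟨q, hq⟩ := (Nat.modEq_iff_dvd' h9.le).1 h8.symm
    have : q ≠ 0 := by rintro rfl; omega
    have : S.a 0 ≤ S.a 0 * q := Nat.le_mul_of_pos_right _ (Nat.pos_of_ne_zero this)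
    omega

/-- A least feasible target in its residue class is a sum of fewer than `a 0` items: among at
least `a 0` items, some have a sum divisible by `a 0`, and can be left out. -/
theorem Items.length_lt (S : Items) {i : ℕ} {l : List (Fin (S.n + 1))}
    (hl : (l.map S.a).sum = S.least i) : l.length < S.a 0 := by
  by_contra! hlen
  have hpos : ∀ j, 0 < S.a j := fun j => S.pos.trans_le (S.strictMono.monotone (Fin.zero_le _))
  obtain ⟨p, hp, q, hq, hne, hpq⟩ := Finset.exists_ne_map_eq_of_card_lt_of_maps_to
    (s := Finset.range (S.a 0 + 1)) (t := Finset.range (S.a 0))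
    (f := fun k => ((l.take k).map S.a).sum % S.a 0) (by simp)
    (fun k _ => Finset.mem_coe.2 (Finset.mem_range.2 (Nat.mod_lt _ S.pos)))
  wlog hlt : p < q generalizing p q
  · exact this q hq p hp hne.symm hpq.symm (by omega)
  simp only [Finset.mem_range] at hp hq
  have hsplit : ∀ k, ((l.take k).map S.a).sum + ((l.drop k).map S.a).sum = S.least i := fun k => by
    rw [← hl, ← List.sum_append, ← List.map_append, List.take_append_drop]
  have h1 := hsplit p
  have h2 := hsplit q
  have h3 : ((l.take p).map S.a).sum < ((l.take q).map S.a).sum := by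
    have h4 : l.take q = l.take p ++ (l.take q).drop p := by
      conv_lhs => rw [← List.take_append_drop p (l.take q)]
      rw [List.take_take, min_eq_left hlt.le]
    rw [h4, List.map_append, List.sum_append]
    have h5 : ((l.take q).drop p).length ≠ 0 := by
      rw [List.length_drop, List.length_take]; omega
    obtain ⟨x, r, hr⟩ := List.exists_cons_of_length_pos (Nat.pos_of_ne_zero h5)
    rw [hr]
    have := hpos x
    simp; omega
  have hf : S.Feasible (((l.take p).map S.a).sum + ((l.drop q).map S.a).sum) :=
    (S.feasible_iff_list _).2 ⟨l.take p ++ l.drop q, by simp⟩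
  have h6 := (S.isLeast_least i).2 ⟨?_, hf⟩
  · omega
  · refine Nat.ModEq.trans ?_ (S.isLeast_least i).1.1
    rw [← h2]
    exact Nat.ModEq.add_right _ hpq

theorem Items.infeasible_of_isGreatest {S : Items} {F : ℕ}
    (hF : IsGreatest {t : ℕ | ¬ S.Feasible t} F) (t : ℕ) (ht : t ≡ F [MOD S.a 0]) :
    S.Feasible t ↔ F < t := by
  constructor
  · intro h
    by_contra! h1
    exact hF.1 (h.of_modEq h1 ht)
  · intro h
    by_contra h1
    exact absurd (hF.2 h1) (by omega)

/-! ### Three-term minima as Frobenius numbers -/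

/-- A sequence `raw 0, …, raw (R - 1)` of numbers at most `G`, and the index sum `T` for which the
minimum of `raw i + raw j + raw k` over `i + j + k = T` is sought. -/
structure TripleSum where
  R : ℕ
  G : ℕ
  T : ℕ
  raw : ℕ → ℕ
  pos : 0 < R
  raw_le : ∀ r < R, raw r ≤ G
  T_le : T ≤ 3 * R

namespace TripleSum

variable (D : TripleSum)

/-- The smallest item. -/
def modulus : ℕ := 10 * D.R

/-- The common part of the heights of the items that stand for entries of the sequence. It is so
large that a sum of four such items exceeds all sums of three. -/
def base : ℕ := 8 * D.R * (D.G + 1)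

/-- The item for entry `r`. Its residue is `2 * R + r`; therefore sums of at most two such items
have smaller residues than sums of three. The summand `r * (G + 1)` makes the items increase,
and contributes the constant `T * (G + 1)` to the sums of interest. -/
def item (r : ℕ) : ℕ := D.modulus * (D.base + D.raw r + r * (D.G + 1)) + 2 * D.R + r

/-- A lower bound for the sums of three items with index sum `T`, in the same residue class. -/
def floor : ℕ := D.modulus * (3 * D.base + D.T * (D.G + 1)) + 6 * D.R + D.T

/-- The items: the modulus, the items of the sequence, and one item for each residue other than
that of `floor`, just below `floor`. -/
def items (i : ℕ) : ℕ :=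
  if i = 0 then D.modulus else if i ≤ D.R then D.item (i - 1)
  else D.floor - D.modulus + (i - D.R)

theorem modulus_le_base_mul : D.modulus ≤ D.modulus * D.base :=
  Nat.le_mul_of_pos_right _ (by have := D.pos; unfold base; positivity)

theorem base_eq : D.base = 8 * (D.R * (D.G + 1)) := by unfold base; ring

theorem G_lt_mul : D.G + 1 ≤ D.R * (D.G + 1) := Nat.le_mul_of_pos_left _ D.pos

theorem item_lt_item {r r' : ℕ} (h : r < r') (hr : r < D.R) : D.item r < D.item r' := by
  unfold item
  have h1 := D.raw_le r hr
  have h2 : D.base + D.raw r + r * (D.G + 1) ≤ D.base + D.raw r' + r' * (D.G + 1) := by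
    have := Nat.mul_le_mul_right (D.G + 1) h
    rw [Nat.succ_mul] at this
    omega
  have := Nat.mul_le_mul_left D.modulus h2
  omega

theorem le_item (r : ℕ) : D.modulus * D.base < D.item r := by
  have := D.pos
  unfold item
  rw [mul_add, mul_add]; omega

theorem item_lt {r : ℕ} (hr : r < D.R) : D.item r + D.modulus < 3 * (D.modulus * D.base) := by
  have h1 := D.raw_le r hr
  have h2 := D.pos
  have h3 : D.base + D.raw r + r * (D.G + 1) + 2 ≤ 3 * D.base := by
    have := Nat.mul_le_mul_right (D.G + 1) hr.le
    have := D.G_lt_mul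
    have := D.base_eq
    omega
  have h4 := Nat.mul_le_mul_left D.modulus h3
  have h5 : D.modulus * (3 * D.base) = 3 * (D.modulus * D.base) := by ring
  rw [mul_add, h5] at h4
  unfold item
  have : D.modulus = 10 * D.R := rfl
  omega

theorem floor_ge : 3 * (D.modulus * D.base) + D.modulus * (D.T * (D.G + 1)) + 6 * D.R ≤ D.floor := by
  unfold floor
  rw [mul_add D.modulus]
  have h5 : D.modulus * (3 * D.base) = 3 * (D.modulus * D.base) := by ring
  omega

theorem floor_le : D.floor + D.modulus * (3 * D.G) ≤ 4 * (D.modulus * D.base) := by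
  have h3 : 3 * D.base + D.T * (D.G + 1) + 3 * D.G + 1 ≤ 4 * D.base := by
    have h1 := Nat.mul_le_mul_right (D.G + 1) D.T_le
    have h2 := D.G_lt_mul
    have h3 := D.base_eq
    rw [mul_assoc] at h1
    omega
  have h4 := Nat.mul_le_mul_left D.modulus h3
  have h5 : D.modulus * (3 * D.base + D.T * (D.G + 1) + 3 * D.G + 1) =
    D.modulus * (3 * D.base + D.T * (D.G + 1)) + D.modulus * (3 * D.G) + D.modulus := by ring
  have h6 : D.modulus * (4 * D.base) = 4 * (D.modulus * D.base) := by ring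
  have h7 : D.modulus = 10 * D.R := rfl
  have := D.T_le
  unfold floor
  omega

theorem items_zero : D.items 0 = D.modulus := rfl

theorem items_item {i : ℕ} (h0 : 0 < i) (h : i ≤ D.R) : D.items i = D.item (i - 1) := by
  rw [items, if_neg (by omega), if_pos h]

theorem items_filler {i : ℕ} (h : D.R < i) : D.items i = D.floor - D.modulus + (i - D.R) := by
  rw [items, if_neg (by omega), if_neg (by omega)]

theorem items_lt {i j : ℕ} (h : i < j) : D.items i < D.items j := by
  have h1 := D.modulus_le_base_mul
  have h2 := D.floor_ge
  rcases Nat.eq_zero_or_pos i with rfl | hi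
  · rw [items_zero]
    rcases Nat.lt_or_ge D.R j with hj | hj
    · rw [D.items_filler hj]; omega
    · rw [D.items_item h hj]; exact h1.trans_lt (D.le_item _)
  · rcases Nat.lt_or_ge D.R j with hj | hj
    · rw [D.items_filler hj]
      rcases Nat.lt_or_ge D.R i with hi' | hi'
      · rw [D.items_filler hi']; omega
      · rw [D.items_item hi hi']
        have := D.item_lt (r := i - 1) (by omega)
        omega
    · rw [D.items_item hi (by omega), D.items_item (by omega) hj]
      exact D.item_lt_item (by omega) (by omega)

/-- The instance that encodes the three-term minimum. -/
def toItems : Items where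
  n := D.R + D.modulus - 1
  a i := D.items i
  pos := by have := D.pos; simp [items, modulus]; omega
  strictMono i j h := D.items_lt h
  gcd_eq_one := by
    have h0 : D.modulus = 10 * D.R := rfl
    have h1 := D.pos
    have h2 := Finset.gcd_dvd (s := Finset.univ)
      (f := fun i : Fin (D.R + D.modulus - 1 + 1) => D.items i)
      (Finset.mem_univ ⟨D.R + 1, by omega⟩)
    have h3 := Finset.gcd_dvd (s := Finset.univ)
      (f := fun i : Fin (D.R + D.modulus - 1 + 1) => D.items i)
      (Finset.mem_univ ⟨D.R + 2, by omega⟩)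
    have h4 := Nat.dvd_sub h3 h2
    simp only [D.items_filler (show D.R < D.R + 1 by omega),
      D.items_filler (show D.R < D.R + 2 by omega)] at h4
    rw [show D.floor - D.modulus + (D.R + 2 - D.R) - (D.floor - D.modulus + (D.R + 1 - D.R)) = 1 by
      omega] at h4
    exact Nat.dvd_one.1 h4

theorem toItems_zero : D.toItems.a 0 = D.modulus := rfl

theorem toItems_largest : D.toItems.largest = D.floor - 1 := by
  have h0 : D.modulus = 10 * D.R := rfl
  have := D.pos
  have h2 := D.floor_ge
  have h1 := D.modulus_le_base_mul
  unfold Items.largest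
  simp only [toItems, Fin.val_last]
  rw [D.items_filler (by omega)]
  omega

/-- A sum of items, with the copies of the modulus set aside. -/
theorem exists_decomposition (l : List (Fin (D.toItems.n + 1))) :
    ∃ (c : ℕ) (l' : List ℕ), (∀ i ∈ l', 0 < i ∧ i < D.R + D.modulus) ∧
      (l.map D.toItems.a).sum = D.modulus * c + (l'.map D.items).sum := by
  induction l with
  | nil => exact ⟨0, [], by simp, by simp⟩
  | cons x l ih =>
    obtain ⟨c, l', h1, h2⟩ := ih
    rw [List.map_cons, List.sum_cons, h2]
    by_cases hx : x = 0
    · subst hx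
      refine ⟨c + 1, l', h1, ?_⟩
      rw [toItems_zero]; ring
    · refine ⟨c, x :: l', ?_, ?_⟩
      · intro i hi
        rcases List.mem_cons.1 hi with rfl | hi
        · have h3 : (x : ℕ) ≠ 0 := fun h => hx (Fin.ext h)
          have h4 : (x : ℕ) < D.R + D.modulus - 1 + 1 := x.2
          omega
        · exact h1 i hi
      · rw [List.map_cons, List.sum_cons]
        change D.items x + _ = _
        ring

theorem le_items {i : ℕ} (h0 : 0 < i) : D.modulus * D.base < D.items i := by
  rcases Nat.lt_or_ge D.R i with hi | hi
  · rw [D.items_filler hi]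
    have := D.floor_ge
    have := D.modulus_le_base_mul
    omega
  · rw [D.items_item h0 hi]; exact D.le_item _

/-- Lower bound for the feasible targets in the residue class of `floor`. Apart from copies of the
modulus, such a target is a sum of exactly three items that stand for entries: sums of at most two
have other residues, four items are too large, and so is one of the further items together with any
other item. -/
theorem le_of_feasible {μ t : ℕ} (hμ : μ ≤ 3 * D.G)
    (hmin : ∀ i < D.R, ∀ j < D.R, ∀ k < D.R, i + j + k = D.T → μ ≤ D.raw i + D.raw j + D.raw k)
    (ht : D.toItems.Feasible t) (hmod : t % D.modulus = 6 * D.R + D.T) :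
    D.floor + D.modulus * μ ≤ t := by
  have h0 : D.modulus = 10 * D.R := rfl
  have hR := D.pos
  have hT := D.T_le
  have hf := D.floor_le
  have hfg := D.floor_ge
  have hμ' := Nat.mul_le_mul_left D.modulus hμ
  have hμ'' : D.modulus * (3 * D.G) + D.modulus ≤ D.modulus * D.base := by
    rw [← Nat.mul_succ]
    refine Nat.mul_le_mul_left _ ?_
    have := D.G_lt_mul
    have := D.base_eq
    omega
  rw [Items.feasible_iff_list] at ht
  obtain ⟨l, rfl⟩ := ht
  obtain ⟨c, l', hl', hsum⟩ := D.exists_decomposition l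
  rw [hsum] at hmod ⊢
  have hmod' : ∀ k r, r < D.modulus → (l'.map D.items).sum = D.modulus * k + r →
      r = 6 * D.R + D.T := fun k r hr h => by
    rw [h, ← add_assoc, ← mul_add, Nat.mul_add_mod, Nat.mod_eq_of_lt hr] at hmod
    exact hmod
  -- An item is either an entry of the sequence or one of the fillers.
  have hcase : ∀ i ∈ l', (∃ r < D.R, D.items i =
        D.modulus * (D.base + D.raw r + r * (D.G + 1)) + (2 * D.R + r)) ∨
      ∃ d, 0 < d ∧ d < D.modulus ∧ D.items i = D.floor - D.modulus + d := fun i hi => by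
    obtain ⟨h1, h2⟩ := hl' i hi
    rcases Nat.lt_or_ge D.R i with hi | hi
    · exact .inr ⟨i - D.R, by omega, by omega, D.items_filler hi⟩
    · exact .inl ⟨i - 1, by omega, (D.items_item h1 hi).trans (add_assoc _ _ _)⟩
  have hbig : ∀ i ∈ l', D.modulus * D.base < D.items i := fun i hi => D.le_items (hl' i hi).1
  have hmb := D.modulus_le_base_mul
  match l', hcase, hbig, hmod' with
  | [], _, _, h =>
    have := h 0 0 (by omega) (by simp)
    omega
  | [x], hc, _, h =>
    simp only [List.map_cons, List.map_nil, List.sum_cons, List.sum_nil, add_zero] at h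
    rcases hc x (by simp) with ⟨r, hr, e⟩ | ⟨d, h1, h2, e⟩
    · have := h _ _ (by omega) e
      omega
    · exfalso
      set H := 3 * D.base + D.T * (D.G + 1)
      have hfl : D.floor = D.modulus * H + (6 * D.R + D.T) := add_assoc _ _ _
      have hH : 1 ≤ H := by
        have := D.G_lt_mul
        have := D.base_eq
        omega
      obtain ⟨H', hH'⟩ := Nat.exists_eq_add_of_le' hH
      rw [hH', mul_add, mul_one] at hfl
      rcases Nat.lt_or_ge (6 * D.R + D.T + d) D.modulus with h3 | h3
      · have := h H' _ h3 (by omega)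
        omega
      · have := h (H' + 1) (6 * D.R + D.T + d - D.modulus) (by omega)
          (by rw [mul_add, mul_one]; omega)
        omega
  | [x, y], hc, hb, h =>
    simp only [List.map_cons, List.map_nil, List.sum_cons, List.sum_nil, add_zero] at h ⊢
    have hx := hb x (by simp)
    have hy := hb y (by simp)
    rcases hc x (by simp) with ⟨r, hr, e⟩ | ⟨d, h1, h2, e⟩
    · rcases hc y (by simp) with ⟨r', hr', e'⟩ | ⟨d', h1', h2', e'⟩
      · have := h (D.base + D.raw r + r * (D.G + 1) + (D.base + D.raw r' + r' * (D.G + 1)))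
          (2 * D.R + r + (2 * D.R + r')) (by omega) (by rw [e, e']; ring)
        omega
      · omega
    · omega
  | [x, y, z], hc, hb, h =>
    simp only [List.map_cons, List.map_nil, List.sum_cons, List.sum_nil, add_zero] at h ⊢
    have hx := hb x (by simp)
    have hy := hb y (by simp)
    have hz := hb z (by simp)
    rcases hc x (by simp) with ⟨r, hr, e⟩ | ⟨d, h1, h2, e⟩
    · rcases hc y (by simp) with ⟨r', hr', e'⟩ | ⟨d', h1', h2', e'⟩
      · rcases hc z (by simp) with ⟨r'', hr'', e''⟩ | ⟨d'', h1'', h2'', e''⟩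
        · have h3 := h (D.base + D.raw r + r * (D.G + 1) + (D.base + D.raw r' + r' * (D.G + 1)) +
            (D.base + D.raw r'' + r'' * (D.G + 1)))
            (2 * D.R + r + (2 * D.R + r') + (2 * D.R + r'')) (by omega) (by rw [e, e', e'']; ring)
          have h4 : r + r' + r'' = D.T := by omega
          have h5 := Nat.mul_le_mul_left D.modulus (hmin r hr r' hr' r'' hr'' h4)
          have h6 : D.items x + (D.items y + D.items z) = D.floor +
              D.modulus * (D.raw r + D.raw r' + D.raw r'') := by
            rw [e, e', e'', floor, ← h4]; ring
          omega
        · omega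
      · omega
    · omega
  | x :: y :: z :: w :: rest, hc, hb, _ =>
    have hx := hb x (by simp)
    have hy := hb y (by simp)
    have hz := hb z (by simp)
    have hw := hb w (by simp)
    simp only [List.map_cons, List.sum_cons]
    omega

/-- The Frobenius number of the instance reveals the three-term minimum. -/
theorem isGreatest_infeasible {μ : ℕ}
    (hmin : ∀ i < D.R, ∀ j < D.R, ∀ k < D.R, i + j + k = D.T → μ ≤ D.raw i + D.raw j + D.raw k)
    (hex : ∃ i < D.R, ∃ j < D.R, ∃ k < D.R, i + j + k = D.T ∧ μ = D.raw i + D.raw j + D.raw k) :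
    IsGreatest {t : ℕ | ¬ D.toItems.Feasible t} (D.floor + D.modulus * μ - D.modulus) := by
  have h0 : D.modulus = 10 * D.R := rfl
  have hR := D.pos
  have hT := D.T_le
  have hfg := D.floor_ge
  have hmb := D.modulus_le_base_mul
  obtain ⟨i, hi, j, hj, k, hk, hijk, hμ⟩ := hex
  have hμG : μ ≤ 3 * D.G := by
    have := D.raw_le i hi
    have := D.raw_le j hj
    have := D.raw_le k hk
    omega
  have hfeas : ∀ x < D.R + D.modulus, D.toItems.Feasible (D.items x) := fun x hx => by
    have := D.toItems.feasible_item ⟨x, by change x < D.R + D.modulus - 1 + 1; omega⟩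
    exact this
  have htop : D.toItems.Feasible (D.floor + D.modulus * μ) := by
    have h1 := ((hfeas (i + 1) (by omega)).add (hfeas (j + 1) (by omega))).add
      (hfeas (k + 1) (by omega))
    rw [D.items_item (by omega) (by omega), D.items_item (by omega) (by omega),
      D.items_item (by omega) (by omega)] at h1
    simp only [Nat.add_sub_cancel] at h1
    convert h1 using 1
    rw [hμ]
    unfold item floor
    rw [← hijk]; ring
  have hmodf : D.floor % D.modulus = 6 * D.R + D.T := by
    unfold floor
    rw [add_assoc, Nat.mul_add_mod, Nat.mod_eq_of_lt (by omega)]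
  constructor
  · intro h
    have h1 : (D.floor + D.modulus * μ - D.modulus) % D.modulus = 6 * D.R + D.T := by
      rw [← Nat.add_mod_right, Nat.sub_add_cancel (by omega), Nat.add_mul_mod_self_left, hmodf]
    have := D.le_of_feasible hμG hmin h h1
    omega
  · intro t ht
    by_contra! hlt
    apply ht
    by_cases hr : t % D.modulus = 6 * D.R + D.T
    · have hm : t ≡ D.floor + D.modulus * μ [MOD D.modulus] := by
        rw [Nat.ModEq, hr, Nat.add_mul_mod_self_left, hmodf]
      refine htop.of_modEq ?_ hm.symm
      by_contra! h2
      obtain ⟨q, hq⟩ := (Nat.modEq_iff_dvd' h2.le).1 hm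
      have h3 : q ≠ 0 := by rintro rfl; omega
      have : D.modulus ≤ D.modulus * q := Nat.le_mul_of_pos_right _ (Nat.pos_of_ne_zero h3)
      omega
    · -- The filler of the residue class of `t` is at most `t`.
      set d := (t - (D.floor - D.modulus)) % D.modulus with hd
      have h1 : d < D.modulus := Nat.mod_lt _ (by omega)
      have h2 := Nat.div_add_mod (t - (D.floor - D.modulus)) D.modulus
      set q := (t - (D.floor - D.modulus)) / D.modulus
      have h3 : t = D.floor - D.modulus + d + D.modulus * q := by omega
      have h4 : d ≠ 0 := by
        intro h
        apply hr
        rw [h3, h, add_zero, Nat.add_mul_mod_self_left, ← Nat.add_mod_right,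
          Nat.sub_add_cancel (by omega), hmodf]
      have h5 := hfeas (D.R + d) (by omega)
      rw [D.items_filler (by omega), Nat.add_sub_cancel_left] at h5
      rw [h3]
      exact h5.add_mul q

end TripleSum

/-! ### Symbolic execution -/

@[simp] theorem State.reg_setReg (s : State) (x : ℕ) (v : ℤ) (y : ℕ) :
    (s.setReg x v).reg y = if y = x then v else s.reg y := by
  simp [State.setReg, Function.update_apply]

@[simp] theorem State.arr_setReg (s : State) (x : ℕ) (v : ℤ) : (s.setReg x v).arr = s.arr := rfl

@[simp] theorem State.reg_setArr (s : State) (A : ℕ) (i v : ℤ) : (s.setArr A i v).reg = s.reg := rfl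

@[simp] theorem State.arr_setArr (s : State) (A : ℕ) (i v : ℤ) (B : ℕ) :
    (s.setArr A i v).arr B = if B = A then Function.update (s.arr A) i v else s.arr B := by
  simp [State.setArr, Function.update_apply]

attribute [simp] Program.wp Expr.Readable Expr.eval ArithOp.apply Expr.addr State.view_setReg

@[simp] theorem State.view_setArr_reg_zero (s : State) {L j j' : ℕ} (hj : j < L) (hj' : j' < L)
    (v : ℤ) : (s.setArr 10 j v).view L j' =
      if j' = j then (s.view L j').setReg 0 v else s.view L j' := by
  simpa using s.view_setArr_reg hj hj' 0 v

@[simp] theorem State.view_setArr_reg_one (s : State) {L j j' : ℕ} (hj : j < L) (hj' : j' < L)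
    (v : ℤ) : (s.setArr 10 (L + j) v).view L j' =
      if j' = j then (s.view L j').setReg 1 v else s.view L j' := by
  simpa using s.view_setArr_reg hj hj' 1 v

@[simp] theorem State.view_setArr_arr_zero (s : State) {L j j' : ℕ} (hj : j < L) (hj' : j' < L)
    (i v : ℤ) : (s.setArr 11 (i * L + j) v).view L j' =
      if j' = j then (s.view L j').setArr 0 i v else s.view L j' := by
  simpa using s.view_setArr hj hj' 0 i v

@[simp] theorem State.view_setArr_arr_one (s : State) {L j j' : ℕ} (hj : j < L) (hj' : j' < L)
    (i v : ℤ) : (s.setArr 12 (i * L + j) v).view L j' =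
      if j' = j then (s.view L j').setArr 1 i v else s.view L j' := by
  simpa using s.view_setArr hj hj' 1 i v

/-- The array whose cells `0, …, i - 1` agree with `f`, and whose other cells are `0`. -/
def prefixArr (i : ℕ) (f : ℕ → ℤ) : ℤ → ℤ := fun z => if 0 ≤ z ∧ z < i then f z.toNat else 0

theorem prefixArr_zero (f : ℕ → ℤ) : prefixArr 0 f = fun _ => 0 := by
  ext z; simp [prefixArr]

theorem update_prefixArr (i : ℕ) (f : ℕ → ℤ) :
    Function.update (prefixArr i f) i (f i) = prefixArr (i + 1) f := by
  ext z
  simp only [Function.update_apply, prefixArr]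
  rcases lt_trichotomy z i with h | rfl | h
  · rw [if_neg (by omega)]
    congr 1
    simp only [eq_iff_iff]; push_cast; omega
  · simp
  · rw [if_neg (by omega), if_neg (by omega), if_neg (by push_cast; omega)]

theorem arrayOf_eq_prefixArr {n : ℕ} (a : Fin n → ℤ) (f : ℕ → ℤ) (h : ∀ i : Fin n, f i = a i) :
    arrayOf a = prefixArr n f := by
  ext z
  simp only [arrayOf, prefixArr]
  split_ifs with hz
  · exact (h ⟨z.toNat, by omega⟩).symm
  · rfl

theorem arrayOf_apply {n : ℕ} (a : Fin n → ℤ) {i : ℕ} (hi : i < n) : arrayOf a i = a ⟨i, hi⟩ := by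
  simp [arrayOf, hi]

theorem Items.state_eq (S : Items) (t : ℕ) (f : ℕ → ℤ) (h : ∀ i : Fin (S.n + 1), f i = S.a i) :
    S.state t = ⟨fun x => if x = 0 then (S.n : ℤ) + 1 else if x = 1 then (t : ℤ) else 0,
      fun A => if A = 0 then prefixArr (S.n + 1) f else fun _ => 0⟩ := by
  unfold Items.state
  rw [arrayOf_eq_prefixArr _ f h]

/-- Copy the items in array `0` to the current slot, with register `7` as the further number, and
run the subprogram `p` on them. -/
def callOnItems (p : Program) : Program :=
  .seq (.seq (.put 10 (.addr (.lit 0)) (.var 0)) (.put 10 (.addr (.lit 1)) (.var 7)))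
    (.seq (.forLoop 6 0 (.put 11 (.addr (.var 6)) (.get 0 (.var 6)))) p.reloc)

/-- `callOnItems p` leaves an answer in the current slot, and changes neither the other slots nor
the memory of the caller, except for a counter. -/
theorem Program.Runs.callOnItems {P : Problem} {p : Program} {X : ℕ} {I : P.Instance}
    {T L j t : ℕ} {S : Items} (hI : P.input I = S.state t)
    (hp : ∃ T' s', Exec p (P.input I) T' s' ∧ T' ≤ T ∧ P.Correct I s')
    (hj : j < L) (hL : L ≤ X) (hn : S.n + 1 ≤ X) {s : State} (h8 : s.reg 8 = L) (h9 : s.reg 9 = j)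
    (h0 : s.reg 0 = S.n + 1) (h7 : s.reg 7 = t)
    (ha : s.arr 0 = arrayOf (fun i => (S.a i : ℤ))) (hv : s.view L j = State.zero) :
    (callOnItems p).Runs X s (2000 * (S.n + 2) + 2 * p.slowdown * T) fun s' =>
      P.Correct I (s'.view L j) ∧ (∀ x ≠ 6, s'.reg x = s.reg x) ∧ (∀ A < 10, s'.arr A = s.arr A) ∧
      ∀ j' < L, j' ≠ j → s'.view L j' = s.view L j' := by
  obtain ⟨f, hf⟩ : ∃ f : ℕ → ℤ, ∀ i : Fin (S.n + 1), f i = S.a i :=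
    ⟨fun i => arrayOf (fun i => (S.a i : ℤ)) i, fun i => arrayOf_apply _ i.2⟩
  have hin := hI.trans (S.state_eq t f hf)
  rw [arrayOf_eq_prefixArr _ f hf] at ha
  have hrest : (Program.seq (.forLoop 6 0 (.put 11 (.addr (.var 6)) (.get 0 (.var 6))))
      p.reloc).Runs X ((s.setArr 10 j (S.n + 1)).setArr 10 (L + j) t)
      (forTime (S.n + 1) (Program.put 11 (.addr (.var 6)) (.get 0 (.var 6))).weight +
        2 * p.slowdown * T) fun s' =>
      P.Correct I (s'.view L j) ∧ (∀ x ≠ 6, s'.reg x = s.reg x) ∧ (∀ A < 10, s'.arr A = s.arr A) ∧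
      ∀ j' < L, j' ≠ j → s'.view L j' = s.view L j' := by
    refine Program.Runs.seq (Program.Runs.forLoop (M := S.n + 1) hn (fun i s' =>
      s'.view L j = ⟨fun x => if x = 0 then (S.n : ℤ) + 1 else if x = 1 then (t : ℤ) else 0,
          fun A => if A = 0 then prefixArr i f else fun _ => 0⟩ ∧
        (∀ x ≠ 6, s'.reg x = s.reg x) ∧ (∀ A < 10, s'.arr A = s.arr A) ∧
        ∀ j' < L, j' ≠ j → s'.view L j' = s.view L j') (by norm_num) (by simp [h0]) ?_ ?_)
      (fun s' hs' => ?_)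
    · refine ⟨?_, ?_, ?_, ?_⟩
      · simp only [State.view_setReg, State.view_setArr_reg_one _ hj hj,
          State.view_setArr_reg_zero _ hj hj, if_true, hv]
        ext x i
        · simp only [State.zero, State.reg_setReg]; grind
        · simp [State.zero, prefixArr_zero]
      · intro x hx; simp [hx]
      · intro A hA; simp [show A ≠ 10 by omega]
      · intro j' h1 h2
        simp [State.view_setArr_reg_one _ hj h1, State.view_setArr_reg_zero _ hj h1, h2]
    · rintro i hi s' - h6 ⟨h1, h2, h3, h4⟩
      refine Program.Runs.of_wp ?_
      have h8' := h2 8 (by norm_num)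
      have h9' := h2 9 (by norm_num)
      have h0' := h2 0 (by norm_num)
      have ha' := h3 0 (by norm_num)
      have hfi : prefixArr (S.n + 1) f i = f i := by
        simp only [prefixArr]; rw [if_pos (by omega)]; simp
      simp only [Program.wp, Expr.Readable, Expr.addr, Expr.eval, ArithOp.apply, h6, h8', h9', h8,
        h9, ha', ha, hfi, State.view_setReg, State.view_setArr_arr_zero _ hj hj, if_true, h1]
      refine ⟨by simp, by simp, by norm_num, h6, by simp [h0', h0], ?_, ?_, ?_, ?_⟩
      · ext x z
        · simp
        · by_cases hx : x = 0
          · subst hx; simp [update_prefixArr]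
          · simp [hx]
      · intro x hx; simp [hx, h2 x hx]
      · intro A hA; simp [show A ≠ 11 by omega, h3 A hA]
      · intro j' h5 h7
        simp [State.view_setArr_arr_zero _ hj h5, h7, h4 j' h5 h7]
    · obtain ⟨-, -, h1, h2, h3, h4⟩ := hs'
      refine (Program.Runs.call hp hj hL (by rw [h2 8 (by norm_num), h8])
        (by rw [h2 9 (by norm_num), h9]) (by rw [h1, hin])).mono le_rfl ?_
      rintro s'' - ⟨h5, h6⟩
      refine ⟨h5, fun x hx => by rw [h6.reg, h2 x hx], fun A hA => by rw [h6.arr A hA, h3 A hA],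
        fun j' h7 h8 => by rw [h6.view j' h7 h8, h4 j' h7 h8]⟩
  refine (Program.Runs.seq (Program.Runs.of_wp (Q := fun s' => s' =
    (s.setArr 10 j (S.n + 1)).setArr 10 (L + j) t) ?_) (fun s' hs' => by rw [hs']; exact hrest)).mono
    ?_ fun _ _ h => h
  · simp [h8, h9, h0, h7]
  · simp only [Program.weight, Expr.weight, Expr.size, Expr.addr, forTime, bitLength]
    norm_num
    omega

/-! ### From the residue table to targets and Frobenius numbers -/

/-- The program `p` solves the instance `I` of the problem `Q` in time `T`. -/
def Problem.SolvedBy (Q : Problem) (p : Program) (I : Q.Instance) (T : ℕ) : Prop :=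
  ∃ T' s', Exec p (Q.input I) T' s' ∧ T' ≤ T ∧ Q.Correct I s'

theorem Program.Runs.solvedBy {Q : Problem} {p : Program} {I : Q.Instance} {X N : ℕ}
    (h : p.Runs X (Q.input I) N (Q.Correct I)) (hb : (Q.input I).Bounded X) :
    Q.SolvedBy p I (N * (X.size + 1)) := by
  obtain ⟨T, s, h1, h2, -, h3⟩ := h hb
  exact ⟨T, s, h1, h2, h3⟩

theorem Items.le_largest (S : Items) (i : Fin (S.n + 1)) : S.a i ≤ S.largest :=
  S.strictMono.monotone (Fin.le_last i)

theorem Items.n_lt_largest (S : Items) : S.n < S.largest := by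
  have h : ∀ i : ℕ, (hi : i < S.n + 1) → i < S.a ⟨i, hi⟩ := by
    intro i
    induction i with
    | zero => exact fun _ => S.pos
    | succ i ih =>
      intro hi
      have h1 := ih (by omega)
      have h2 : S.a ⟨i, by omega⟩ < S.a ⟨i + 1, hi⟩ := S.strictMono (by simp)
      omega
  exact h S.n (by omega)

theorem Items.least_le (S : Items) (i : ℕ) : S.least i ≤ S.a 0 * S.largest := by
  obtain ⟨l, hl⟩ := (S.feasible_iff_list _).1 (S.isLeast_least i).1.2
  have h1 := S.length_lt hl
  have h2 := List.sum_le_card_nsmul (l.map S.a) S.largest (by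
    simp only [List.mem_map]
    rintro _ ⟨j, -, rfl⟩
    exact S.le_largest j)
  rw [hl, List.length_map, smul_eq_mul] at h2
  exact h2.trans (Nat.mul_le_mul_right _ h1.le)

theorem arrayOf_natAbs_le {n : ℕ} {a : Fin n → ℤ} {X : ℕ} (h : ∀ i, (a i).natAbs ≤ X) (z : ℤ) :
    (arrayOf a z).natAbs ≤ X := by
  unfold arrayOf
  split_ifs
  exacts [h _, by simp]

theorem Items.state_bounded (S : Items) {t X : ℕ} (h : S.largest ≤ X) (ht : t ≤ X) :
    (S.state t).Bounded X where
  reg x := by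
    have := S.n_lt_largest
    simp only [Items.state]
    split_ifs <;> omega
  arr A _ i := by
    simp only [Items.state]
    split_ifs
    · exact arrayOf_natAbs_le (fun i => by simpa using (S.le_largest i).trans h) i
    · simp

theorem Items.state_view (S : Items) (t L j : ℕ) : (S.state t).view L j = State.zero := by
  ext x i
  · simp [State.view, State.zero, Items.state]
  · simp [State.view, State.zero, Items.state]

theorem Items.arrayOf_zero (S : Items) : arrayOf (fun i => (S.a i : ℤ)) 0 = S.a 0 := by
  simp [arrayOf]

theorem Items.eq_least (S : Items) {i m : ℕ}
    (h : IsLeast {t : ℕ | t ≡ i [MOD S.a 0] ∧ S.Feasible t} m) : m = S.least i :=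
  h.unique (S.isLeast_least i)

/-- Decide a target by one look at the residue table, which is computed by `p`. -/
def targetFromTable (p : Program) : Program :=
  .seq (.set 8 (.lit 1)) (.seq (callOnItems p) (.seq (.set 3 (.get 12 (.addr
    (.op .mod (.var 1) (.get 0 (.lit 0))))))
    (.ifPos (.op .sub (.var 3) (.var 1)) (.set 0 (.lit 0)) (.set 0 (.lit 1)))))

theorem targetFromTable_solves (p : Program) : ∃ K, ∀ (S : Items) (t T : ℕ),
    allTargets.SolvedBy p S T → unboundedSubsetSum.SolvedBy (targetFromTable p) (S, t)
      (K * (S.n + 1 + T) * (Nat.size ((max S.largest t + 2) ^ 2) + 1)) := by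
  refine ⟨4000 + 2 * p.slowdown + (targetFromTable p).weight, fun S t T hp => ?_⟩
  set X := (max S.largest t + 2) ^ 2 with hX
  have hX1 : max S.largest t + 2 ≤ X := Nat.le_self_pow two_ne_zero _
  have hn := S.n_lt_largest
  have h0 := S.le_largest 0
  have hsq : S.a 0 * S.largest ≤ X := by
    rw [hX, sq]; exact Nat.mul_le_mul (by omega) (by omega)
  have key : (targetFromTable p).Runs X (S.state t)
      ((Program.set 8 (.lit 1)).weight + ((2000 * (S.n + 2) + 2 * p.slowdown * T) +
        (Program.seq (.set 3 (.get 12 (.addr (.op .mod (.var 1) (.get 0 (.lit 0))))))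
          (.ifPos (.op .sub (.var 3) (.var 1)) (.set 0 (.lit 0)) (.set 0 (.lit 1)))).weight))
      (unboundedSubsetSum.Correct (S, t)) := by
    refine Program.Runs.seq (Program.Runs.of_wp (Q := fun s' => s' = (S.state t).setReg 8 1)
      (by simp; omega)) ?_
    rintro s rfl
    refine Program.Runs.seq (Program.Runs.callOnItems (P := allTargets) (I := S) (L := 1) (j := 0)
      (t := 0) rfl hp (by norm_num) (by omega) (by omega) (by simp) (by simp [Items.state])
      (by simp [Items.state]) (by simp [Items.state]) (by simp [Items.state])
      (by rw [State.view_setReg, Items.state_view])) ?_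
    rintro s ⟨h1, h2, h3, -⟩
    refine Program.Runs.of_wp ?_
    have r1 : s.reg 1 = t := by rw [h2 1 (by norm_num)]; simp [Items.state]
    have r8 : s.reg 8 = 1 := by rw [h2 8 (by norm_num)]; simp
    have r9 : s.reg 9 = 0 := by rw [h2 9 (by norm_num)]; simp [Items.state]
    have ra : s.arr 0 0 = S.a 0 := by
      rw [h3 0 (by norm_num)]; simp [Items.state, Items.arrayOf_zero]
    have rv : s.arr 12 ((t : ℤ) % S.a 0) = S.least (t % S.a 0) := by
      obtain ⟨m, hm, h4⟩ := h1 (t % S.a 0) (Nat.mod_lt _ S.pos)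
      rw [Items.eq_least S hm] at h4
      simpa [State.view] using h4
    have hl := (S.least_le (t % S.a 0)).trans hsq
    have hf := S.feasible_iff_least_le t
    simp only [Program.wp, Expr.Readable, Expr.addr, Expr.eval, ArithOp.apply, r1, r8, r9, ra,
      mul_one, add_zero, rv, State.reg_setReg, unboundedSubsetSum]
    norm_num
    refine ⟨hl, ?_, ?_⟩
    · intro h; rw [hf]; omega
    · intro h; exact ⟨by omega, hf.2 h⟩
  have := key.solvedBy (Q := unboundedSubsetSum) (I := (S, t))
    (S.state_bounded (by omega) (by omega))
  obtain ⟨T', s', h1, h2, h3⟩ := this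
  refine ⟨T', s', h1, h2.trans (Nat.mul_le_mul_right _ ?_), h3⟩
  simp only [targetFromTable, Program.weight]
  generalize (callOnItems p).weight = c1
  generalize Expr.weight _ = c2
  generalize Expr.weight _ = c3
  generalize Expr.weight _ = c4
  generalize Expr.weight _ = c5
  nlinarith [Nat.zero_le (p.slowdown * S.n), Nat.zero_le (c1 * (S.n + T)),
    Nat.zero_le ((c2 + c3 + c4 + c5) * (S.n + T))]

/-- The largest entry of the residue table, which is computed by `p`, minus the smallest item. -/
def frobeniusFromTable (p : Program) : Program :=
  .seq (.set 8 (.lit 1)) (.seq (callOnItems p) (.seq (.set 2 (.get 0 (.lit 0)))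
    (.seq (.forLoop 6 2 (.seq (.set 4 (.get 12 (.addr (.var 6))))
      (.ifPos (.op .sub (.var 4) (.var 3)) (.set 3 (.var 4)) .skip)))
    (.set 0 (.op .sub (.var 3) (.var 2))))))

theorem frobeniusFromTable_solves (p : Program) : ∃ K, ∀ (S : {S : Items // 2 ≤ S.a 0}) (T : ℕ),
    allTargets.SolvedBy p S.1 T → frobeniusProblem.SolvedBy (frobeniusFromTable p) S
      (K * (S.1.n + S.1.a 0 + T) * (Nat.size ((S.1.largest + 2) ^ 2) + 1)) := by
  set B : Program := .seq (.set 4 (.get 12 (.addr (.var 6))))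
      (.ifPos (.op .sub (.var 4) (.var 3)) (.set 3 (.var 4)) .skip) with hB
  refine ⟨4000 + 2 * p.slowdown + (frobeniusFromTable p).weight + B.weight, ?_⟩
  rintro ⟨S, hS⟩ T hp
  set X := (S.largest + 2) ^ 2 with hX
  have hX1 : S.largest + 2 ≤ X := Nat.le_self_pow two_ne_zero _
  have hn := S.n_lt_largest
  have h0 := S.le_largest 0
  have hsq : S.a 0 * S.largest ≤ X := by
    rw [hX, sq]; exact Nat.mul_le_mul (by omega) (by omega)
  have key : (frobeniusFromTable p).Runs X (S.state 0)
      ((Program.set 8 (.lit 1)).weight + ((2000 * (S.n + 2) + 2 * p.slowdown * T) +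
        ((Program.set 2 (.get 0 (.lit 0))).weight + (forTime (S.a 0) B.weight +
        (Program.set 0 (.op .sub (.var 3) (.var 2))).weight))))
      (frobeniusProblem.Correct ⟨S, hS⟩) := by
    refine Program.Runs.seq (Program.Runs.of_wp (Q := fun s' => s' = (S.state 0).setReg 8 1)
      (by simp; omega)) ?_
    rintro s rfl
    refine Program.Runs.seq (Program.Runs.callOnItems (P := allTargets) (I := S) (L := 1) (j := 0)
      (t := 0) rfl hp (by norm_num) (by omega) (by omega) (by simp) (by simp [Items.state])
      (by simp [Items.state]) (by simp [Items.state]) (by simp [Items.state])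
      (by rw [State.view_setReg, Items.state_view])) ?_
    rintro s ⟨h1, h2, h3, -⟩
    have r3 : s.reg 3 = 0 := by rw [h2 3 (by norm_num)]; simp [Items.state]
    have r8 : s.reg 8 = 1 := by rw [h2 8 (by norm_num)]; simp
    have r9 : s.reg 9 = 0 := by rw [h2 9 (by norm_num)]; simp [Items.state]
    have ra : s.arr 0 0 = S.a 0 := by
      rw [h3 0 (by norm_num)]; simp [Items.state, Items.arrayOf_zero]
    have rv : ∀ i < S.a 0, s.arr 12 (i : ℤ) = S.least i := fun i hi => by
      obtain ⟨m, hm, h4⟩ := h1 i hi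
      rw [Items.eq_least S hm] at h4
      simpa [State.view] using h4
    refine Program.Runs.seq (Program.Runs.of_wp (Q := fun s' => s' = s.setReg 2 (S.a 0))
      (by simp [ra]; omega)) ?_
    rintro s' rfl
    refine Program.Runs.seq (Program.Runs.forLoop (M := S.a 0) (by omega) (fun i s' =>
      s'.reg 8 = 1 ∧ s'.reg 9 = 0 ∧ s'.arr = s.arr ∧ ∃ m : ℕ, s'.reg 3 = m ∧
        (∀ k < i, S.least k ≤ m) ∧ (m = 0 ∨ ∃ k < i, S.least k = m)) (by norm_num) (by simp)
        ⟨by simp [r8], by simp [r9], by simp, 0, by simp [r3], by simp, by simp⟩ ?_) ?_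
    · rintro i hi s' h5 h6 ⟨h7, h8, h9, m, h10, h11, h12⟩
      refine Program.Runs.of_wp ?_
      have hl := (S.least_le i).trans hsq
      simp only [Program.wp, Expr.Readable, Expr.addr, Expr.eval, ArithOp.apply, h6, h7, h8, h9,
        mul_one, add_zero, rv i hi, State.reg_setReg, h10, h5, State.arr_setReg]
      norm_num
      refine ⟨hl, fun hlt => ⟨hl, fun k hk => ?_, .inr ⟨i, le_rfl, rfl⟩⟩,
        fun hlt => ⟨fun k hk => ?_, ?_⟩⟩
      · rcases hk.lt_or_eq with hk | rfl
        · have := h11 k hk; omega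
        · rfl
      · rcases hk.lt_or_eq with hk | rfl
        · exact h11 k hk
        · exact hlt
      · exact h12.imp_right fun ⟨k, h13, h14⟩ => ⟨k, h13.le, h14⟩
    · rintro s' ⟨h5, -, -, -, -, m, h10, h11, h12⟩
      have h13 : ∃ k < S.a 0, S.least k = m := by
        rcases h12 with rfl | h12
        · exact ⟨0, S.pos, Nat.le_zero.1 (h11 0 S.pos)⟩
        · exact h12
      obtain ⟨h14, h15⟩ := S.isGreatest_infeasible hS h11 h13
      have h16 : m ≤ X := by
        obtain ⟨k, -, rfl⟩ := h13
        exact (S.least_le k).trans hsq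
      refine Program.Runs.of_wp ?_
      simp only [Program.wp, Expr.Readable, Expr.eval, ArithOp.apply, h5, h10, State.reg_setReg,
        frobeniusProblem]
      refine ⟨by simp, by omega, _, h15, ?_⟩
      simp; omega
  obtain ⟨T', s', h1, h2, h3⟩ := key.solvedBy (Q := frobeniusProblem) (I := ⟨S, hS⟩)
    (S.state_bounded (by omega) (by omega))
  refine ⟨T', s', h1, h2.trans (Nat.mul_le_mul_right _ ?_), h3⟩
  have h4 : (Program.set 8 (.lit 1)).weight + (Program.set 2 (.get 0 (.lit 0))).weight +
    (Program.set 0 (.op .sub (.var 3) (.var 2))).weight ≤ (frobeniusFromTable p).weight := by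
    simp only [frobeniusFromTable, Program.weight]; omega
  generalize (frobeniusFromTable p).weight = c at *
  generalize B.weight = b
  generalize p.slowdown = σ
  have h5 := S.pos
  simp only [forTime]
  nlinarith [Nat.zero_le (σ * S.n), Nat.zero_le (σ * S.a 0), Nat.zero_le (c * (S.n + T)),
    Nat.zero_le (b * (S.n + T)), Nat.mul_le_mul_left c hS]

/-! ### Frobenius numbers with a known residue -/

/-- Items whose smallest is at least `2`, together with the residue of their largest infeasible
target modulo the smallest item; leave that target in register 0. Binary search solves this
problem with few calls of a program for targets, which is not known for the Frobenius problem. -/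
def frobeniusWithResidue : Problem where
  Instance := {I : Items × ℕ // 2 ≤ I.1.a 0 ∧ ∃ F : ℕ, IsGreatest {t : ℕ | ¬ I.1.Feasible t} F ∧
    F % I.1.a 0 = I.2 ∧ F ≤ I.1.a 0 * I.1.largest}
  input I := I.1.1.state I.1.2
  Correct I s := ∃ F : ℕ, IsGreatest {t : ℕ | ¬ I.1.1.Feasible t} F ∧ s.reg 0 = F

theorem frobeniusWithResidue_of_frobenius (p : Program) (I : frobeniusWithResidue.Instance) (T : ℕ)
    (hp : frobeniusProblem.SolvedBy p ⟨I.1.1, I.2.1⟩ T) :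
    frobeniusWithResidue.SolvedBy (.seq (.set 1 (.lit 0)) p) I (T + 2) := by
  obtain ⟨T', s', h1, h2, h3⟩ := hp
  have h4 : (I.1.1.state I.1.2).setReg 1 0 = I.1.1.state 0 := by
    ext x i
    · simp only [State.reg_setReg, Items.state]; grind
    · rfl
  refine ⟨2 + T', s', .seq _ _ _ _ _ _ _ (.set 1 (.lit 0) _) ?_, by omega, h3⟩
  change Exec p ((I.1.1.state I.1.2).setReg 1 0) T' s'
  rw [h4]; exact h1

/-- One step of the search for the quotient of the largest infeasible target by the smallest item.
The quotient lies between register `3` and the sum of the registers `3` and `4`. -/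
def searchStep (p : Program) : Program :=
  .seq (.seq (.set 5 (.op .add (.op .div (.var 4) (.lit 2)) (.lit 1)))
    (.set 7 (.op .add (.var 1) (.op .mul (.var 2) (.op .add (.var 3) (.var 5))))))
  (.seq (callOnItems p)
    (.seq (.ifPos (.get 10 (.addr (.lit 0))) .skip (.set 3 (.op .add (.var 3) (.var 5))))
      (.seq (.set 4 (.op .div (.var 4) (.lit 2))) (.set 9 (.op .add (.var 9) (.lit 1))))))

/-- Binary search for the largest infeasible target with the program `p` for targets. -/
def frobeniusBySearch (p : Program) : Program :=
  .seq (.seq (.set 2 (.get 0 (.lit 0)))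
    (.seq (.set 4 (.get 0 (.op .sub (.var 0) (.lit 1)))) (.set 8 (.op .add (.var 4) (.lit 1)))))
  (.seq (.loop (.var 4) (searchStep p))
    (.set 0 (.op .add (.var 1) (.op .mul (.var 2) (.var 3)))))

/-- The state during the binary search for the quotient `Q` of the largest infeasible target. -/
structure SearchInv (S : Items) (ρ Q : ℕ) (s : State) : Prop where
  r0 : s.reg 0 = S.n + 1
  r1 : s.reg 1 = ρ
  r2 : s.reg 2 = S.a 0
  r8 : s.reg 8 = (S.largest + 1 : ℕ)
  items : s.arr 0 = arrayOf (fun i => (S.a i : ℤ))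
  state : ∃ lo u j : ℕ, s.reg 3 = lo ∧ s.reg 4 = u ∧ s.reg 9 = j ∧ lo ≤ Q ∧ Q ≤ lo + u ∧
    j + u ≤ S.largest ∧ ∀ j' < S.largest + 1, j ≤ j' → s.view (S.largest + 1) j' = State.zero

theorem searchStep_runs {p : Program} {S : Items} {F X T : ℕ}
    (hF : IsGreatest {t : ℕ | ¬ S.Feasible t} F)
    (hFl : F ≤ S.a 0 * S.largest) (hX : 4 * (S.largest + 1) ^ 2 ≤ X)
    (hp : ∀ t ≤ 4 * (S.largest + 1) ^ 2, unboundedSubsetSum.SolvedBy p (S, t) T) {s : State}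
    (hs : SearchInv S (F % S.a 0) (F / S.a 0) s) (hpos : 0 < s.reg 4) :
    (searchStep p).Runs X s (2000 * (S.n + 2) + 2 * p.slowdown * T + (searchStep p).weight)
      fun s' => SearchInv S (F % S.a 0) (F / S.a 0) s' ∧
        Nat.size (s'.reg 4).toNat < Nat.size (s.reg 4).toNat := by
  obtain ⟨r0, r1, r2, r8, items, lo, u, j, r3, r4, r9, hlo, hu, hj, hfresh⟩ := hs
  have hu0 : 0 < u := by omega
  have hX1 : S.largest + 1 ≤ (S.largest + 1) ^ 2 := Nat.le_self_pow two_ne_zero _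
  have hn := S.n_lt_largest
  have hdm := Nat.div_add_mod F (S.a 0)
  have hmod := Nat.mod_lt F S.pos
  have ha0 := S.le_largest 0
  have hQ : F / S.a 0 ≤ S.largest := by
    by_contra! h
    have := Nat.mul_le_mul_left (S.a 0) h
    rw [Nat.mul_succ] at this
    have := S.pos
    omega
  set h := u / 2 + 1 with hh
  set t := F % S.a 0 + S.a 0 * (lo + h) with ht
  have htX : t ≤ 4 * (S.largest + 1) ^ 2 := by
    have h1 : S.a 0 * (lo + h) ≤ S.largest * (2 * S.largest + 1) :=
      Nat.mul_le_mul ha0 (by omega)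
    nlinarith
  have hfeas : S.Feasible t ↔ F < t := S.infeasible_of_isGreatest hF t (by
    rw [Nat.ModEq, ht, Nat.add_mul_mod_self_left, Nat.mod_mod])
  have hFt : F < t ↔ F / S.a 0 < lo + h := by
    rw [Nat.div_lt_iff_lt_mul S.pos]
    constructor
    · intro h1
      by_contra! h2
      have h3 := (Nat.le_div_iff_mul_le S.pos).2 h2
      have := Nat.mul_le_mul_left (S.a 0) h3
      omega
    · intro h1
      rw [ht, mul_comm]; omega
  refine Program.Runs.mono (N := (Program.seq (.set 5 (.op .add (.op .div (.var 4) (.lit 2))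
      (.lit 1))) (.set 7 (.op .add (.var 1) (.op .mul (.var 2) (.op .add (.var 3)
      (.var 5)))))).weight + ((2000 * (S.n + 2) + 2 * p.slowdown * T) +
      (Program.seq (.ifPos (.get 10 (.addr (.lit 0))) .skip (.set 3 (.op .add (.var 3) (.var 5))))
      (.seq (.set 4 (.op .div (.var 4) (.lit 2)))
        (.set 9 (.op .add (.var 9) (.lit 1))))).weight)) ?_ (by
      simp only [searchStep, Program.weight]; omega) fun _ _ h => h
  refine Program.Runs.seq (Program.Runs.of_wp (Q := fun s' => s' = (s.setReg 5 h).setReg 7 t) ?_) ?_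
  · simp only [Program.wp, Expr.Readable, Expr.eval, ArithOp.apply, State.reg_setReg, r1, r2, r3,
      r4]
    have e1 : (u : ℤ) / 2 + 1 = h := by omega
    norm_num
    rw [e1]
    refine ⟨by omega, ?_, by rw [ht]; push_cast; rfl⟩
    have e2 : ((F % S.a 0 : ℕ) : ℤ) + S.a 0 * (lo + h) = t := by rw [ht]; push_cast; rfl
    push_cast at e2
    rw [e2]; omega
  rintro s' rfl
  refine Program.Runs.seq (Program.Runs.callOnItems (P := unboundedSubsetSum) (I := (S, t)) (S := S)
    (L := S.largest + 1) (j := j) (t := t) rfl (hp t htX) (by omega) (by omega) (by omega)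
    (by simpa using r8) (by simpa using r9) (by simpa using r0) (by simp) (by simpa using items)
    (by simpa using hfresh j (by omega) le_rfl)) ?_
  rintro s' ⟨h1, h2, h3, h4⟩
  have q0 : s'.reg 0 = S.n + 1 := by rw [h2 0 (by norm_num)]; simpa using r0
  have q1 : s'.reg 1 = (F % S.a 0 : ℕ) := by rw [h2 1 (by norm_num)]; simpa using r1
  have q2 : s'.reg 2 = S.a 0 := by rw [h2 2 (by norm_num)]; simpa using r2
  have q3 : s'.reg 3 = lo := by rw [h2 3 (by norm_num)]; simpa using r3
  have q4 : s'.reg 4 = u := by rw [h2 4 (by norm_num)]; simpa using r4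
  have q5 : s'.reg 5 = h := by rw [h2 5 (by norm_num)]; simp
  have q8 : s'.reg 8 = (S.largest + 1 : ℕ) := by rw [h2 8 (by norm_num)]; simpa using r8
  have q9 : s'.reg 9 = j := by rw [h2 9 (by norm_num)]; simpa using r9
  have qa : s'.arr 0 = arrayOf (fun i => (S.a i : ℤ)) := by
    rw [h3 0 (by norm_num)]; simpa using items
  have qf : ∀ j' < S.largest + 1, j + 1 ≤ j' → s'.view (S.largest + 1) j' = State.zero :=
    fun j' h5 h6 => by
      rw [h4 j' h5 (by omega)]; simpa using hfresh j' h5 (by omega)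
  have e3 : ((u : ℤ) / 2).toNat = u / 2 := by omega
  have hsize : Nat.size (u / 2) < Nat.size u := by
    conv_rhs => rw [← Nat.bit_bodd_div2 u]
    rw [Nat.size_bit (by rw [Nat.bit_bodd_div2]; omega), Nat.div2_val]
    omega
  refine Program.Runs.of_wp ?_
  have hres : s'.arr 10 j = 1 ∧ F < t ∨ s'.arr 10 j = 0 ∧ ¬ F < t := by
    rw [← hfeas]
    rcases h1 with ⟨h5, h6⟩ | ⟨h5, h6⟩
    · left; exact ⟨by simpa [State.view] using h6, h5⟩
    · right; exact ⟨by simpa [State.view] using h6, h5⟩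
  rw [hFt] at hres
  simp only [Program.wp, Expr.Readable, Expr.eval, ArithOp.apply, Expr.addr, State.reg_setReg, q3,
    q4, q5, q8, q9, zero_mul, zero_add]
  norm_num
  refine ⟨by omega, fun h5 => ⟨by omega, by omega, ?_⟩,
    fun h5 => ⟨by omega, by omega, by omega, ?_⟩⟩
  · refine ⟨⟨by simpa using q0, by simpa using q1, by simpa using q2, by simpa using q8,
      by simpa using qa, lo, u / 2, j + 1, by simp [q3], by simp, by simp, hlo, by omega, by omega,
      by simpa using qf⟩, by rwa [e3, r4]⟩
  · refine ⟨⟨by simpa using q0, by simpa using q1, by simpa using q2, by simpa using q8,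
      by simpa using qa, lo + h, u / 2, j + 1, by simp, by simp, by simp, by omega, by omega,
      by omega, by simpa using qf⟩, by rwa [e3, r4]⟩

theorem searchTime_le {n a T σ b c u v z z' : ℕ} (ha : 0 < a) (hz : z' ≤ z)
    (hc : u + v + (Expr.var 4).weight + 1 ≤ c) :
    u + ((z' * ((2000 * (n + 2) + 2 * σ * T + b) + (Expr.var 4).weight + 1) +
      (Expr.var 4).weight + 1) + v) ≤ (5000 + 2 * σ + 4 * b + c) * (n + a + T) * (z + 1) := by
  rw [show (Expr.var 4).weight = 4 from rfl] at *
  have h1 : 2000 * (n + 2) + 2 * σ * T + b + 4 + 1 ≤ (5000 + 2 * σ + 4 * b) * (n + a + T) := by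
    have := Nat.le_mul_of_pos_right b ha
    rw [show (5000 + 2 * σ + 4 * b) * (n + a + T) = 5000 * n + 5000 * a + 5000 * T + 2 * σ * T +
      4 * (b * a) + (2 * σ * (n + a) + 4 * b * (n + T)) by ring]
    omega
  have h2 := Nat.mul_le_mul hz h1
  have h3 : c ≤ c * (n + a + T) := Nat.le_mul_of_pos_right _ (by omega)
  rw [show (5000 + 2 * σ + 4 * b + c) * (n + a + T) * (z + 1) =
    z * ((5000 + 2 * σ + 4 * b) * (n + a + T)) + c * (n + a + T) +
    ((5000 + 2 * σ + 4 * b) * (n + a + T) + z * (c * (n + a + T))) by ring]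
  omega

theorem frobeniusBySearch_solves (p : Program) : ∃ K, ∀ (I : frobeniusWithResidue.Instance) (T : ℕ),
    (∀ t ≤ 4 * (I.1.1.largest + 1) ^ 2, unboundedSubsetSum.SolvedBy p (I.1.1, t) T) →
    frobeniusWithResidue.SolvedBy (frobeniusBySearch p) I
      (K * (I.1.1.n + I.1.1.a 0 + T) * (Nat.size (4 * (I.1.1.largest + 1) ^ 2) + 1) ^ 2) := by
  refine ⟨5000 + 2 * p.slowdown + 4 * (searchStep p).weight + (frobeniusBySearch p).weight, ?_⟩
  rintro ⟨⟨S, ρ⟩, hS, F, hF, hFρ, hFl⟩ T hp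
  obtain rfl : F % S.a 0 = ρ := hFρ
  replace hF : IsGreatest {t : ℕ | ¬ S.Feasible t} F := hF
  replace hFl : F ≤ S.a 0 * S.largest := hFl
  replace hp : ∀ t ≤ 4 * (S.largest + 1) ^ 2, unboundedSubsetSum.SolvedBy p (S, t) T := hp
  simp only
  set X := 4 * (S.largest + 1) ^ 2 with hX
  have hX1 : S.largest + 1 ≤ (S.largest + 1) ^ 2 := Nat.le_self_pow two_ne_zero _
  have hn := S.n_lt_largest
  have hdm := Nat.div_add_mod F (S.a 0)
  have hmod := Nat.mod_lt F S.pos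
  have ha0 := S.le_largest 0
  have hFX : F ≤ X := hFl.trans (by nlinarith)
  have hlast : arrayOf (fun i => (S.a i : ℤ)) S.n = S.largest := by
    rw [arrayOf_apply _ (Nat.lt_succ_self S.n)]; rfl
  have hQ : F / S.a 0 ≤ S.largest := by
    by_contra! h
    have := Nat.mul_le_mul_left (S.a 0) h
    rw [Nat.mul_succ] at this
    have := S.pos
    omega
  have key := Program.Runs.seq (X := X) (s := S.state (F % S.a 0)) (Q := fun s' => s'.reg 0 = F)
    (Q' := fun s' => SearchInv S (F % S.a 0) (F / S.a 0) s' ∧ s'.reg 4 = S.largest)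
    (N' := (Nat.size S.largest * ((2000 * (S.n + 2) + 2 * p.slowdown * T + (searchStep p).weight) +
        (Expr.var 4).weight + 1) + (Expr.var 4).weight + 1) +
        (Program.set 0 (.op .add (.var 1) (.op .mul (.var 2) (.var 3)))).weight)
    (p := .seq (.set 2 (.get 0 (.lit 0)))
      (.seq (.set 4 (.get 0 (.op .sub (.var 0) (.lit 1)))) (.set 8 (.op .add (.var 4) (.lit 1)))))
    (q := .seq (.loop (.var 4) (searchStep p))
      (.set 0 (.op .add (.var 1) (.op .mul (.var 2) (.var 3)))))
    (Program.Runs.of_wp ?_) ?_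
  · obtain ⟨T', s', h1, h2, -, h3⟩ := key (S.state_bounded (by omega) (by omega))
    refine ⟨T', s', h1, h2.trans ?_, F, hF, h3⟩
    rw [sq, ← mul_assoc]
    refine Nat.mul_le_mul_right _ ?_
    have h4 : (Program.seq (.set 2 (.get 0 (.lit 0)))
      (.seq (.set 4 (.get 0 (.op .sub (.var 0) (.lit 1))))
        (.set 8 (.op .add (.var 4) (.lit 1))))).weight +
      (Program.set 0 (.op .add (.var 1) (.op .mul (.var 2) (.var 3)))).weight
       + (Expr.var 4).weight + 1 ≤ (frobeniusBySearch p).weight := by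
      simp only [frobeniusBySearch, Program.weight]; omega
    exact searchTime_le S.pos (Nat.size_le_size (by omega)) h4
  · simp only [Program.wp, Expr.Readable, Expr.eval, ArithOp.apply, State.reg_setReg,
      State.arr_setReg]
    simp only [Items.state]
    norm_num
    rw [hlast, Items.arrayOf_zero]
    norm_num
    refine ⟨by omega, by omega, by omega, ?_⟩
    refine ⟨by simp, by simp, by simp, by simp, by simp, 0, S.largest, 0, by simp, by simp,
      by simp, by simp, by simpa using hQ, by omega, fun j' _ _ => ?_⟩
    simp only [State.view_setReg]
    exact S.state_view _ _ _
  · rintro s ⟨hs, hs4⟩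
    have hloop := Program.Runs.loop (X := X) (e := .var 4) (p := searchStep p)
      (SearchInv S (F % S.a 0) (F / S.a 0)) (fun s => Nat.size (s.reg 4).toNat)
      (fun _ _ _ => trivial) (fun s h h' => searchStep_runs hF hFl le_rfl hp h h') hs
    rw [hs4, Int.toNat_natCast] at hloop
    refine Program.Runs.seq hloop ?_
    rintro s' ⟨⟨r0, r1, r2, r8, items, lo, u, j, r3, r4, r9, hlo, hu, hj, hfresh⟩, he⟩
    simp only [Expr.eval, r4] at he
    obtain rfl : lo = F / S.a 0 := by omega
    refine Program.Runs.of_wp ?_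
    have e : ((F % S.a 0 : ℕ) : ℤ) + S.a 0 * (F / S.a 0 : ℕ) = F := by
      exact_mod_cast (by omega : F % S.a 0 + S.a 0 * (F / S.a 0) = F)
    simp only [Program.wp, Expr.Readable, Expr.eval, ArithOp.apply, State.reg_setReg, r1, r2, r3, e]
    norm_num
    exact hFX

/-! ### The residue table by repeated (min,+)-convolution -/

/-- `v` approximates the residue table from above: its entries below `a 0 * largest`, which
stands for infinity, are feasible targets, and no sum of at most `k` items is smaller than the
entry for its residue class. -/
structure Items.Table (S : Items) (k : ℕ) (v : ℕ → ℤ) : Prop where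
  nonneg : ∀ i < S.a 0, 0 ≤ v i
  le : ∀ i < S.a 0, v i ≤ (S.a 0 * S.largest : ℕ)
  zero : v 0 = 0
  sound : ∀ i < S.a 0, v i < (S.a 0 * S.largest : ℕ) → ∃ t, t ≡ i [MOD S.a 0] ∧ S.Feasible t ∧ v i = t
  complete : ∀ l : List (Fin (S.n + 1)), l.length ≤ k → v ((l.map S.a).sum % S.a 0) ≤ (l.map S.a).sum

/-- Cyclic (min,+)-convolution of a table with itself doubles the number of items. It is computed
by an ordinary convolution of two periods of the table, whose second half is the result. -/
theorem Items.Table.double {S : Items} {k : ℕ} {v v' : ℕ → ℤ} (h : S.Table k v)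
    (hv' : ∀ i < S.a 0, IsLeast {z : ℤ | ∃ x < 2 * S.a 0, ∃ y < 2 * S.a 0, x + y = i + S.a 0 ∧
      z = v (x % S.a 0) + v (y % S.a 0)} (v' i)) : S.Table (2 * k) v' := by
  have hpos := S.pos
  have hlt : ∀ x, x % S.a 0 < S.a 0 := fun x => Nat.mod_lt _ hpos
  have hnn : ∀ i < S.a 0, 0 ≤ v' i := fun i hi => by
    obtain ⟨x, -, y, -, -, h1⟩ := (hv' i hi).1
    rw [h1]
    exact add_nonneg (h.nonneg _ (hlt x)) (h.nonneg _ (hlt y))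
  have hle : ∀ i < S.a 0, v' i ≤ v i := fun i hi => by
    refine (hv' i hi).2 ⟨i, by omega, S.a 0, by omega, rfl, ?_⟩
    rw [Nat.mod_self, h.zero, Nat.mod_eq_of_lt hi, add_zero]
  refine ⟨hnn, fun i hi => (hle i hi).trans (h.le i hi),
    le_antisymm ((hle 0 hpos).trans h.zero.le) (hnn 0 hpos), fun i hi h1 => ?_, fun l hl => ?_⟩
  · obtain ⟨x, -, y, -, hxy, h2⟩ := (hv' i hi).1
    have hx := h.nonneg _ (hlt x)
    have hy := h.nonneg _ (hlt y)
    obtain ⟨t, ht, hft, e⟩ := h.sound _ (hlt x) (by omega)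
    obtain ⟨t', ht', hft', e'⟩ := h.sound _ (hlt y) (by omega)
    refine ⟨t + t', ?_, hft.add hft', by rw [h2, e, e']; push_cast; rfl⟩
    have := (ht.trans (Nat.mod_modEq _ _)).add (ht'.trans (Nat.mod_modEq _ _))
    rw [hxy] at this
    exact this.trans (by simp [Nat.ModEq])
  · have h1 := h.complete (l.take k) (by simp)
    have h2 := h.complete (l.drop k) (by rw [List.length_drop]; omega)
    have hsum : (l.map S.a).sum = ((l.take k).map S.a).sum + ((l.drop k).map S.a).sum := by
      rw [← List.sum_append, ← List.map_append, List.take_append_drop]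
    set t₁ := ((l.take k).map S.a).sum
    set t₂ := ((l.drop k).map S.a).sum
    rw [hsum]
    have h3 := hlt t₁
    have h4 := hlt t₂
    have h5 : (t₁ + t₂) % S.a 0 = if S.a 0 ≤ t₁ % S.a 0 + t₂ % S.a 0 then
      t₁ % S.a 0 + t₂ % S.a 0 - S.a 0 else t₁ % S.a 0 + t₂ % S.a 0 := Nat.add_mod_eq_ite
    have h6 : v' ((t₁ + t₂) % S.a 0) ≤ v (t₁ % S.a 0) + v (t₂ % S.a 0) := by
      refine (hv' _ (hlt _)).2 ?_
      split_ifs at h5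
      · exact ⟨t₁ % S.a 0, by omega, t₂ % S.a 0, by omega, by omega, by simp⟩
      · exact ⟨t₁ % S.a 0 + S.a 0, by omega, t₂ % S.a 0, by omega, by omega, by simp⟩
    push_cast
    linarith

theorem Items.Table.eq_least {S : Items} {k : ℕ} {v : ℕ → ℤ} (h : S.Table k v) (hk : S.a 0 ≤ k)
    {i : ℕ} (hi : i < S.a 0) : v i = S.least i := by
  have hl := S.isLeast_least i
  obtain ⟨l, hl'⟩ := (S.feasible_iff_list _).1 hl.1.2
  have h1 := S.length_lt hl'
  have h2 := h.complete l (by omega)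
  have h3 : S.least i % S.a 0 = i := by
    have : S.least i % S.a 0 = i % S.a 0 := hl.1.1
    rwa [Nat.mod_eq_of_lt hi] at this
  rw [hl', h3] at h2
  refine le_antisymm h2 ?_
  have h4 : S.least i < S.a 0 * S.largest := by
    have h5 := List.sum_le_card_nsmul (l.map S.a) S.largest (by
      simp only [List.mem_map]
      rintro _ ⟨j, -, rfl⟩
      exact S.le_largest j)
    rw [hl', List.length_map, smul_eq_mul] at h5
    exact h5.trans_lt (Nat.mul_lt_mul_of_pos_right h1 (Nat.zero_lt_of_lt S.n_lt_largest))
  obtain ⟨t, ht, hft, e⟩ := h.sound i hi (by omega)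
  rw [e]
  exact_mod_cast hl.2 ⟨ht, hft⟩

/-- Announce the length of the convolution instance to the subprogram. -/
def loadLength : Program := .put 10 (.addr (.lit 0)) (.var 4)

/-- Copy one entry of the table to both sequences of the convolution instance. -/
def loadEntry : Program :=
  .seq (.put 11 (.addr (.var 6)) (.get 1 (.op .mod (.var 6) (.var 2))))
    (.put 12 (.addr (.var 6)) (.get 1 (.op .mod (.var 6) (.var 2))))

/-- Copy one entry from the second half of the convolution to the table. -/
def readEntry : Program :=
  .put 1 (.var 6) (.get 13 (.addr (.op .add (.var 6) (.var 2))))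

/-- Halve register `5` and proceed to the next slot. -/
def halveAndAdvance : Program :=
  .seq (.set 5 (.op .div (.var 5) (.lit 2))) (.set 9 (.op .add (.var 9) (.lit 1)))

/-- One squaring of the table in array `1`. -/
def squareTable (p : Program) : Program :=
  .seq loadLength (.seq (.forLoop 6 4 loadEntry)
    (.seq p.reloc (.seq (.forLoop 6 2 readEntry) halveAndAdvance)))

/-- Register `2` receives the smallest item, `3` the substitute for infinity, `4` the length of the
convolutions, `5` a counter whose halving limits the number of squarings, and `8` the number of
slots. -/
def initTableRegisters : Program :=
  .seq (.set 2 (.get 0 (.lit 0)))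
    (.seq (.set 3 (.op .mul (.var 2) (.get 0 (.op .sub (.var 0) (.lit 1)))))
    (.seq (.set 4 (.op .mul (.lit 2) (.var 2)))
    (.seq (.set 5 (.var 2)) (.set 8 (.op .add (.var 2) (.lit 1))))))

/-- Set one entry of the table to infinity. -/
def clearEntry : Program := .put 1 (.var 6) (.var 3)

/-- Lower the entry in the residue class of an item to that item. -/
def enterItem : Program :=
  .seq (.set 7 (.op .mod (.get 0 (.var 6)) (.var 2)))
    (.ifPos (.op .sub (.get 1 (.var 7)) (.get 0 (.var 6)))
      (.put 1 (.var 7) (.get 0 (.var 6))) .skip)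

/-- The initial table, for sums of at most one item. -/
def initTable : Program :=
  .seq initTableRegisters (.seq (.forLoop 6 2 clearEntry)
    (.seq (.put 1 (.lit 0) (.lit 0)) (.forLoop 6 0 enterItem)))

/-- The residue table by repeated squaring with the program `p` for convolution. -/
def tableFromMinConv (p : Program) : Program :=
  .seq initTable (.loop (.var 5) (squareTable p))

/-- The state between the squarings. -/
structure TableInv (S : Items) (s : State) : Prop where
  r2 : s.reg 2 = S.a 0
  r4 : s.reg 4 = (2 * S.a 0 : ℕ)
  r8 : s.reg 8 = (S.a 0 + 1 : ℕ)
  state : ∃ k u j : ℕ, s.reg 5 = u ∧ s.reg 9 = j ∧ S.a 0 < k * 2 ^ Nat.size u ∧ j + u ≤ S.a 0 ∧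
    S.Table k (fun i => s.arr 1 i) ∧ ∀ j' < S.a 0 + 1, j ≤ j' → s.view (S.a 0 + 1) j' = State.zero

theorem Nat.size_div_two {u : ℕ} (hu : 0 < u) : Nat.size (u / 2) + 1 = Nat.size u := by
  conv_rhs => rw [← Nat.bit_bodd_div2 u]
  rw [Nat.size_bit (by rw [Nat.bit_bodd_div2]; omega), Nat.div2_val]

theorem State.view_congr {s s' : State} (h : ∀ A, 10 ≤ A → s'.arr A = s.arr A) (L j : ℕ) :
    s'.view L j = s.view L j := by
  ext x i
  · simp [State.view, h 10 le_rfl]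
  · simp [State.view, h (11 + x) (by omega)]

theorem minConv_input_eq {n : ℕ} (hn : 0 < n) (f g : ℕ → ℤ) :
    minConv.input ⟨n, hn, fun i => f i, fun i => g i⟩ =
      ⟨fun x => if x = 0 then (n : ℤ) else 0,
        fun A => if A = 0 then prefixArr n f else if A = 1 then prefixArr n g else fun _ => 0⟩ := by
  simp only [minConv]
  rw [arrayOf_eq_prefixArr _ f fun i => rfl, arrayOf_eq_prefixArr _ g fun i => rfl]

theorem squareTable_runs {p : Program} {S : Items} {X T : ℕ} (hX : (S.largest + 2) ^ 2 ≤ X)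
    (hp : ∀ I : SequencePair, I.n = 2 * S.a 0 → I.maxAbs ≤ S.a 0 * S.largest →
      minConv.SolvedBy p I T) {s : State} (hs : TableInv S s) (hpos : 0 < s.reg 5) :
    (squareTable p).Runs X s
      ((2 * (squareTable p).weight + 1000) * (S.a 0 + 1) + 2 * p.slowdown * T)
      fun s' => TableInv S s' ∧ Nat.size (s'.reg 5).toNat < Nat.size (s.reg 5).toNat := by
  obtain ⟨r2, r4, r8, k, u, j, r5, r9, hk, hj, htab, hfresh⟩ := hs
  have hu : 0 < u := by omega
  have hN := S.pos
  have ha0 := S.le_largest 0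
  have hsq : S.a 0 * S.largest + 2 * S.a 0 + 2 ≤ X := by
    have := Nat.mul_le_mul_right S.largest ha0
    nlinarith
  refine Program.Runs.mono (N := loadLength.weight + (forTime (2 * S.a 0) loadEntry.weight + (2 * p.slowdown * T +
    (forTime (S.a 0) readEntry.weight + halveAndAdvance.weight)))) ?_ ?_ fun _ _ h => h
  rotate_left
  · have : (squareTable p).weight ≥ loadLength.weight + loadEntry.weight + readEntry.weight + halveAndAdvance.weight := by
      simp only [squareTable, Program.weight, Program.forLoop]
      omega
    have h1 := Nat.mul_le_mul_right (2 * S.a 0 + 1) this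
    simp only [forTime]
    nlinarith [Nat.zero_le (loadLength.weight * S.a 0), Nat.zero_le (halveAndAdvance.weight * S.a 0),
      Nat.zero_le (readEntry.weight * S.a 0)]
  set f : ℕ → ℤ := fun i => s.arr 1 ((i % S.a 0 : ℕ) : ℤ) with hf
  have hlt : ∀ i, i % S.a 0 < S.a 0 := fun i => Nat.mod_lt _ hN
  refine Program.Runs.seq (Program.Runs.of_wp (Q := fun s' => s' = s.setArr 10 j (2 * S.a 0 : ℕ))
    (by simp [loadLength, r8, r9, r4])) ?_
  rintro s' rfl
  refine Program.Runs.seq (Program.Runs.forLoop (M := 2 * S.a 0) (by omega) (fun i s' =>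
    s'.view (S.a 0 + 1) j = ⟨fun x => if x = 0 then ((2 * S.a 0 : ℕ) : ℤ) else 0,
        fun A => if A = 0 then prefixArr i f else if A = 1 then prefixArr i f else fun _ => 0⟩ ∧
      (∀ x ≠ 6, s'.reg x = s.reg x) ∧ (∀ A < 10, s'.arr A = s.arr A) ∧
      ∀ j' < S.a 0 + 1, j' ≠ j → s'.view (S.a 0 + 1) j' = s.view (S.a 0 + 1) j') (by norm_num)
      (by simp [r4]) ?_ ?_) ?_
  · refine ⟨?_, fun x hx => by simp [hx], fun A hA => by simp [show A ≠ 10 by omega],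
      fun j' h1 h2 => ?_⟩
    · rw [State.view_setReg, State.view_setArr_reg_zero _ (by omega) (by omega), if_pos rfl,
        hfresh j (by omega) le_rfl]
      ext x i
      · simp [State.zero]
      · simp [State.zero, prefixArr_zero]
    · rw [State.view_setReg, State.view_setArr_reg_zero _ (by omega) (by omega), if_neg h2]
  · rintro i hi s' - h6 ⟨h1, h2, h3, h4⟩
    refine Program.Runs.of_wp ?_
    have e2 := h2 2 (by norm_num)
    have e4 := h2 4 (by norm_num)
    have e8 := h2 8 (by norm_num)
    have e9 := h2 9 (by norm_num)
    have ea := h3 1 (by norm_num)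
    have hfi : s.arr 1 ((i : ℤ) % S.a 0) = f i := by simp [hf]
    have hjN : j < S.a 0 + 1 := by omega
    simp only [loadEntry, Program.wp, Expr.Readable, Expr.addr, Expr.eval, ArithOp.apply, h6, e2, r2, e8,
      e9, r8, r9, ea, State.reg_setArr, State.arr_setArr, State.view_setReg,
      State.view_setArr_arr_zero _ hjN hjN, State.view_setArr_arr_one _ hjN hjN, if_true, h1]
    refine ⟨by simp, by simp, by norm_num, by simp, by simp, by norm_num, trivial, by rw [e4, r4],
      ?_, fun x hx => by simp [hx, h2 x hx], fun A hA => ?_, fun j' h5 h7 => ?_⟩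
    · ext x z
      · simp
      · simp only [State.arr_setArr]
        rcases x with _ | _ | x
        · simp [hfi, update_prefixArr]
        · simp [hfi, update_prefixArr]
        · simp
    · simp [show A ≠ 11 by omega, show A ≠ 12 by omega, h3 A hA]
    · rw [State.view_setArr_arr_one _ hjN h5, if_neg h7, State.view_setArr_arr_zero _ hjN h5,
        if_neg h7, h4 j' h5 h7]
  rintro s' ⟨-, -, h1, h2, h3, h4⟩
  set I : SequencePair := ⟨2 * S.a 0, by omega, fun i => f i, fun i => f i⟩ with hI
  have hmax : I.maxAbs ≤ S.a 0 * S.largest := by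
    refine Finset.sup_le fun i _ => ?_
    have h5 := htab.nonneg _ (hlt i)
    have h6 := htab.le _ (hlt i)
    change max (f i).natAbs (f i).natAbs ≤ _
    simp only [hf, max_self] at h5 h6 ⊢
    omega
  refine Program.Runs.seq (Program.Runs.call (P := minConv) (I := I) (hp I rfl hmax)
    (by omega : j < S.a 0 + 1) (by omega) (by rw [h2 8 (by norm_num), r8])
    (by rw [h2 9 (by norm_num), r9]) (by rw [h1, hI, minConv_input_eq])) ?_
  rintro s₂ ⟨h5, h6⟩
  set v' : ℕ → ℤ := fun i => s₂.arr 13 ((i + S.a 0) * (S.a 0 + 1) + j) with hv'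
  have hdouble : S.Table (2 * k) v' := by
    refine htab.double fun i hi => ?_
    obtain ⟨⟨x, y, h7, h8⟩, h9⟩ := h5 ⟨i + S.a 0, by simp only [hI]; omega⟩
    have e : (s₂.view (S.a 0 + 1) j).arr 2 ((i + S.a 0 : ℕ) : ℤ) = v' i := by
      simp [State.view, hv']
    simp only at h8 h9
    rw [e] at h8 h9
    refine ⟨⟨x, x.2, y, y.2, h7, h8⟩, ?_⟩
    rintro z ⟨x, hx, y, hy, hxy, rfl⟩
    exact h9 ⟨⟨x, hx⟩, ⟨y, hy⟩, hxy, rfl⟩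
  have g : ∀ x ≠ 6, s₂.reg x = s.reg x := fun x hx => by rw [h6.reg, h2 x hx]
  have hfresh₂ : ∀ j' < S.a 0 + 1, j + 1 ≤ j' → s₂.view (S.a 0 + 1) j' = State.zero := fun j' h7 h8 => by
    rw [h6.view j' h7 (by omega), h4 j' h7 (by omega), hfresh j' h7 (by omega)]
  refine Program.Runs.seq (Program.Runs.forLoop (M := S.a 0) (by omega) (fun i s' =>
    (∀ x ≠ 6, s'.reg x = s.reg x) ∧ (∀ A, 10 ≤ A → s'.arr A = s₂.arr A) ∧
      ∀ k < i, s'.arr 1 (k : ℤ) = v' k) (by norm_num) (by rw [g 2 (by norm_num), r2])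
      ⟨fun x hx => by simp [hx, g x hx], fun _ _ => rfl, by simp⟩ ?_) ?_
  · rintro i hi s' h7 h8 ⟨h9, h10, h11⟩
    refine Program.Runs.of_wp ?_
    have e8 := h9 8 (by norm_num)
    have e9 := h9 9 (by norm_num)
    have e13 := h10 13 (by norm_num)
    have hvi : s₂.arr 13 ((i + S.a 0) * ((S.a 0 + 1 : ℕ) : ℤ) + j) = v' i := by simp [hv']
    have hb1 := hdouble.nonneg i hi
    have hb2 := hdouble.le i hi
    simp only [readEntry, Program.wp, Expr.Readable, Expr.addr, Expr.eval, ArithOp.apply, h8, h7, e8, e9,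
      r8, r9, e13, hvi]
    refine ⟨trivial, ⟨by simp, fun _ => by omega⟩, fun _ => by omega, h8, h7,
      fun x hx => by simp [hx, h9 x hx], fun A hA => by simp [show A ≠ 1 by omega, h10 A hA],
      fun k hk => ?_⟩
    rcases Nat.lt_succ_iff_lt_or_eq.1 hk with hk | rfl
    · simp [show (k : ℤ) ≠ i by omega, h11 k hk]
    · simp
  rintro s₃ ⟨-, -, h7, h8, h9⟩
  refine Program.Runs.of_wp ?_
  have e5 := h7 5 (by norm_num)
  have e9 := h7 9 (by norm_num)
  simp only [halveAndAdvance, Program.wp, Expr.Readable, Expr.eval, ArithOp.apply, State.reg_setReg, e5, r5, e9,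
    r9]
  norm_num
  have hsize := Nat.size_div_two hu
  have e3 : ((u : ℤ) / 2).toNat = u / 2 := by omega
  refine ⟨by omega, by omega, ⟨by simp [h7, r2], by simp [h7, r4], by simp [h7, r8],
    2 * k, u / 2, j + 1, by simp, by simp, ?_, by omega, ?_, ?_⟩, by rw [e3]; omega⟩
  · calc S.a 0 < k * 2 ^ Nat.size u := hk
      _ = _ := by rw [← hsize]; ring
  · constructor
    · intro i hi; simpa [h9 i hi] using hdouble.nonneg i hi
    · intro i hi; simpa [h9 i hi] using hdouble.le i hi
    · exact (h9 0 hN).trans hdouble.zero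
    · intro i hi; simpa [h9 i hi] using hdouble.sound i hi
    · intro l hl
      simp only [State.arr_setReg]
      rw [h9 _ (hlt _)]
      exact hdouble.complete l hl
  · intro j' h10 h11
    simp only [State.view_setReg]
    rw [State.view_congr h8]
    exact hfresh₂ j' h10 h11

theorem initTable_runs {S : Items} {X : ℕ} (hX : (S.largest + 2) ^ 2 ≤ X) :
    initTable.Runs X (S.state 0) ((initTable.weight + 1000) * (S.n + S.a 0 + 1)) fun s =>
      TableInv S s ∧ s.reg 5 = S.a 0 := by
  have hN := S.pos
  have ha0 := S.le_largest 0
  have hn := S.n_lt_largest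
  have hsq : S.a 0 * S.largest + 2 * S.a 0 + S.largest + 2 ≤ X := by
    have := Nat.mul_le_mul_right S.largest ha0
    nlinarith
  have hlast : arrayOf (fun i => (S.a i : ℤ)) S.n = S.largest := by
    rw [arrayOf_apply _ (Nat.lt_succ_self S.n)]; rfl
  refine Program.Runs.mono (N := initTableRegisters.weight + (forTime (S.a 0) clearEntry.weight + ((Program.put 1 (.lit 0) (.lit 0)).weight +
    forTime (S.n + 1) enterItem.weight))) ?_ ?_ fun _ _ h => h
  rotate_left
  · have : initTable.weight ≥ initTableRegisters.weight + clearEntry.weight + (Program.put 1 (.lit 0) (.lit 0)).weight + enterItem.weight := by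
      simp only [initTable, Program.weight, Program.forLoop]
      omega
    have h1 := Nat.mul_le_mul_right (S.n + S.a 0 + 1) this
    simp only [forTime]
    nlinarith [Nat.zero_le (initTableRegisters.weight * (S.n + S.a 0)), Nat.zero_le (enterItem.weight * S.a 0),
      Nat.zero_le ((Program.put 1 (.lit 0) (.lit 0)).weight * (S.n + S.a 0)), Nat.zero_le (clearEntry.weight * (S.n + 1))]
  have hrest : ∀ s : State, s.reg 0 = S.n + 1 → s.reg 2 = S.a 0 → s.reg 3 = (S.a 0 * S.largest : ℕ) →
      s.reg 4 = (2 * S.a 0 : ℕ) → s.reg 5 = S.a 0 → s.reg 8 = (S.a 0 + 1 : ℕ) → s.reg 9 = 0 →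
      s.arr 0 = arrayOf (fun i => (S.a i : ℤ)) →
      (∀ j, s.view (S.a 0 + 1) j = State.zero) →
      Program.Runs X (.seq (.forLoop 6 2 clearEntry) (.seq (Program.put 1 (.lit 0) (.lit 0)) (.forLoop 6 0 enterItem))) s
        (forTime (S.a 0) clearEntry.weight + ((Program.put 1 (.lit 0) (.lit 0)).weight + forTime (S.n + 1) enterItem.weight)) fun s =>
        TableInv S s ∧ s.reg 5 = S.a 0 := by
    intro s r0 r2 r3 r4 r5 r8 r9 ha hv
    refine Program.Runs.seq (Program.Runs.forLoop (M := S.a 0) (by omega) (fun i s' =>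
      (∀ x ≠ 6, s'.reg x = s.reg x) ∧ (∀ A ≠ 1, s'.arr A = s.arr A) ∧
        ∀ k < i, s'.arr 1 (k : ℤ) = (S.a 0 * S.largest : ℕ)) (by norm_num) r2
        ⟨fun x hx => by simp [hx], fun _ _ => rfl, by simp⟩ ?_) ?_
    · rintro i hi s' h1 h2 ⟨h3, h4, h5⟩
      refine Program.Runs.of_wp ?_
      have e3 := h3 3 (by norm_num)
      simp only [clearEntry, Program.wp, Expr.Readable, Expr.eval, h2, e3, r3]
      refine ⟨trivial, trivial, fun _ => by omega, h2, h1, fun x hx => by simp [hx, h3 x hx],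
        fun A hA => by simp [hA, h4 A hA], fun k hk => ?_⟩
      rcases Nat.lt_succ_iff_lt_or_eq.1 hk with hk | rfl
      · simp [show (k : ℤ) ≠ i by omega, h5 k hk]
      · simp
    rintro s₁ ⟨-, -, h1, h2, h3⟩
    refine Program.Runs.seq (Program.Runs.of_wp (Q := fun s' => s' = s₁.setArr 1 0 0)
      (by simp)) ?_
    rintro s' rfl
    refine (Program.Runs.forLoop (M := S.n + 1) (by omega) (fun i s' =>
      (∀ x ≠ 6, x ≠ 7 → s'.reg x = s.reg x) ∧ (∀ A ≠ 1, s'.arr A = s.arr A) ∧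
      (∀ i < S.a 0, 0 ≤ s'.arr 1 i ∧ s'.arr 1 i ≤ (S.a 0 * S.largest : ℕ) ∧
        (s'.arr 1 i < (S.a 0 * S.largest : ℕ) →
          ∃ t, t ≡ i [MOD S.a 0] ∧ S.Feasible t ∧ s'.arr 1 i = t)) ∧
      s'.arr 1 0 = 0 ∧ ∀ k : Fin (S.n + 1), k < i → s'.arr 1 ((S.a k % S.a 0 : ℕ) : ℤ) ≤ S.a k)
      (by norm_num) (by simp [h1, r0]) ?_ ?_).mono le_rfl ?_
    · refine ⟨fun x hx _ => by simp [hx, h1], fun A hA => by simp [hA, h2], fun i hi => ?_,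
        by simp, by simp⟩
      rcases Nat.eq_zero_or_pos i with rfl | hi0
      · exact ⟨by simp, by simp; positivity, fun _ => ⟨0, rfl, S.feasible_zero, by simp⟩⟩
      · have e : ((s₁.setArr 1 0 0).setReg 6 0).arr 1 (i : ℤ) = (S.a 0 * S.largest : ℕ) := by
          simp [hi0.ne', h3 i hi]
        rw [e]
        exact ⟨by omega, le_rfl, fun h => absurd h (lt_irrefl _)⟩
    · rintro i hi s' h4 h5 ⟨h6, h7, h8, h9, h10⟩
      refine Program.Runs.of_wp ?_
      have e2 := h6 2 (by norm_num) (by norm_num)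
      have e0 := h7 0 (by norm_num)
      have eai : s.arr 0 (i : ℤ) = S.a ⟨i, hi⟩ := by rw [ha, arrayOf_apply _ hi]
      have hal := S.le_largest ⟨i, hi⟩
      obtain ⟨r, hr⟩ : ∃ r, r = S.a ⟨i, hi⟩ % S.a 0 := ⟨_, rfl⟩
      have hm : r < S.a 0 := hr ▸ Nat.mod_lt _ hN
      have er : (S.a ⟨i, hi⟩ : ℤ) % S.a 0 = r := by rw [hr]; push_cast; rfl
      simp only [enterItem, Program.wp, Expr.Readable, Expr.eval, ArithOp.apply, State.reg_setReg,
        State.arr_setReg]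
      norm_num [h5, h4, e2, r2, e0, eai, er]
      have hstep : ∀ v : ℤ → ℤ, v = s'.arr 1 ∨ v = Function.update (s'.arr 1) r (S.a ⟨i, hi⟩) ∧
          (S.a ⟨i, hi⟩ : ℤ) < s'.arr 1 r → v r ≤ S.a ⟨i, hi⟩ →
          (∀ i < S.a 0, 0 ≤ v i ∧ v i ≤ S.a 0 * S.largest ∧ (v i < S.a 0 * S.largest →
            ∃ t, t ≡ i [MOD S.a 0] ∧ S.Feasible t ∧ v i = t)) ∧ v 0 = 0 ∧
          ∀ k : Fin (S.n + 1), k ≤ i → v ((S.a k : ℤ) % S.a 0) ≤ S.a k := by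
        intro v hv hvr
        have hle : ∀ z, v z ≤ s'.arr 1 z := fun z => by
          rcases hv with rfl | ⟨rfl, hlt⟩
          · exact le_rfl
          · rw [Function.update_apply]
            split_ifs with hz
            · rw [hz]; exact hlt.le
            · exact le_rfl
        have hvi : ∀ i' < S.a 0, 0 ≤ v i' ∧ v i' ≤ S.a 0 * S.largest ∧
            (v i' < S.a 0 * S.largest →
            ∃ t, t ≡ i' [MOD S.a 0] ∧ S.Feasible t ∧ v i' = t) := by
          intro i' hi'
          have h11 := h8 i' hi'
          push_cast at h11
          rcases hv with rfl | ⟨rfl, hlt⟩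
          · exact h11
          · by_cases e : i' = r
            · rw [e, Function.update_self]
              have h12 := (h8 r hm).2.1
              push_cast at h12
              exact ⟨by omega, by omega, fun _ => ⟨_, by rw [hr]; exact (Nat.mod_modEq _ _).symm,
                S.feasible_item _, rfl⟩⟩
            · rw [Function.update_of_ne (by exact_mod_cast e)]
              exact h11
        refine ⟨hvi, le_antisymm ((hle 0).trans h9.le) (by simpa using (hvi 0 hN).1),
          fun k hk => ?_⟩
        rcases hk.lt_or_eq with hk | hk
        · have h13 := h10 k hk
          push_cast at h13
          exact (hle _).trans h13
        · obtain rfl : k = ⟨i, hi⟩ := Fin.ext hk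
          rw [er]; exact hvr
      refine ⟨by omega, fun hlt => ⟨by omega, fun x hx hx' => by simp [hx, hx', h6 x hx hx'],
        fun A hA => by simp [hA, h7 A hA], ?_⟩, fun hge => ⟨fun x hx hx' => by
          simp [hx, hx', h6 x hx hx'], h7, ?_⟩⟩
      · exact hstep _ (.inr ⟨rfl, hlt⟩) (by simp)
      · exact hstep _ (.inl rfl) hge
    · rintro s' - ⟨-, -, h4, h5, h6, h7, h8⟩
      refine ⟨⟨by rw [h4 2 (by norm_num) (by norm_num), r2], by
        rw [h4 4 (by norm_num) (by norm_num), r4], by rw [h4 8 (by norm_num) (by norm_num), r8], 1,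
        S.a 0, 0, by rw [h4 5 (by norm_num) (by norm_num), r5], by
        rw [h4 9 (by norm_num) (by norm_num), r9]; rfl, by rw [one_mul]; exact Nat.lt_size_self _,
        by omega, ⟨fun i hi => (h6 i hi).1, fun i hi => (h6 i hi).2.1, h7,
          fun i hi => (h6 i hi).2.2, fun l hl => ?_⟩, fun j _ _ => ?_⟩, by
        rw [h4 5 (by norm_num) (by norm_num), r5]⟩
      · rcases l with _ | ⟨x, _ | ⟨y, l⟩⟩
        · simp [h7]
        · have := h8 x x.2
          simpa using this
        · simp at hl
      · rw [State.view_congr (fun A hA => h5 A (by omega)), hv j]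
  refine Program.Runs.seq (Program.Runs.of_wp (Q := fun s => s.reg 0 = S.n + 1 ∧ s.reg 2 = S.a 0 ∧
    s.reg 3 = (S.a 0 * S.largest : ℕ) ∧ s.reg 4 = (2 * S.a 0 : ℕ) ∧ s.reg 5 = S.a 0 ∧
    s.reg 8 = (S.a 0 + 1 : ℕ) ∧ s.reg 9 = 0 ∧ s.arr 0 = arrayOf (fun i => (S.a i : ℤ)) ∧
    ∀ j, s.view (S.a 0 + 1) j = State.zero) ?_) fun s h => ?_
  · simp only [initTableRegisters, Program.wp, Expr.Readable, Expr.eval, ArithOp.apply,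
      State.reg_setReg, State.arr_setReg, State.view_setReg, Items.state_view]
    simp only [Items.state]
    norm_num [hlast, Items.arrayOf_zero]
    zify
    rw [abs_of_nonneg (by positivity), abs_of_nonneg (by positivity), abs_of_nonneg (by positivity)]
    norm_cast
    omega
  · obtain ⟨h0, h2, h3, h4, h5, h8, h9, ha, hv⟩ := h
    exact hrest s h0 h2 h3 h4 h5 h8 h9 ha hv

theorem tableFromMinConv_solves (p : Program) : ∃ K, ∀ (S : Items) (T : ℕ),
    (∀ I : SequencePair, I.n = 2 * S.a 0 → I.maxAbs ≤ S.a 0 * S.largest →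
      minConv.SolvedBy p I T) →
    allTargets.SolvedBy (tableFromMinConv p) S
      (K * (S.n + S.a 0 + T) * (Nat.size ((S.largest + 2) ^ 2) + 1) ^ 2) := by
  refine ⟨2 * (initTable.weight + 1000) + 2 * (2 * (squareTable p).weight + 1000) +
    2 * p.slowdown + 10, fun S T hp => ?_⟩
  set X := (S.largest + 2) ^ 2 with hX
  have hX1 : S.largest + 2 ≤ X := Nat.le_self_pow two_ne_zero _
  have hN := S.pos
  have ha0 := S.le_largest 0
  have key := Program.Runs.seq (initTable_runs (S := S) (X := X) le_rfl)
    (q := .loop (.var 5) (squareTable p)) (Q := allTargets.Correct S)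
    (N' := Nat.size (S.a 0) * (((2 * (squareTable p).weight + 1000) * (S.a 0 + 1) +
      2 * p.slowdown * T) + (Expr.var 5).weight + 1) + (Expr.var 5).weight + 1) ?_
  · obtain ⟨T', s', h1, h2, h3⟩ := key.solvedBy (Q := allTargets) (I := S)
      (S.state_bounded (by omega) (by omega))
    refine ⟨T', s', h1, h2.trans ?_, h3⟩
    rw [sq, ← mul_assoc]
    refine Nat.mul_le_mul_right _ ?_
    rw [show (Expr.var 5).weight = 4 from rfl]
    have h5 : Nat.size (S.a 0) ≤ Nat.size X := Nat.size_le_size (by omega)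
    have h6 := Nat.mul_le_mul_right ((2 * (squareTable p).weight + 1000) * (S.a 0 + 1) +
      2 * p.slowdown * T + 5) h5
    generalize (squareTable p).weight = b at *
    generalize initTable.weight = c at *
    generalize p.slowdown = σ at *
    generalize X.size = z at *
    have h7 : (c + 1000) * (S.n + S.a 0 + 1) + 5 ≤ (2 * (c + 1000) + 5) * (S.n + S.a 0 + T) := by
      nlinarith [Nat.zero_le (c * (S.n + S.a 0 + T)), Nat.mul_le_mul_left c hN]
    have h8 : (2 * b + 1000) * (S.a 0 + 1) + 2 * σ * T + 5 ≤
        (2 * (2 * b + 1000) + 2 * σ + 5) * (S.n + S.a 0 + T) := by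
      nlinarith [Nat.zero_le (b * (S.n + T)), Nat.zero_le (σ * (S.n + S.a 0)),
        Nat.mul_le_mul_left b hN]
    have h9 := Nat.mul_le_mul_left z h8
    have h10 := Nat.zero_le (z * ((2 * (c + 1000) + 5) * (S.n + S.a 0 + T)))
    have h11 := Nat.zero_le ((2 * (2 * b + 1000) + 2 * σ + 5) * (S.n + S.a 0 + T))
    calc _ ≤ (2 * (c + 1000) + 5) * (S.n + S.a 0 + T) +
          z * ((2 * (2 * b + 1000) + 2 * σ + 5) * (S.n + S.a 0 + T)) := by linarith
      _ ≤ (2 * (c + 1000) + 5) * (S.n + S.a 0 + T) +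
          z * ((2 * (2 * b + 1000) + 2 * σ + 5) * (S.n + S.a 0 + T)) +
          (z * ((2 * (c + 1000) + 5) * (S.n + S.a 0 + T)) +
          (2 * (2 * b + 1000) + 2 * σ + 5) * (S.n + S.a 0 + T)) := Nat.le_add_right _ _
      _ = _ := by ring
  · rintro s ⟨hs, hs5⟩
    have hloop := Program.Runs.loop (X := X) (e := .var 5) (p := squareTable p)
      (TableInv S) (fun s => Nat.size (s.reg 5).toNat)
      (fun _ _ _ => trivial) (fun s h h' => squareTable_runs le_rfl hp h h') hs
    rw [hs5, Int.toNat_natCast] at hloop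
    refine hloop.mono le_rfl ?_
    rintro s' - ⟨⟨-, -, -, k, u, j, h5, -, hk, -, htab, -⟩, he⟩
    simp only [Expr.eval, h5] at he
    obtain rfl : u = 0 := by omega
    intro i hi
    exact ⟨S.least i, S.isLeast_least i, htab.eq_least (by simpa using hk.le) hi⟩

/-! ### Violated thresholds in a pair of blocks -/

/-- Block `I` of the sequence `a`, block `J` of `b` (both of length `m`) and thresholds `d`: is
there an `i` in block `I` and a `j` in block `J` with `a i + b j + 2 * w < d (i + j)`? -/
structure BlockQuery where
  m : ℕ
  w : ℕ
  I : ℕ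
  J : ℕ
  a : ℤ → ℤ
  b : ℤ → ℤ
  d : ℤ → ℤ
  m_pos : 0 < m
  a_le : ∀ z, (a z).natAbs ≤ w
  b_le : ∀ z, (b z).natAbs ≤ w
  d_nonneg : ∀ z, 0 ≤ d z
  d_le : ∀ z, d z ≤ 8 * w

namespace BlockQuery

variable (Q : BlockQuery)

/-- The largest entry. -/
def bound : ℕ := 2 * Q.m * (12 * Q.w + 1)

/-- The three sequences in one: `a`, `b` and the reversed thresholds are stored at distances that
make index sum `26 * m - 2` possible only for one index in each group, apart from entries outside
the groups, which are too large. The scaling by `2 * m` makes room for the position of the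
threshold in the last group. -/
def entry (r : ℕ) : ℤ :=
  if r < Q.m then 2 * Q.m * (Q.a (Q.I * Q.m + r) + Q.w)
  else if r < 6 * Q.m then Q.bound
  else if r < 7 * Q.m then 2 * Q.m * (Q.b (Q.J * Q.m + (r - 6 * Q.m)) + Q.w)
  else if r < 18 * Q.m then Q.bound
  else if r < 20 * Q.m - 1 then
    2 * Q.m * (8 * Q.w - Q.d ((Q.I + Q.J) * Q.m + 2 * Q.m - 2 - (r - 18 * Q.m))) + (r - 18 * Q.m)
  else Q.bound

theorem entry_mem (r : ℕ) : 0 ≤ Q.entry r ∧ Q.entry r ≤ Q.bound := by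
  have hm := Q.m_pos
  have key : ∀ x : ℤ, ∀ l : ℤ, 0 ≤ x → x ≤ 8 * Q.w → 0 ≤ l → l ≤ 2 * Q.m →
      0 ≤ 2 * Q.m * x + l ∧ 2 * Q.m * x + l ≤ Q.bound := by
    intro x l h1 h2 h3 h4
    have h5 : (2 * Q.m : ℤ) * x ≤ 2 * Q.m * (8 * Q.w) := mul_le_mul_of_nonneg_left h2 (by positivity)
    have h6 : (0 : ℤ) ≤ 2 * Q.m * x := by positivity
    have h7 : (0 : ℤ) ≤ Q.m * Q.w := by positivity
    unfold bound
    push_cast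
    constructor
    · linarith
    · linarith
  have hb : (0 : ℤ) ≤ Q.bound := by positivity
  unfold entry
  split_ifs with h1 h2 h3 h4 h5
  · have := Q.a_le (Q.I * Q.m + r)
    simpa using key (Q.a (Q.I * Q.m + r) + Q.w) 0 (by omega) (by omega) le_rfl (by omega)
  · exact ⟨hb, le_rfl⟩
  · have := Q.b_le (Q.J * Q.m + (r - 6 * Q.m))
    simpa using key (Q.b (Q.J * Q.m + (r - 6 * Q.m)) + Q.w) 0 (by omega) (by omega) le_rfl (by omega)
  · exact ⟨hb, le_rfl⟩
  · have h6 := Q.d_nonneg ((Q.I + Q.J) * Q.m + 2 * Q.m - 2 - (r - 18 * Q.m))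
    have h7 := Q.d_le ((Q.I + Q.J) * Q.m + 2 * Q.m - 2 - (r - 18 * Q.m))
    exact key _ _ (by omega) (by omega) (by omega) (by omega)
  · exact ⟨hb, le_rfl⟩

/-- The three-term minimum problem for the combined sequence. -/
def toTripleSum : TripleSum where
  R := 24 * Q.m
  G := Q.bound
  T := 26 * Q.m - 2
  raw r := (Q.entry r).toNat
  pos := by have := Q.m_pos; omega
  raw_le r _ := by have := Q.entry_mem r; omega
  T_le := by omega

theorem entry_sum {p q l : ℕ} (hp : p < Q.m) (hq : q < Q.m) (h : p + q + l = 2 * Q.m - 2) :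
    Q.entry p + Q.entry (6 * Q.m + q) + Q.entry (18 * Q.m + l) =
      2 * Q.m * (Q.a (Q.I * Q.m + p) + Q.b (Q.J * Q.m + q) + 10 * Q.w -
        Q.d ((Q.I + Q.J) * Q.m + (p + q))) + l := by
  have h1 : Q.entry p = 2 * Q.m * (Q.a (Q.I * Q.m + p) + Q.w) := by rw [entry, if_pos hp]
  have h2 : Q.entry (6 * Q.m + q) = 2 * Q.m * (Q.b (Q.J * Q.m + q) + Q.w) := by
    rw [entry, if_neg (by omega), if_neg (by omega), if_pos (by omega)]
    push_cast
    rw [add_sub_cancel_left]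
  have h3 : Q.entry (18 * Q.m + l) = 2 * Q.m * (8 * Q.w - Q.d ((Q.I + Q.J) * Q.m + (p + q))) + l := by
    rw [entry, if_neg (by omega), if_neg (by omega), if_neg (by omega), if_neg (by omega),
      if_pos (by omega)]
    push_cast
    rw [add_sub_cancel_left]
    congr 4
    have : (p : ℤ) + q + l = 2 * Q.m - 2 := by have := Q.m_pos; omega
    linarith
  rw [h1, h2, h3]
  ring

/-- An index at which the combined sequence has an entry of one of the three sequences. -/
def Proper (r : ℕ) : Prop :=
  r < Q.m ∨ (6 * Q.m ≤ r ∧ r < 7 * Q.m) ∨ (18 * Q.m ≤ r ∧ r < 20 * Q.m - 1)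

theorem proper_of_lt {r : ℕ} (h : Q.entry r < Q.bound) : Q.Proper r := by
  unfold entry at h
  unfold Proper
  split_ifs at h <;> omega

theorem classify {i j k : ℕ} (hi : Q.Proper i) (hj : Q.Proper j) (hk : Q.Proper k)
    (h : i + j + k = 26 * Q.m - 2) : ∃ p q l, p < Q.m ∧ q < Q.m ∧ p + q + l = 2 * Q.m - 2 ∧
      Q.entry i + Q.entry j + Q.entry k =
        Q.entry p + Q.entry (6 * Q.m + q) + Q.entry (18 * Q.m + l) := by
  have hm := Q.m_pos
  have key : ∀ i j k s, i < Q.m → (6 * Q.m ≤ j ∧ j < 7 * Q.m) → (18 * Q.m ≤ k ∧ k < 20 * Q.m - 1) →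
      i + j + k = 26 * Q.m - 2 → s = Q.entry i + Q.entry j + Q.entry k →
      ∃ p q l, p < Q.m ∧ q < Q.m ∧ p + q + l = 2 * Q.m - 2 ∧
      s = Q.entry p + Q.entry (6 * Q.m + q) + Q.entry (18 * Q.m + l) := by
    rintro i j k _ hi hj hk h rfl
    refine ⟨i, j - 6 * Q.m, k - 18 * Q.m, hi, by omega, by omega, ?_⟩
    rw [Nat.add_sub_cancel' hj.1, Nat.add_sub_cancel' hk.1]
  rcases hi with hi | hi | hi <;> rcases hj with hj | hj | hj <;> rcases hk with hk | hk | hk <;>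
    first
    | (exfalso; omega)
    | exact key i j k _ hi hj hk h rfl
    | exact key i k j _ hi hk hj (by omega) (by ring)
    | exact key j i k _ hj hi hk (by omega) (by ring)
    | exact key j k i _ hj hk hi (by omega) (by ring)
    | exact key k i j _ hk hi hj (by omega) (by ring)
    | exact key k j i _ hk hj hi (by omega) (by ring)

/-- The Frobenius number of the instance for a pair of blocks yields a number `μ` that tells
whether a threshold is violated, and a violated one if there is any. -/
theorem exists_frobenius : ∃ μ : ℕ,
    IsGreatest {t : ℕ | ¬ Q.toTripleSum.toItems.Feasible t}
      (Q.toTripleSum.floor + Q.toTripleSum.modulus * μ - Q.toTripleSum.modulus) ∧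
    μ ≤ 3 * Q.bound ∧
    (μ < 16 * Q.m * Q.w → ∃ p < Q.m, ∃ q < Q.m,
      Q.a (Q.I * Q.m + p) + Q.b (Q.J * Q.m + q) + 2 * Q.w < Q.d ((Q.I + Q.J) * Q.m + (p + q)) ∧
      μ % (2 * Q.m) + (p + q) = 2 * Q.m - 2) ∧
    (16 * Q.m * Q.w ≤ μ → ∀ p < Q.m, ∀ q < Q.m,
      Q.d ((Q.I + Q.J) * Q.m + (p + q)) ≤ Q.a (Q.I * Q.m + p) + Q.b (Q.J * Q.m + q) + 2 * Q.w) := by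
  have hm := Q.m_pos
  set D := Q.toTripleSum with hD
  have hraw : ∀ r, (D.raw r : ℤ) = Q.entry r := fun r => Int.toNat_of_nonneg (Q.entry_mem r).1
  have hne : ∃ μ, ∃ i < D.R, ∃ j < D.R, ∃ k < D.R, i + j + k = D.T ∧
      μ = D.raw i + D.raw j + D.raw k :=
    ⟨_, 0, by change 0 < 24 * Q.m; omega, 6 * Q.m, by change _ < 24 * Q.m; omega,
      20 * Q.m - 2, by change _ < 24 * Q.m; omega, by change _ = 26 * Q.m - 2; omega, rfl⟩
  classical
  refine ⟨Nat.find hne, D.isGreatest_infeasible (fun i hi j hj k hk h => Nat.find_min' hne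
    ⟨i, hi, j, hj, k, hk, h, rfl⟩) (Nat.find_spec hne), ?_, fun h => ?_, fun h p hp q hq => ?_⟩
  · obtain ⟨i, hi, j, hj, k, hk, h1, h2⟩ := Nat.find_spec hne
    have h3 := D.raw_le i hi
    have h4 := D.raw_le j hj
    have h5 := D.raw_le k hk
    change _ ≤ 3 * D.G
    omega
  · obtain ⟨i, hi, j, hj, k, hk, h1, h2⟩ := Nat.find_spec hne
    set μ := Nat.find hne
    have hb : 16 * Q.m * Q.w ≤ Q.bound := by
      unfold bound
      nlinarith [Nat.zero_le (Q.m * Q.w)]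
    have h3 : (μ : ℤ) = Q.entry i + Q.entry j + Q.entry k := by
      rw [h2]; push_cast; rw [hraw, hraw, hraw]
    have hi0 := (Q.entry_mem i).1
    have hj0 := (Q.entry_mem j).1
    have hk0 := (Q.entry_mem k).1
    obtain ⟨p, q, l, hp, hq, hpql, he⟩ := Q.classify (Q.proper_of_lt (r := i) (by omega))
      (Q.proper_of_lt (r := j) (by omega)) (Q.proper_of_lt (r := k) (by omega)) h1
    rw [he, Q.entry_sum hp hq hpql] at h3
    set x := Q.a (Q.I * Q.m + p) + Q.b (Q.J * Q.m + q) + 10 * Q.w -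
        Q.d ((Q.I + Q.J) * Q.m + (p + q)) with hx
    refine ⟨p, hp, q, hq, ?_, ?_⟩
    · have h4 : x < 8 * Q.w := by
        by_contra! h5
        have h6 : (2 * Q.m : ℤ) * (8 * Q.w) ≤ 2 * Q.m * x :=
          mul_le_mul_of_nonneg_left h5 (by positivity)
        zify at h
        linarith
      omega
    · have h4 : μ % (2 * Q.m) = l := by
        zify
        rw [h3, Int.mul_add_emod_self_left, Int.emod_eq_of_lt (by omega) (by omega)]
      omega
  · have h1 : Nat.find hne ≤ _ := Nat.find_min' hne ⟨p, by change _ < 24 * Q.m; omega,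
      6 * Q.m + q, by change _ < 24 * Q.m; omega, 18 * Q.m + (2 * Q.m - 2 - (p + q)),
      by change _ < 24 * Q.m; omega, by change _ = 26 * Q.m - 2; omega, rfl⟩
    zify at h1 h
    rw [hraw, hraw, hraw, Q.entry_sum hp hq (by omega)] at h1
    by_contra! h2
    set x := Q.a (Q.I * Q.m + p) + Q.b (Q.J * Q.m + q) + 10 * Q.w -
        Q.d ((Q.I + Q.J) * Q.m + (p + q)) with hx
    have h3 : x ≤ 8 * Q.w - 1 := by omega
    have h4 : (2 * Q.m : ℤ) * x ≤ 2 * Q.m * (8 * Q.w - 1) :=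
      mul_le_mul_of_nonneg_left h3 (by positivity)
    have h5 : ((2 * Q.m - 2 - (p + q) : ℕ) : ℤ) < 2 * Q.m := by omega
    linarith

end BlockQuery

/-! ### Queries for pairs of blocks -/

/-- The part `base` of the items for blocks of length `m` and sequences bounded by `w`. -/
def itemBase (m w : ℕ) : ℕ := 8 * (24 * m) * (2 * m * (12 * w + 1) + 1)

/-- The value `floor` of the instances for blocks of length `m` and sequences bounded by `w`. -/
def itemFloor (m w : ℕ) : ℕ :=
  10 * (24 * m) * (3 * itemBase m w + (26 * m - 2) * (2 * m * (12 * w + 1) + 1)) + 6 * (24 * m) +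
    (26 * m - 2)

theorem BlockQuery.base_eq (Q : BlockQuery) : Q.toTripleSum.base = itemBase Q.m Q.w := rfl

theorem TripleSum.items_lt_floor (D : TripleSum) {i : ℕ} (hi : i < D.R + D.modulus) :
    D.items i < D.floor := by
  have h := D.toItems.le_largest ⟨i, by change i < D.R + D.modulus - 1 + 1; omega⟩
  rw [D.toItems_largest] at h
  have h1 := D.floor_ge
  have h2 := D.pos
  change D.items i ≤ _ at h
  omega

/-- The constants and the input of the convolution algorithm, for sequences `A`, `B` of length `n`,
bounded by `w`, in blocks of length `m`, with `L` memory slots for subprograms. -/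
structure ConvConsts (n w m L : ℕ) (A B : ℤ → ℤ) (s : State) : Prop where
  r0 : s.reg 0 = n
  r1 : s.reg 1 = w
  r2 : s.reg 2 = m
  r8 : s.reg 8 = L
  r11 : s.reg 11 = (240 * m : ℕ)
  r14 : s.reg 14 = (2 * m * (12 * w + 1) : ℕ)
  r15 : s.reg 15 = itemBase m w
  r16 : s.reg 16 = itemFloor m w
  r17 : s.reg 17 = (264 * m : ℕ)
  r18 : s.reg 18 = (m * m : ℕ)
  a : s.arr 0 = A
  b : s.arr 1 = B

theorem ConvConsts.congr {n w m L : ℕ} {A B : ℤ → ℤ} {s s' : State}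
    (h : ConvConsts n w m L A B s)
    (hr : ∀ x ∈ [0, 1, 2, 8, 11, 14, 15, 16, 17, 18], s'.reg x = s.reg x)
    (h0 : s'.arr 0 = s.arr 0) (h1 : s'.arr 1 = s.arr 1) : ConvConsts n w m L A B s' where
  r0 := (hr 0 (by simp)).trans h.r0
  r1 := (hr 1 (by simp)).trans h.r1
  r2 := (hr 2 (by simp)).trans h.r2
  r8 := (hr 8 (by simp)).trans h.r8
  r11 := (hr 11 (by simp)).trans h.r11
  r14 := (hr 14 (by simp)).trans h.r14
  r15 := (hr 15 (by simp)).trans h.r15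
  r16 := (hr 16 (by simp)).trans h.r16
  r17 := (hr 17 (by simp)).trans h.r17
  r18 := (hr 18 (by simp)).trans h.r18
  a := h0.trans h.a
  b := h1.trans h.b

/-- The expression `k * x - y` for a numeral `k` and registers `x`, `y`. -/
def Expr.mulSub (k : ℤ) (x y : ℕ) : Expr := .op .sub (.op .mul (.lit k) (.var x)) (.var y)

/-- Register `24` receives the entry of the combined sequence whose index is in register `23`. -/
def computeEntry : Program :=
  .ifPos (.op .sub (.var 2) (.var 23))
    (.set 24 (.op .mul (.op .mul (.lit 2) (.var 2))
      (.op .add (.get 0 (.op .add (.op .mul (.var 20) (.var 2)) (.var 23))) (.var 1))))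
  (.ifPos (.mulSub 6 2 23) (.set 24 (.var 14))
  (.ifPos (.mulSub 7 2 23)
    (.set 24 (.op .mul (.op .mul (.lit 2) (.var 2))
      (.op .add (.get 1 (.op .add (.op .mul (.var 21) (.var 2))
        (.op .sub (.var 23) (.op .mul (.lit 6) (.var 2))))) (.var 1))))
  (.ifPos (.mulSub 18 2 23) (.set 24 (.var 14))
  (.ifPos (.op .sub (.mulSub 20 2 23) (.lit 1))
    (.set 24 (.op .add (.op .mul (.op .mul (.lit 2) (.var 2))
      (.op .sub (.op .mul (.lit 8) (.var 1)) (.get 3 (.op .sub (.op .sub (.op .add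
        (.op .mul (.op .add (.var 20) (.var 21)) (.var 2)) (.op .mul (.lit 2) (.var 2))) (.lit 2))
        (.op .sub (.var 23) (.op .mul (.lit 18) (.var 2)))))))
      (.op .sub (.var 23) (.op .mul (.lit 18) (.var 2)))))
  (.set 24 (.var 14))))))

theorem computeEntry_wp {Q : BlockQuery} {X : ℕ} {s : State} {P : State → Prop} {r : ℕ}
    (hX : Q.bound ≤ X) (r1 : s.reg 1 = Q.w) (r2 : s.reg 2 = Q.m) (r14 : s.reg 14 = Q.bound)
    (r20 : s.reg 20 = Q.I) (r21 : s.reg 21 = Q.J) (r23 : s.reg 23 = r) (ha : s.arr 0 = Q.a)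
    (hb : s.arr 1 = Q.b) (hd : s.arr 3 = Q.d) (hP : P (s.setReg 24 (Q.entry r))) :
    computeEntry.wp X s P := by
  have hm := Q.entry_mem r
  have hX' : (Q.entry r).natAbs ≤ X := by omega
  simp only [computeEntry, Program.wp, Expr.mulSub, Expr.Readable, Expr.eval, ArithOp.apply, r1, r2,
    r14, r20, r21, r23, ha, hb, hd]
  unfold BlockQuery.entry at hP hX'
  norm_num
  refine ⟨fun h1 => ?_, fun h1 => ⟨fun h2 => ?_, fun h2 => ⟨fun h3 => ?_, fun h3 =>
    ⟨fun h4 => ?_, fun h4 => ⟨fun h5 => ?_, fun h5 => ?_⟩⟩⟩⟩⟩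
  · rw [if_pos (by omega)] at hP hX'
    exact ⟨hX', hP⟩
  · rw [if_neg (by omega), if_pos (by omega)] at hP hX'
    exact ⟨hX, hP⟩
  · rw [if_neg (by omega), if_neg (by omega), if_pos (by omega)] at hP hX'
    exact ⟨hX', hP⟩
  · rw [if_neg (by omega), if_neg (by omega), if_neg (by omega), if_pos (by omega)] at hP hX'
    exact ⟨hX, hP⟩
  · rw [if_neg (by omega), if_neg (by omega), if_neg (by omega), if_neg (by omega),
      if_pos (by omega)] at hP hX'
    exact ⟨hX', hP⟩
  · rw [if_neg (by omega), if_neg (by omega), if_neg (by omega), if_neg (by omega),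
      if_neg (by omega)] at hP hX'
    exact ⟨hX, hP⟩

/-- Write the item whose index is in register `6` to the current slot. -/
def loadItem : Program :=
  .seq (.ifPos (.var 6)
    (.ifPos (.op .sub (.var 6) (.op .mul (.lit 24) (.var 2)))
      (.set 7 (.op .add (.op .sub (.var 16) (.var 11))
        (.op .sub (.var 6) (.op .mul (.lit 24) (.var 2)))))
      (.seq (.set 23 (.op .sub (.var 6) (.lit 1)))
      (.seq computeEntry
        (.set 7 (.op .add (.op .add (.op .mul (.var 11) (.op .add (.op .add (.var 15) (.var 24))
          (.op .mul (.var 23) (.op .add (.var 14) (.lit 1))))) (.op .mul (.lit 48) (.var 2)))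
          (.var 23))))))
    (.set 7 (.var 11)))
  (.put 11 (.addr (.var 6)) (.var 7))

theorem loadItem_wp {Q : BlockQuery} {X n L i : ℕ} {s : State} {P : State → Prop}
    (hs : ConvConsts n Q.w Q.m L Q.a Q.b s) (hX : itemFloor Q.m Q.w ≤ X) (hi : i < 264 * Q.m)
    (r20 : s.reg 20 = Q.I) (r21 : s.reg 21 = Q.J) (r6 : s.reg 6 = i) (hd : s.arr 3 = Q.d)
    (hP : ∀ s' : State, (∀ x, x ≠ 7 → x ≠ 23 → x ≠ 24 → s'.reg x = s.reg x) → s'.arr = s.arr →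
      P (s'.setArr 11 (i * L + s.reg 9) (Q.toTripleSum.items i))) :
    loadItem.wp X s P := by
  set D := Q.toTripleSum with hD
  have hm := Q.m_pos
  have hR : D.R = 24 * Q.m := rfl
  have hN : D.modulus = 240 * Q.m := by change 10 * (24 * Q.m) = _; ring
  have hG : D.G = 2 * Q.m * (12 * Q.w + 1) := rfl
  have hfl : D.floor = itemFloor Q.m Q.w := rfl
  have hba : D.base = itemBase Q.m Q.w := rfl
  have hlt := D.items_lt_floor (i := i) (by omega)
  have hge := D.floor_ge
  have hmb := D.modulus_le_base_mul
  have hGX : Q.bound ≤ D.floor := by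
    have h1 := D.floor_le
    have h2 : D.G ≤ D.base := by
      have := D.base_eq
      have := D.G_lt_mul
      omega
    have h3 := Nat.mul_le_mul_left D.modulus h2
    have h4 : D.G ≤ D.modulus * D.G := Nat.le_mul_of_pos_left _ (by omega)
    change D.G ≤ _
    omega
  obtain ⟨r0, r1, r2, r8, r11, r14, r15, r16, r17, r18, ha, hb⟩ := hs
  simp only [loadItem, Program.wp, Expr.Readable, Expr.eval, ArithOp.apply, r6, r2, r16, r11,
    Expr.addr]
  refine ⟨trivial, fun h1 => ⟨by simp, fun h2 => ?_, fun h2 => ?_⟩, fun h1 => ?_⟩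
  · have e : ((itemFloor Q.m Q.w : ℕ) : ℤ) - (240 * Q.m : ℕ) + (i - 24 * Q.m) = D.items i := by
      rw [D.items_filler (by omega)]
      omega
    rw [e]
    refine ⟨by simp, by omega, by simp, by simp, by norm_num, ?_⟩
    have := hP (s.setReg 7 (D.items i)) (fun x hx _ _ => by simp [hx]) rfl
    simpa [r6, r8] using this
  · have e : D.items i = D.item (i - 1) := D.items_item (by omega) (by omega)
    refine ⟨by simp, by omega, ?_⟩
    refine computeEntry_wp (Q := Q) (r := i - 1) (by omega) (by simpa using r1) (by simpa using r2)
      (by rw [State.reg_setReg, if_neg (by norm_num)]; exact r14) (by simpa using r20)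
      (by simpa using r21) (by simp; omega)
      (by simpa using ha) (by simpa using hb) (by simpa using hd) ?_
    have e1 : ((240 * Q.m : ℕ) : ℤ) * (itemBase Q.m Q.w + Q.entry (i - 1) + (i - 1) *
        ((2 * Q.m * (12 * Q.w + 1) : ℕ) + 1)) + 48 * Q.m + (i - 1) = D.items i := by
      have h3 : ((D.raw (i - 1) : ℕ) : ℤ) = Q.entry (i - 1) :=
        Int.toNat_of_nonneg (Q.entry_mem (i - 1)).1
      have h4 : ((i - 1 : ℕ) : ℤ) = i - 1 := by omega
      rw [e, TripleSum.item, hN, hba, hG, hR]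
      push_cast
      rw [h3, h4]
      ring
    simp only [State.reg_setReg, r11, r15, r14, r2]
    norm_num
    push_cast at e1
    rw [e1]
    have := hP (((s.setReg 23 (i - 1)).setReg 24 (Q.entry (i - 1))).setReg 7 (D.items i))
      (fun x hx h h' => by simp [hx, h, h']) rfl
    refine ⟨by omega, ?_⟩
    simpa [r6, r8] using this
  · have e : D.items i = 240 * Q.m := by
      rw [show i = 0 by omega, D.items_zero, hN]
    refine ⟨by simp, by omega, by simp, by simp, by norm_num, ?_⟩
    have := hP (s.setReg 7 (D.items i)) (fun x hx _ _ => by simp [hx]) rfl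
    rw [e] at this
    simpa [r6, r8] using this

/-- Write the instance for the pair of blocks number `q = reg 5` to the current slot. Its smallest
item is `240 * m`, and `170 * m - 2` is the residue of its Frobenius number. -/
def loadInstance : Program :=
  .seq (.seq (.seq (.set 20 (.op .div (.var 5) (.var 2))) (.set 21 (.op .mod (.var 5) (.var 2))))
    (.seq (.put 10 (.addr (.lit 0)) (.var 17))
      (.put 10 (.addr (.lit 1)) (.op .sub (.op .mul (.lit 170) (.var 2)) (.lit 2)))))
  (.forLoop 6 17 loadItem)

theorem fillTime_le (m : ℕ) {u v c : ℕ} (h : u + v ≤ c) :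
    u + forTime (264 * m) v ≤ (c + 1000) * 300 * (m + 1) := by
  have h1 := Nat.mul_le_mul_right m h
  rw [forTime, show (c + 1000) * 300 * (m + 1) = 300 * (c * m) + 300000 * m + 300 * c + 300000 by
    ring, show 264 * m * (v + 200) = 264 * (v * m) + 52800 * m by ring]
  rw [add_mul] at h1
  omega

theorem loadInstance_runs {Q : BlockQuery} {X n L j q : ℕ} {s : State}
    (hs : ConvConsts n Q.w Q.m L Q.a Q.b s) (hX : itemFloor Q.m Q.w ≤ X)
    (hj : j < L) (r5 : s.reg 5 = q) (hI : q / Q.m = Q.I) (hJ : q % Q.m = Q.J)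
    (r9 : s.reg 9 = j) (hqX : q ≤ X) (hd : s.arr 3 = Q.d) (hv : s.view L j = State.zero) :
    loadInstance.Runs X s ((loadInstance.weight + 1000) * 300 * (Q.m + 1)) fun s' =>
      s'.view L j = Q.toTripleSum.toItems.state (170 * Q.m - 2) ∧
      s'.reg 20 = Q.I ∧ s'.reg 21 = Q.J ∧
      (∀ x ∉ [6, 7, 20, 21, 23, 24], s'.reg x = s.reg x) ∧ (∀ A < 10, s'.arr A = s.arr A) ∧
      ∀ j' < L, j' ≠ j → s'.view L j' = s.view L j' := by
  set D := Q.toTripleSum with hD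
  have hm := Q.m_pos
  have hR : D.R = 24 * Q.m := rfl
  have hN : D.modulus = 240 * Q.m := by change 10 * (24 * Q.m) = _; ring
  have hn : D.toItems.n + 1 = 264 * Q.m := by
    change D.R + D.modulus - 1 + 1 = _
    omega
  have hn' : (D.toItems.n : ℤ) + 1 = (264 * Q.m : ℕ) := by rw [← hn]; rfl
  set f : ℕ → ℤ := fun i => D.items i with hf
  have hstate := D.toItems.state_eq (170 * Q.m - 2) f fun i => rfl
  have hfloor : 264 * Q.m ≤ X := by
    have h1 := D.floor_ge
    have h2 : D.floor = itemFloor Q.m Q.w := rfl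
    have h3 := D.modulus_le_base_mul
    omega
  have hdiv : ((q : ℤ) / Q.m) = Q.I := by rw [← hI]; push_cast; rfl
  have hmod : ((q : ℤ) % Q.m) = Q.J := by rw [← hJ]; push_cast; rfl
  have hIX : Q.I ≤ X := by rw [← hI]; exact (Nat.div_le_self _ _).trans hqX
  have hJX : Q.J ≤ X := by rw [← hJ]; exact (Nat.mod_le _ _).trans hqX
  refine Program.Runs.mono (N := (Program.seq (.seq (.set 20 (.op .div (.var 5) (.var 2)))
      (.set 21 (.op .mod (.var 5) (.var 2)))) (.seq (.put 10 (.addr (.lit 0)) (.var 17))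
      (.put 10 (.addr (.lit 1)) (.op .sub (.op .mul (.lit 170) (.var 2)) (.lit 2))))).weight +
      forTime (264 * Q.m) loadItem.weight) ?_ ?_ fun _ _ h => h
  · refine Program.Runs.seq (Program.Runs.of_wp (Q := fun s' => s' =
      (((s.setReg 20 Q.I).setReg 21 Q.J).setArr 10 j (264 * Q.m : ℕ)).setArr 10 (L + j)
        (170 * Q.m - 2 : ℕ)) ?_) ?_
    · simp only [Program.wp, Expr.Readable, Expr.eval, ArithOp.apply, State.reg_setReg, r5, hs.r2,
        hdiv, Expr.addr, hs.r8, r9, hs.r17]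
      norm_num
      refine ⟨hIX, ?_, ?_⟩
      · rw [hmod]; simpa using hJX
      · have e : ((170 * Q.m - 2 : ℕ) : ℤ) = 170 * Q.m - 2 := by omega
        rw [hmod, r9, e, hs.r8, hs.r2]
    rintro s' rfl
    refine (Program.Runs.forLoop (M := 264 * Q.m) hfloor (fun i s' =>
      s'.view L j = ⟨fun x => if x = 0 then (D.toItems.n : ℤ) + 1 else if x = 1 then
          ((170 * Q.m - 2 : ℕ) : ℤ) else 0,
          fun A => if A = 0 then prefixArr i f else fun _ => 0⟩ ∧
      s'.reg 20 = Q.I ∧ s'.reg 21 = Q.J ∧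
      (∀ x ∉ [6, 7, 20, 21, 23, 24], s'.reg x = s.reg x) ∧ (∀ A < 10, s'.arr A = s.arr A) ∧
      ∀ j' < L, j' ≠ j → s'.view L j' = s.view L j') (by norm_num) (by simp [hs.r17])
      ?_ ?_).mono le_rfl ?_
    · refine ⟨?_, by simp, by simp, fun x hx => ?_, fun A hA => by simp [show A ≠ 10 by omega],
        fun j' h1 h2 => ?_⟩
      · simp only [State.view_setReg, State.view_setArr_reg_one _ hj hj,
          State.view_setArr_reg_zero _ hj hj, if_true, hv]
        ext x i
        · simp only [State.zero, State.reg_setReg, hn']; grind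
        · simp [State.zero, prefixArr_zero]
      · simp only [List.mem_cons, not_or] at hx
        simp [hx]
      · simp [State.view_setArr_reg_one _ hj h1, State.view_setArr_reg_zero _ hj h1, h2]
    · rintro i hi s' h17 h6 ⟨h1, h2, h3, h4, h5, h7⟩
      refine Program.Runs.of_wp ?_
      have h9 : s'.reg 9 = j := by rw [h4 9 (by simp), r9]
      refine loadItem_wp (Q := Q) (n := n) (L := L) (i := i) (hs.congr (fun x hx => h4 x ?_)
        (h5 0 (by norm_num)) (h5 1 (by norm_num))) hX hi h2 h3 h6
        (by rw [h5 3 (by norm_num), hd]) ?_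
      · fin_cases hx <;> simp
      · intro s'' h10 h11
        have hv' : ∀ j', s''.view L j' = s'.view L j' :=
          State.view_congr (fun A _ => by rw [h11]) L
        rw [h9]
        refine ⟨by simp [h10, h6], by simp [h10, h17], ?_, by simp [h10, h2], by simp [h10, h3],
          fun x hx => ?_, fun A hA => by simp [show A ≠ 11 by omega, h11, h5 A hA],
          fun j' h12 h13 => ?_⟩
        · rw [State.view_setReg, State.view_setArr_arr_zero _ hj hj, if_pos rfl, hv', h1]
          ext x z
          · simp
          · by_cases hx : x = 0
            · subst hx
              simp only [State.arr_setArr, if_true]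
              exact congrFun (update_prefixArr i f) z
            · simp [hx]
        · simp only [List.mem_cons, not_or] at hx
          simp only [State.reg_setReg, State.reg_setArr]
          rw [if_neg hx.1, h10 x (by simp [hx]) (by simp [hx]) (by simp [hx])]
          exact h4 x (by simp [hx])
        · rw [State.view_setReg, State.view_setArr_arr_zero _ hj h12, if_neg h13, hv', h7 j' h12 h13]
    · rintro s' - ⟨-, -, h1, h2, h3, h4, h5, h6⟩
      refine ⟨?_, h2, h3, h4, h5, h6⟩
      rw [h1, hstate, hn]
  · have h1 : (Program.seq (.seq (.set 20 (.op .div (.var 5) (.var 2)))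
      (.set 21 (.op .mod (.var 5) (.var 2)))) (.seq (.put 10 (.addr (.lit 0)) (.var 17))
      (.put 10 (.addr (.lit 1)) (.op .sub (.op .mul (.lit 170) (.var 2)) (.lit 2))))).weight +
      loadItem.weight ≤ loadInstance.weight := by
      conv_rhs => unfold loadInstance Program.forLoop
      simp only [Program.weight]
      omega
    exact fillTime_le Q.m h1

/-! ### Thresholds for all pairs of blocks -/

/-- A convolution problem whose length `n` is at most `m ^ 2` and whose entries are bounded by `w`;
`c` is its solution. -/
structure Convolution where
  n : ℕ
  w : ℕ
  m : ℕ
  a : ℤ → ℤ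
  b : ℤ → ℤ
  c : ℕ → ℤ
  m_pos : 0 < m
  w_pos : 0 < w
  n_le : n ≤ m * m
  a_le : ∀ z, (a z).natAbs ≤ w
  b_le : ∀ z, (b z).natAbs ≤ w
  isLeast : ∀ k < n, IsLeast {v : ℤ | ∃ i j : ℕ, i + j = k ∧ v = a i + b j} (c k)

namespace Convolution

variable (C : Convolution)

/-- The number of queries in one round is at most this: every query finishes a pair of blocks or
clears a threshold. -/
def queries : ℕ := C.m * C.m + C.n

/-- The number of memory slots. -/
def slots : ℕ := 4 * C.w * C.queries + 1

/-- A bound for all numbers that the algorithm computes. -/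
def word : ℕ := 960 * C.m * itemBase C.m C.w

/-- The program `p` solves all instances that queries lead to, in time `T`. -/
def SolvedBy (p : Program) (T : ℕ) : Prop :=
  ∀ I : frobeniusWithResidue.Instance, I.1.1.n + 1 = 264 * C.m → I.1.1.a 0 = 240 * C.m →
    I.1.1.largest ≤ itemFloor C.m C.w → frobeniusWithResidue.SolvedBy p I T

theorem c_mem {k : ℕ} (hk : k < C.n) : -(2 * C.w : ℤ) ≤ C.c k ∧ C.c k ≤ 2 * C.w := by
  obtain ⟨i, j, -, h⟩ := (C.isLeast k hk).1
  have := C.a_le i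
  have := C.b_le j
  omega

theorem itemBase_le_word : itemBase C.m C.w ≤ C.word :=
  Nat.le_mul_of_pos_left _ (by have := C.m_pos; omega)

theorem itemBase_ge : 8 * (24 * C.m) * (2 * C.m * (12 * C.w)) ≤ itemBase C.m C.w :=
  Nat.mul_le_mul_left _ ((Nat.mul_le_mul_left _ (Nat.le_succ _)).trans (Nat.le_succ _))

theorem m_le_itemBase : 1000 * C.m * C.m * C.w ≤ itemBase C.m C.w := by
  refine le_trans ?_ C.itemBase_ge
  rw [show 8 * (24 * C.m) * (2 * C.m * (12 * C.w)) = 4608 * (C.m * C.m * C.w) by ring,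
    show 1000 * C.m * C.m * C.w = 1000 * (C.m * C.m * C.w) by ring]
  omega

theorem mul_self_le : C.m * C.m ≤ C.m * C.m * C.w := Nat.le_mul_of_pos_right _ C.w_pos

theorem w_le : C.w ≤ C.m * C.m * C.w :=
  Nat.le_mul_of_pos_left _ (Nat.mul_pos C.m_pos C.m_pos)

theorem slots_le_word : C.slots ≤ C.word := by
  refine le_trans ?_ C.itemBase_le_word
  refine le_trans ?_ C.m_le_itemBase
  have h1 := Nat.mul_le_mul_left (4 * C.w) (Nat.add_le_add_left C.n_le (C.m * C.m))
  have h2 := C.w_le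
  have h3 := C.w_pos
  unfold slots queries
  rw [show 4 * C.w * (C.m * C.m + C.m * C.m) = 8 * (C.m * C.m * C.w) by ring] at h1
  rw [show 1000 * C.m * C.m * C.w = 1000 * (C.m * C.m * C.w) by ring]
  omega

theorem small_le_word : 1000 * (C.m * C.m) ≤ C.word ∧ 1000 * C.w ≤ C.word ∧ C.n ≤ C.word := by
  have h1 := C.m_le_itemBase
  have h2 := C.itemBase_le_word
  have h3 := C.mul_self_le
  have h4 := C.w_le
  have h5 := C.n_le
  rw [show 1000 * C.m * C.m * C.w = 1000 * (C.m * C.m * C.w) by ring] at h1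
  omega

/-- The query for the block pair number `q`. -/
def query (d : ℤ → ℤ) (hd : ∀ z, 0 ≤ d z) (hd' : ∀ z, d z ≤ 8 * C.w) (q : ℕ) : BlockQuery where
  m := C.m
  w := C.w
  I := q / C.m
  J := q % C.m
  a := C.a
  b := C.b
  d := d
  m_pos := C.m_pos
  a_le := C.a_le
  b_le := C.b_le
  d_nonneg := hd
  d_le := hd'

/-- The thresholds `d` during a round in which the lower bounds `lo` for `c + 2 * w`, exact up to
`u`, are tested for being exact up to `h - 1`. Cleared thresholds record failures. -/
structure Thresholds (u h : ℕ) (lo d : ℤ → ℤ) : Prop where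
  outside : ∀ z : ℤ, z < 0 ∨ C.n ≤ z → d z = 0
  bounds : ∀ k < C.n, 0 ≤ lo k ∧ lo k ≤ C.c k + 2 * C.w ∧ C.c k + 2 * C.w ≤ lo k + u
  cases : ∀ k < C.n, d k = lo k + h ∨ d k = 0 ∧ C.c k + 2 * C.w < lo k + h

variable {C}

theorem Thresholds.mem {u h : ℕ} {lo d : ℤ → ℤ} (ht : C.Thresholds u h lo d) (hh : h ≤ 4 * C.w)
    (z : ℤ) : 0 ≤ d z ∧ d z ≤ 8 * C.w := by
  by_cases hz : z < 0 ∨ C.n ≤ z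
  · rw [ht.outside z hz]; omega
  · obtain ⟨k, rfl⟩ := Int.eq_ofNat_of_zero_le (show 0 ≤ z by omega)
    have hk : k < C.n := by omega
    have h1 := ht.bounds k hk
    have h2 := C.c_mem hk
    rcases ht.cases k hk with h3 | ⟨h3, -⟩ <;> omega

/-- The number of active thresholds. -/
noncomputable def active (n : ℕ) (d : ℤ → ℤ) : ℕ := by
  classical exact ((Finset.range n).filter fun k : ℕ => d k ≠ 0).card

theorem active_le (n : ℕ) (d : ℤ → ℤ) : active n d ≤ n := by
  classical exact (Finset.card_filter_le _ _).trans (by simp)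

theorem active_update_lt {n k : ℕ} {d : ℤ → ℤ} (hk : k < n) (hd : d k ≠ 0) :
    active n (Function.update d k 0) < active n d := by
  classical
  refine Finset.card_lt_card (Finset.ssubset_iff_of_subset (fun i => ?_) |>.2 ⟨k, ?_⟩)
  · simp only [Finset.mem_filter, Function.update_apply]
    rintro ⟨h1, h2⟩
    refine ⟨h1, fun h => h2 ?_⟩
    simp [h]
  · simp [hk, hd]

/-- A violated threshold may be cleared. -/
theorem Thresholds.clear {u h : ℕ} {lo d : ℤ → ℤ} (ht : C.Thresholds u h lo d) {i j : ℕ}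
    (hij : C.a i + C.b j + 2 * C.w < d (i + j : ℕ)) :
    i + j < C.n ∧ d (i + j : ℕ) ≠ 0 ∧
      C.Thresholds u h lo (Function.update d (i + j : ℕ) 0) := by
  have h1 := C.a_le i
  have h2 := C.b_le j
  have h3 : i + j < C.n := by
    by_contra! h
    rw [ht.outside (i + j : ℕ) (.inr (by omega))] at hij
    omega
  have h4 := (C.isLeast _ h3).2 ⟨i, j, rfl, rfl⟩
  refine ⟨h3, by omega, fun z hz => ?_, ht.bounds, fun k hk => ?_⟩
  · rw [Function.update_apply]
    split_ifs
    exacts [rfl, ht.outside z hz]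
  · by_cases e : k = i + j
    · subst e
      rw [Function.update_self]
      rcases ht.cases _ h3 with h5 | h5
      · exact .inr ⟨rfl, by omega⟩
      · exact .inr ⟨rfl, h5.2⟩
    · rw [Function.update_of_ne (by exact_mod_cast e)]
      exact ht.cases k hk

/-- None of the thresholds for the pairs of blocks with numbers below `q` is violated. -/
def Checked (C : Convolution) (q : ℕ) (d : ℤ → ℤ) : Prop :=
  ∀ I < C.m, ∀ J < C.m, I * C.m + J < q → ∀ x < C.m, ∀ y < C.m,
    d ((I * C.m + x + (J * C.m + y) : ℕ)) ≤
      C.a (I * C.m + x : ℕ) + C.b (J * C.m + y : ℕ) + 2 * C.w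

theorem Checked.update {q : ℕ} {d : ℤ → ℤ} (h : C.Checked q d) (z : ℤ) :
    C.Checked q (Function.update d z 0) := by
  intro I hI J hJ hq x hx y hy
  rw [Function.update_apply]
  split_ifs
  · have := C.a_le (I * C.m + x : ℕ)
    have := C.b_le (J * C.m + y : ℕ)
    omega
  · exact h I hI J hJ hq x hx y hy

/-- When all pairs of blocks are checked, the active thresholds are lower bounds, and the next
round has lower bounds that are exact up to `u / 2`. -/
theorem Thresholds.halve {u : ℕ} {lo d : ℤ → ℤ} (ht : C.Thresholds u (u / 2 + 1) lo d)
    (hd : C.Checked (C.m * C.m) d) {k : ℕ} (hk : k < C.n) :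
    0 ≤ (if 0 < d k then d k else lo k) ∧ (if 0 < d k then d k else lo k) ≤ C.c k + 2 * C.w ∧
      C.c k + 2 * C.w ≤ (if 0 < d k then d k else lo k) + (u / 2 : ℕ) := by
  obtain ⟨h1, h2, h3⟩ := ht.bounds k hk
  have h4 : d k ≤ C.c k + 2 * C.w := by
    obtain ⟨i, j, hij, hc⟩ := (C.isLeast k hk).1
    have hm := C.m_pos
    have hn := C.n_le
    have h5 := hd (i / C.m) ((Nat.div_lt_iff_lt_mul hm).2 (by omega)) (j / C.m)
      ((Nat.div_lt_iff_lt_mul hm).2 (by omega)) ?_ (i % C.m) (Nat.mod_lt _ hm) (j % C.m)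
      (Nat.mod_lt _ hm)
    · rwa [Nat.div_add_mod', Nat.div_add_mod', hij, ← hc] at h5
    · have h6 : i / C.m + 1 ≤ C.m := (Nat.div_lt_iff_lt_mul hm).2 (by omega)
      have h7 : j / C.m < C.m := (Nat.div_lt_iff_lt_mul hm).2 (by omega)
      have := Nat.mul_le_mul_right C.m h6
      rw [add_mul] at this
      omega
  rcases ht.cases k hk with h5 | ⟨h5, h6⟩
  · rw [if_pos (by omega)]; omega
  · rw [if_neg (by omega)]; omega

end Convolution

/-! ### A round of queries -/

/-- Evaluate the answer to a query: clear a violated threshold, or go on to the next pair. -/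
def settleQuery : Program :=
  .seq (.set 22 (.op .div (.op .sub (.op .add (.get 10 (.addr (.lit 0))) (.var 11)) (.var 16))
    (.var 11)))
  (.seq (.ifPos (.op .sub (.op .mul (.op .mul (.lit 16) (.var 2)) (.var 1)) (.var 22))
      (.put 3 (.op .sub (.op .sub (.op .add (.op .mul (.op .add (.var 20) (.var 21)) (.var 2))
        (.op .mul (.lit 2) (.var 2))) (.lit 2)) (.op .mod (.var 22) (.op .mul (.lit 2) (.var 2))))
        (.lit 0))
      (.set 5 (.op .add (.var 5) (.lit 1))))
    (.set 9 (.op .add (.var 9) (.lit 1))))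

/-- One query, for the pair of blocks whose number is in register `5`. -/
def queryStep (p : Program) : Program := .seq loadInstance (.seq p.reloc settleQuery)

namespace Convolution

variable {C : Convolution}

/-- The state during a round of queries that may use the slots up to `l`. -/
structure QueryInv (C : Convolution) (u h l : ℕ) (lo : ℤ → ℤ) (s : State) : Prop where
  consts : ConvConsts C.n C.w C.m C.slots C.a C.b s
  r3 : s.reg 3 = u
  r4 : s.reg 4 = h
  arr2 : s.arr 2 = lo
  thresholds : C.Thresholds u h lo (s.arr 3)
  state : ∃ q j : ℕ, s.reg 5 = q ∧ q ≤ C.m * C.m ∧ s.reg 9 = j ∧ C.Checked q (s.arr 3) ∧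
    j + ((C.m * C.m - q) + active C.n (s.arr 3)) ≤ l ∧
    ∀ j' < C.slots, j ≤ j' → s.view C.slots j' = State.zero

theorem frobenius_promise (Q : BlockQuery) {μ : ℕ} (hμ : μ ≤ 3 * Q.bound) :
    (Q.toTripleSum.floor + Q.toTripleSum.modulus * μ - Q.toTripleSum.modulus) %
      Q.toTripleSum.toItems.a 0 = 170 * Q.m - 2 ∧
    Q.toTripleSum.floor + Q.toTripleSum.modulus * μ - Q.toTripleSum.modulus ≤
      Q.toTripleSum.toItems.a 0 * Q.toTripleSum.toItems.largest ∧
    Q.toTripleSum.floor + Q.toTripleSum.modulus * μ ≤ 960 * Q.m * itemBase Q.m Q.w := by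
  set D := Q.toTripleSum with hD
  have hm := Q.m_pos
  have hN : D.modulus = 240 * Q.m := by change 10 * (24 * Q.m) = _; ring
  have h1 := D.floor_ge
  have h2 := D.floor_le
  have h3 := D.modulus_le_base_mul
  have h4 : D.modulus * μ ≤ D.modulus * (3 * D.G) := Nat.mul_le_mul_left _ hμ
  rw [D.toItems_zero, D.toItems_largest]
  refine ⟨?_, ?_, ?_⟩
  · have e : D.floor = D.modulus * (3 * D.base + D.T * (D.G + 1)) + (170 * Q.m - 2) := by
      have e1 : D.R = 24 * Q.m := rfl
      have e2 : D.T = 26 * Q.m - 2 := rfl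
      unfold TripleSum.floor
      omega
    have h5 : D.modulus ≤ D.modulus * (3 * D.base + D.T * (D.G + 1)) := by
      rw [mul_add]
      have : D.modulus * (3 * D.base) = 3 * (D.modulus * D.base) := by ring
      omega
    obtain ⟨x, hx⟩ : ∃ x, D.modulus * (3 * D.base + D.T * (D.G + 1)) = D.modulus * x + D.modulus := by
      obtain ⟨y, hy⟩ : ∃ y, 3 * D.base + D.T * (D.G + 1) = y + 1 := by
        refine Nat.exists_eq_succ_of_ne_zero fun h => ?_
        rw [h] at h5
        omega
      exact ⟨y, by rw [hy]; ring⟩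
    rw [e, hx, show D.modulus * x + D.modulus + (170 * Q.m - 2) + D.modulus * μ - D.modulus =
      170 * Q.m - 2 + D.modulus * (x + μ) by rw [mul_add]; omega, Nat.add_mul_mod_self_left,
      Nat.mod_eq_of_lt (by omega)]
  · have h5 : 2 * (D.floor - 1) ≤ D.modulus * (D.floor - 1) := Nat.mul_le_mul_right _ (by omega)
    omega
  · have : 960 * Q.m * itemBase Q.m Q.w = 4 * (D.modulus * D.base) := by
      rw [hN, Q.base_eq]; ring
    omega

theorem settleQuery_wp {Q : BlockQuery} {X μ n L j q : ℕ} {s : State} {P : State → Prop}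
    (hs : ConvConsts n Q.w Q.m L Q.a Q.b s) (hX : 960 * Q.m * itemBase Q.m Q.w ≤ X)
    (hμ : μ ≤ 3 * Q.bound) (hqX : q + 1 ≤ X) (hjX : j + 1 ≤ X)
    (h10 : s.arr 10 j =
      (Q.toTripleSum.floor + Q.toTripleSum.modulus * μ - Q.toTripleSum.modulus : ℕ))
    (r5 : s.reg 5 = q) (r9 : s.reg 9 = j) (r20 : s.reg 20 = Q.I) (r21 : s.reg 21 = Q.J)
    (hP : P (((if μ < 16 * Q.m * Q.w then (s.setReg 22 μ).setArr 3
      (((Q.I + Q.J) * Q.m + 2 * Q.m - 2 : ℤ) - (μ % (2 * Q.m) : ℕ)) 0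
      else (s.setReg 22 μ).setReg 5 (q + 1 : ℕ))).setReg 9 (j + 1 : ℕ))) :
    settleQuery.wp X s P := by
  obtain ⟨-, hF, hF'⟩ := frobenius_promise Q hμ
  set D := Q.toTripleSum with hD
  have hm := Q.m_pos
  have hN : D.modulus = 240 * Q.m := by change 10 * (24 * Q.m) = _; ring
  have h1 := D.floor_ge
  have h3 := D.modulus_le_base_mul
  have hfl : D.floor = itemFloor Q.m Q.w := rfl
  have e : (((D.floor + D.modulus * μ - D.modulus : ℕ) : ℤ) + (240 * Q.m : ℕ) - itemFloor Q.m Q.w) /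
      (240 * Q.m : ℕ) = μ := by
    have : ((D.floor + D.modulus * μ - D.modulus : ℕ) : ℤ) + (240 * Q.m : ℕ) - itemFloor Q.m Q.w =
        (240 * Q.m : ℕ) * μ := by
      rw [← hN, ← hfl, ← Nat.cast_mul]
      omega
    rw [this]
    exact Int.mul_ediv_cancel_left _ (by omega)
  have hμX : μ ≤ X := by
    have : μ ≤ D.modulus * μ := Nat.le_mul_of_pos_left _ (by omega)
    omega
  simp only [settleQuery, Program.wp, Expr.Readable, Expr.eval, ArithOp.apply, Expr.addr,
    State.reg_setReg, State.reg_setArr, hs.r1, hs.r2, hs.r8, hs.r11, hs.r16, r5, r9, r20, r21,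
    zero_mul, zero_add, h10, e]
  norm_num
  have hc : (μ : ℤ) < 16 * Q.m * Q.w ↔ μ < 16 * Q.m * Q.w := by norm_cast
  refine ⟨by omega, hμX, fun h => ?_, fun h => ?_⟩
  · rw [if_pos (hc.1 h)] at hP
    refine ⟨?_, ?_⟩
    · omega
    · push_cast at hP
      exact hP
  · rw [if_neg (fun h' => absurd (hc.2 h') (by omega))] at hP
    refine ⟨by omega, by omega, ?_⟩
    push_cast at hP
    exact hP

/-- A query decreases the number of unfinished pairs of blocks plus active thresholds. -/
theorem queryStep_runs {p : Program} {T u h l : ℕ} {lo : ℤ → ℤ} (hp : C.SolvedBy p T)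
    (hh : 0 < h) (hh' : h ≤ 4 * C.w) (hl : l < C.slots) {s : State} (hs : C.QueryInv u h l lo s)
    (hpos : 0 < s.reg 18 - s.reg 5) :
    (queryStep p).Runs C.word s
      (((loadInstance.weight + 1000) * 300 * (C.m + 1)) + (2 * p.slowdown * T + settleQuery.weight))
      fun s' => C.QueryInv u h l lo s' ∧
        (C.m * C.m - (s'.reg 5).toNat) + active C.n (s'.arr 3) <
          (C.m * C.m - (s.reg 5).toNat) + active C.n (s.arr 3) := by
  obtain ⟨consts, r3, r4, arr2, ht, q, j, r5, hq, r9, hch, hj, hfresh⟩ := hs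
  rw [consts.r18, r5] at hpos
  have hm := C.m_pos
  have hql : q < C.m * C.m := by omega
  have hJ : q / C.m < C.m := (Nat.div_lt_iff_lt_mul hm).2 hql
  have hmod := Nat.mod_lt q hm
  have hdm := Nat.div_add_mod' q C.m
  obtain ⟨hw1, hw2, hw3⟩ := C.small_le_word
  have hsl := C.slots_le_word
  set Q := C.query (s.arr 3) (fun z => (ht.mem hh' z).1) (fun z => (ht.mem hh' z).2) q with hQ
  have hfl : itemFloor Q.m Q.w ≤ C.word := by
    have := (frobenius_promise Q (Nat.zero_le _)).2.2
    have h2 : Q.toTripleSum.floor = itemFloor Q.m Q.w := rfl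
    change _ ≤ C.word at this
    omega
  obtain ⟨μ, hgr, hμ, hviol, hok⟩ := Q.exists_frobenius
  obtain ⟨hpr, hpr', -⟩ := frobenius_promise Q hμ
  refine Program.Runs.seq (loadInstance_runs (Q := Q) (j := j) consts hfl (by omega) r5 rfl rfl r9
    (by omega) rfl (hfresh j (by omega) le_rfl)) ?_
  rintro s₁ ⟨hv, h20, h21, hreg, harr, hview⟩
  have hN : Q.toTripleSum.toItems.a 0 = 240 * C.m := by
    rw [TripleSum.toItems_zero]
    change 10 * (24 * C.m) = _
    ring
  let I : frobeniusWithResidue.Instance :=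
    ⟨(Q.toTripleSum.toItems, 170 * C.m - 2), by change 2 ≤ Q.toTripleSum.toItems.a 0; omega, _,
      hgr, hpr, hpr'⟩
  have hI := hp I (by
      change Q.toTripleSum.R + Q.toTripleSum.modulus - 1 + 1 = _
      rw [TripleSum.toItems_zero] at hN
      have : Q.toTripleSum.R = 24 * C.m := rfl
      omega) hN (by
      change Q.toTripleSum.toItems.largest ≤ _
      rw [TripleSum.toItems_largest]
      exact Nat.sub_le _ _)
  refine Program.Runs.seq (Program.Runs.call (I := I) hI (j := j) (by omega) hsl
    (by rw [hreg 8 (by simp), consts.r8]) (by rw [hreg 9 (by simp), r9]) hv) ?_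
  rintro s₂ ⟨⟨F, hF, hF0⟩, hsame⟩
  have hFe : F = _ := hF.unique hgr
  have h10 : s₂.arr 10 j =
      (Q.toTripleSum.floor + Q.toTripleSum.modulus * μ - Q.toTripleSum.modulus : ℕ) := by
    rw [← hFe, ← hF0]
    simp [State.view]
  have hreg₂ : ∀ x ∉ [6, 7, 20, 21, 23, 24], s₂.reg x = s.reg x := fun x hx => by
    rw [hsame.reg, hreg x hx]
  have harr₂ : ∀ A < 10, s₂.arr A = s.arr A := fun A hA => by
    rw [hsame.arr A hA, harr A hA]
  have hview₂ : ∀ j' < C.slots, j + 1 ≤ j' → s₂.view C.slots j' = State.zero := fun j' h1 h2 => by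
    rw [hsame.view j' h1 (by omega), hview j' h1 (by omega), hfresh j' h1 (by omega)]
  refine Program.Runs.of_wp (settleQuery_wp (Q := Q) (q := q) (j := j) (consts.congr (fun x hx =>
    hreg₂ x ?_) (harr₂ 0 (by norm_num)) (harr₂ 1 (by norm_num))) le_rfl hμ (by omega) (by omega) h10
    (by rw [hreg₂ 5 (by simp), r5]) (by rw [hreg₂ 9 (by simp), r9]) (by rw [hsame.reg, h20])
    (by rw [hsame.reg, h21]) ?_)
  · fin_cases hx <;> simp
  have hconsts : ∀ s' : State, (∀ x ≤ 18, x ≠ 5 → x ≠ 6 → x ≠ 7 → x ≠ 9 → s'.reg x = s.reg x) →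
      (∀ A < 2, s'.arr A = s.arr A) → ConvConsts C.n C.w C.m C.slots C.a C.b s' :=
    fun s' h1 h2 => consts.congr (fun x hx => by
      simp only [List.mem_cons, List.not_mem_nil, or_false] at hx
      exact h1 x (by omega) (by omega) (by omega) (by omega) (by omega)) (h2 0 (by norm_num))
      (h2 1 (by norm_num))
  have hr : ∀ x ≤ 18, x ≠ 6 → x ≠ 7 → s₂.reg x = s.reg x := fun x h1 h2 h3 => hreg₂ x (by
    simp only [List.mem_cons, List.not_mem_nil, or_false]
    omega)
  split_ifs with hμlt
  · obtain ⟨x, hx, y, hy, hlt, hxy⟩ := hviol hμlt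
    have e1 : ((Q.I + Q.J) * Q.m + 2 * Q.m - 2 : ℤ) - (μ % (2 * Q.m) : ℕ) =
        ((q / C.m * C.m + x) + (q % C.m * C.m + y) : ℕ) := by
      change ((q / C.m : ℕ) + (q % C.m : ℕ) : ℤ) * C.m + 2 * C.m - 2 - _ = _
      change μ % (2 * C.m) + (x + y) = 2 * C.m - 2 at hxy
      change _ - ((μ % (2 * C.m) : ℕ) : ℤ) = _
      have e2 : ((μ % (2 * C.m) : ℕ) : ℤ) = 2 * C.m - 2 - (x + y) := by omega
      rw [e2, Nat.cast_add, Nat.cast_add, Nat.cast_add, Nat.cast_mul, Nat.cast_mul]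
      ring
    have hlt' : C.a (q / C.m * C.m + x : ℕ) + C.b (q % C.m * C.m + y : ℕ) + 2 * C.w <
        s.arr 3 ((q / C.m * C.m + x) + (q % C.m * C.m + y) : ℕ) := by
      have e3 : (((q / C.m * C.m + x) + (q % C.m * C.m + y) : ℕ) : ℤ) =
          (Q.I + Q.J) * Q.m + (x + y) := by
        rw [Nat.cast_add, Nat.cast_add, Nat.cast_add, Nat.cast_mul, Nat.cast_mul]
        change _ = ((q / C.m : ℕ) + (q % C.m : ℕ) : ℤ) * C.m + (x + y)
        ring
      rw [e3, Nat.cast_add, Nat.cast_add, Nat.cast_mul, Nat.cast_mul]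
      exact hlt
    obtain ⟨hk, hdk, ht'⟩ := ht.clear hlt'
    rw [e1]
    have hact := active_update_lt hk hdk
    set z : ℤ := (((q / C.m * C.m + x) + (q % C.m * C.m + y) : ℕ) : ℤ) with hz
    have e3 : ((((s₂.setReg 22 μ).setArr 3 z 0).setReg 9 (j + 1 : ℕ))).arr 3 =
        Function.update (s.arr 3) z 0 := by
      simp [harr₂ 3 (by norm_num)]
    refine ⟨⟨hconsts _ (fun x h1 h2 h3 h4 h5 => by
        simp [h5, show x ≠ 22 by omega, hr x h1 h3 h4]) (fun A hA => by
        simp [show A ≠ 3 by omega, harr₂ A (by omega)]), by simp [hr, r3], by simp [hr, r4],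
        by simp [harr₂, arr2], by rw [e3]; exact ht', q, j + 1, by simp [hr, r5], hq, by simp,
        by rw [e3]; exact hch.update z, by rw [e3]; omega, fun j' h1 h2 => ?_⟩, ?_⟩
    · have e4 : (((s₂.setReg 22 μ).setArr 3 z 0).setReg 9 (j + 1 : ℕ)).view C.slots j' =
          s₂.view C.slots j' := State.view_congr (fun A hA => by
            simp [show A ≠ 3 by omega]) _ _
      rw [e4, hview₂ j' h1 h2]
    · rw [e3]
      have : ((((s₂.setReg 22 μ).setArr 3 z 0).setReg 9 (j + 1 : ℕ))).reg 5 = q := by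
        simp [hr, r5]
      rw [this, r5]
      exact Nat.add_lt_add_left hact _
  · have e3 : (((s₂.setReg 22 μ).setReg 5 (q + 1 : ℕ)).setReg 9 (j + 1 : ℕ)).arr 3 = s.arr 3 := by
      simp [harr₂ 3 (by norm_num)]
    refine ⟨⟨hconsts _ (fun x h1 h2 h3 h4 h5 => by
        simp [h5, h2, show x ≠ 22 by omega, hr x h1 h3 h4]) (fun A hA => by
        simp [harr₂ A (by omega)]), by simp [hr, r3], by simp [hr, r4],
        by simp [harr₂, arr2], by rw [e3]; exact ht, q + 1, j + 1, by simp, hql, by simp,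
        ?_, by rw [e3]; clear hviol; omega, fun j' h1 h2 => ?_⟩, ?_⟩
    · rw [e3]
      intro I hI J hJ hIJ x hx y hy
      rcases Nat.lt_succ_iff_lt_or_eq.1 hIJ with h1 | h1
      · exact hch I hI J hJ h1 x hx y hy
      · have e5 : I = q / C.m := by
          rw [← h1, mul_comm, Nat.mul_add_div hm, Nat.div_eq_of_lt hJ, add_zero]
        have e6 : J = q % C.m := by
          rw [← h1, add_comm, Nat.add_mul_mod_self_right, Nat.mod_eq_of_lt hJ]
        have h2 := hok (by omega) x hx y hy
        rw [e5, e6]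
        have e7 : (((q / C.m * C.m + x) + (q % C.m * C.m + y) : ℕ) : ℤ) =
            (Q.I + Q.J) * Q.m + (x + y) := by
          rw [Nat.cast_add, Nat.cast_add, Nat.cast_add, Nat.cast_mul, Nat.cast_mul]
          change _ = ((q / C.m : ℕ) + (q % C.m : ℕ) : ℤ) * C.m + (x + y)
          ring
        rw [e7, Nat.cast_add, Nat.cast_add, Nat.cast_mul, Nat.cast_mul]
        exact h2
    · rw [State.view_setReg, State.view_setReg, State.view_setReg, hview₂ j' h1 h2]
    · rw [e3]
      have : (((s₂.setReg 22 μ).setReg 5 (q + 1 : ℕ)).setReg 9 (j + 1 : ℕ)).reg 5 = (q + 1 : ℕ) := by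
        simp
      rw [this, r5, Int.toNat_natCast, Int.toNat_natCast]
      exact Nat.add_lt_add_right (Nat.sub_succ_lt_self _ _ hql) _

end Convolution

/-! ### The convolution algorithm -/

/-- Overwrite the lower bound whose index is in register `6` by the threshold, if that is active. -/
def keepThreshold : Program :=
  .ifPos (.get 3 (.var 6)) (.put 2 (.var 6) (.get 3 (.var 6))) .skip

/-- Set the threshold for the index in register `6`. -/
def raiseThreshold : Program :=
  .seq keepThreshold (.put 3 (.var 6) (.op .add (.get 2 (.var 6)) (.var 4)))

/-- One round: register `3` holds a bound `u` for the error of the lower bounds, which is halved. -/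
def queryRound (p : Program) : Program :=
  .seq (.set 4 (.op .add (.op .div (.var 3) (.lit 2)) (.lit 1)))
  (.seq (.forLoop 6 0 raiseThreshold)
  (.seq (.set 5 (.lit 0))
  (.seq (.loop (.op .sub (.var 18) (.var 5)) (queryStep p))
    (.set 3 (.op .div (.var 3) (.lit 2))))))

/-- The current lower bounds. -/
def State.lower (s : State) (z : ℤ) : ℤ := if 0 < s.arr 3 z then s.arr 3 z else s.arr 2 z

namespace Convolution

variable {C : Convolution}

/-- The state between two rounds. -/
structure RoundInv (C : Convolution) (s : State) : Prop where
  consts : ConvConsts C.n C.w C.m C.slots C.a C.b s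
  outside : ∀ z : ℤ, z < 0 ∨ C.n ≤ z → s.arr 3 z = 0
  state : ∃ u j : ℕ, s.reg 3 = u ∧ u ≤ 4 * C.w ∧ s.reg 9 = j ∧
    (∀ k < C.n, 0 ≤ s.lower k ∧ s.lower k ≤ C.c k + 2 * C.w ∧ C.c k + 2 * C.w ≤ s.lower k + u) ∧
    j + u * C.queries ≤ 4 * C.w * C.queries ∧
    ∀ j' < C.slots, j ≤ j' → s.view C.slots j' = State.zero

theorem raise_runs {u h : ℕ} (hh : h ≤ 4 * C.w) {s : State} (r0 : s.reg 0 = C.n)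
    (r4 : s.reg 4 = h) (hout : ∀ z : ℤ, z < 0 ∨ C.n ≤ z → s.arr 3 z = 0)
    (hb : ∀ k < C.n, 0 ≤ s.lower k ∧ s.lower k ≤ C.c k + 2 * C.w ∧
      C.c k + 2 * C.w ≤ s.lower k + u) :
    (Program.forLoop 6 0 raiseThreshold).Runs C.word s (forTime C.n raiseThreshold.weight) fun s' =>
      (∀ x ≠ 6, s'.reg x = s.reg x) ∧ (∀ A, A ≠ 2 → A ≠ 3 → s'.arr A = s.arr A) ∧
      C.Thresholds u h (s'.arr 2) (s'.arr 3) ∧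
      ∀ k < C.n, s'.arr 3 (k : ℤ) = s'.arr 2 k + h := by
  obtain ⟨hw1, hw2, hw3⟩ := C.small_le_word
  refine (Program.Runs.forLoop hw3 (fun i s' => (∀ x ≠ 6, s'.reg x = s.reg x) ∧
    (∀ A, A ≠ 2 → A ≠ 3 → s'.arr A = s.arr A) ∧
    (∀ z : ℤ, 0 ≤ z → z < i → s'.arr 2 z = s.lower z ∧ s'.arr 3 z = s.lower z + h) ∧
    ∀ z : ℤ, z < 0 ∨ i ≤ z → s'.arr 2 z = s.arr 2 z ∧ s'.arr 3 z = s.arr 3 z) (by norm_num) r0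
    ⟨fun x hx => by simp [hx], fun _ _ _ => rfl, fun z h1 h2 => absurd h1 (by simpa using h2),
      fun _ _ => ⟨rfl, rfl⟩⟩ ?_).mono le_rfl ?_
  · rintro i hi s' h0 h6 ⟨h1, h2, h3, h4⟩
    refine Program.Runs.of_wp ?_
    obtain ⟨e2, e3⟩ := h4 i (.inr le_rfl)
    have e4 : s'.reg 4 = h := by rw [h1 4 (by norm_num), r4]
    obtain ⟨b1, b2, -⟩ := hb i hi
    have b3 := (C.c_mem hi).2
    have hlow : s.lower i = if 0 < s.arr 3 i then s.arr 3 i else s.arr 2 i := rfl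
    simp only [raiseThreshold, keepThreshold, Program.wp, Expr.Readable, Expr.eval, ArithOp.apply,
      h6, e2, e3, e4, State.reg_setArr]
    norm_num
    have hfin : ∀ v : State, v.reg = s'.reg → (∀ A, A ≠ 2 → A ≠ 3 → v.arr A = s.arr A) →
        (∀ z : ℤ, v.arr 2 z = if z = i then s.lower i else s'.arr 2 z) →
        (∀ z : ℤ, v.arr 3 z = if z = i then s.lower i + h else s'.arr 3 z) →
        v.reg 6 = i ∧ v.reg 0 = C.n ∧ (∀ x, ¬ x = 6 → (v.setReg 6 (i + 1)).reg x = s.reg x) ∧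
        (∀ A, ¬ A = 2 → ¬ A = 3 → v.arr A = s.arr A) ∧
        (∀ z : ℤ, 0 ≤ z → z < i + 1 → v.arr 2 z = s.lower z ∧ v.arr 3 z = s.lower z + h) ∧
        ∀ z : ℤ, z < 0 ∨ (i : ℤ) + 1 ≤ z → v.arr 2 z = s.arr 2 z ∧ v.arr 3 z = s.arr 3 z := by
      intro v hv hvA hv2 hv3
      refine ⟨by rw [hv, h6], by rw [hv, h0], fun x hx => by simp [hx, hv, h1 x hx], hvA,
        fun z hz hz' => ?_, fun z hz => ?_⟩
      · rw [hv2, hv3]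
        split_ifs with e
        · subst e; exact ⟨rfl, rfl⟩
        · exact h3 z hz (by omega)
      · rw [hv2, hv3, if_neg (by omega), if_neg (by omega)]
        exact h4 z (by omega)
    refine ⟨fun hpos => ?_, fun hneg => ?_⟩
    · rw [if_pos hpos] at hlow
      refine ⟨by omega, by omega, ?_⟩
      have := hfin ((s'.setArr 2 i (s.arr 3 i)).setArr 3 i (s.arr 3 i + h)) rfl
        (fun A hA hA' => by simp [hA, hA', h2 A hA hA'])
        (fun z => by simp [Function.update_apply, hlow])
        (fun z => by simp [Function.update_apply, hlow])
      simpa [h6] using this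
    · rw [if_neg (by omega)] at hlow
      refine ⟨by omega, ?_⟩
      have := hfin (s'.setArr 3 i (s.arr 2 i + h)) rfl
        (fun A hA hA' => by simp [hA', h2 A hA hA'])
        (fun z => by
          simp only [State.arr_setArr]
          norm_num
          intro e
          rw [e, hlow, e2])
        (fun z => by simp [Function.update_apply, hlow])
      simpa [h6] using this
  · rintro s' - ⟨-, -, h1, h2, h3, h4⟩
    refine ⟨h1, h2, ⟨fun z hz => by rw [(h4 z hz).2, hout z hz], fun k hk => ?_, fun k hk => ?_⟩,
      fun k hk => ?_⟩
    · rw [(h3 k (by omega) (by omega)).1]; exact hb k hk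
    · obtain ⟨e2, e3⟩ := h3 k (by omega) (by omega)
      left; rw [e2, e3]
    · obtain ⟨e2, e3⟩ := h3 k (by omega) (by omega)
      rw [e2, e3]

/-- An upper bound for the running time of a round, with generous constants. -/
def roundTime (C : Convolution) (p : Program) (T : ℕ) : ℕ :=
  1000 * (loadInstance.weight + settleQuery.weight + raiseThreshold.weight + p.slowdown + 1000) *
    (C.queries * (C.m + T))

theorem roundTime_ge (C : Convolution) (p : Program) (T : ℕ) :
    300 + (forTime C.n raiseThreshold.weight + (5 + ((C.queries *
      ((((loadInstance.weight + 1000) * 300 * (C.m + 1)) +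
        (2 * p.slowdown * T + settleQuery.weight)) + 36 + 1) + 36 + 1) + 300))) ≤
      C.roundTime p T := by
  have hm : 1 ≤ C.m := C.m_pos
  have hq : 1 ≤ C.queries := le_trans (Nat.mul_pos C.m_pos C.m_pos) (Nat.le_add_right _ _)
  have hn : C.n ≤ C.queries := Nat.le_add_left _ _
  unfold roundTime forTime
  generalize loadInstance.weight = x
  generalize settleQuery.weight = y
  generalize raiseThreshold.weight = v
  generalize p.slowdown = σ
  generalize C.queries = q at *
  generalize C.m = m at *
  generalize C.n = n at *
  have h1 : n * (v + 200) ≤ q * (v + 200) := Nat.mul_le_mul_right _ hn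
  have h2 : (x + 1000) * 300 * (m + 1) + (2 * σ * T + y) + 36 + 1 ≤
      700 * (x + y + σ + 1000) * (m + T) := by
    nlinarith [Nat.zero_le (x * T), Nat.zero_le (σ * m), Nat.zero_le (σ * T), Nat.zero_le (y * T),
      Nat.mul_le_mul_left x hm, Nat.mul_le_mul_left y hm]
  have h3 := Nat.mul_le_mul_left q h2
  have h4 : v + 1000 ≤ (v + 1000) * (m + T) := Nat.le_mul_of_pos_right _ (by omega)
  have h5 := Nat.mul_le_mul_left q h4
  have h6 : 1000 * (x + y + v + σ + 1000) * (q * (m + T)) =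
      q * (700 * (x + y + σ + 1000) * (m + T)) + q * ((v + 1000) * (m + T)) +
      (q * ((300 * (x + y + σ) + 999 * v + 299000) * (m + T))) := by ring
  have h7 : 2000 * q ≤ q * ((300 * (x + y + σ) + 999 * v + 299000) * (m + T)) := by
    rw [mul_comm]
    refine Nat.mul_le_mul_left q ?_
    nlinarith [Nat.zero_le ((300 * (x + y + σ) + 999 * v) * (m + T))]
  nlinarith

/-- A round restores the invariant with half the error; the halving shows in the bit length. -/
theorem queryRound_runs {p : Program} {T : ℕ} (hp : C.SolvedBy p T) {s : State}
    (hs : C.RoundInv s) (hpos : 0 < s.reg 3) :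
    (queryRound p).Runs C.word s (C.roundTime p T) fun s' =>
      C.RoundInv s' ∧ Nat.size (s'.reg 3).toNat < Nat.size (s.reg 3).toNat := by
  obtain ⟨consts, hout, u, j, r3, hu, r9, hb, hj, hfresh⟩ := hs
  obtain ⟨hw1, hw2, hw3⟩ := C.small_le_word
  have hwp := C.w_pos
  have hu0 : 0 < u := by omega
  refine Program.Runs.mono ?_ (C.roundTime_ge p T) fun _ _ h => h
  refine Program.Runs.seq (Program.Runs.block (Q := fun s' => s' = s.setReg 4 (u / 2 + 1 : ℕ))
    (by decide) ?_) ?_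
  · simp only [Program.wp, Expr.Readable, Expr.eval, ArithOp.apply, r3]
    refine ⟨by simp, by omega, by push_cast; rfl⟩
  rintro s₀ rfl
  refine Program.Runs.seq (raise_runs (u := u) (h := u / 2 + 1) (by omega)
    (by simpa using consts.r0) (by simp) hout hb) ?_
  rintro s₁ ⟨hr₁, ha₁, ht, hd⟩
  refine Program.Runs.seq (N := 5) (Q' := fun s' => s' = s₁.setReg 5 0)
    (Program.Runs.of_wp (p := .set 5 (.lit 0)) ⟨trivial, by simp, rfl⟩) ?_
  rintro s₂ rfl
  have hinv : C.QueryInv u (u / 2 + 1) (j + C.queries) (s₁.arr 2) (s₁.setReg 5 0) := by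
    refine ⟨consts.congr (fun x hx => ?_) ?_ ?_, ?_, ?_, rfl, ht, 0, j, ?_, Nat.zero_le _, ?_, ?_,
      ?_, fun j' h1 h2 => ?_⟩
    · simp only [List.mem_cons, List.not_mem_nil, or_false] at hx
      simp [show x ≠ 5 by omega, show x ≠ 4 by omega, hr₁ x (by omega)]
    · exact ha₁ 0 (by norm_num) (by norm_num)
    · exact ha₁ 1 (by norm_num) (by norm_num)
    · simp [hr₁, r3]
    · simp [hr₁]
    · simp
    · simp [hr₁, r9]
    · intro I _ J _ h; omega
    · have := active_le C.n (s₁.arr 3)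
      simp only [State.arr_setReg, queries]
      omega
    · rw [State.view_setReg, State.view_congr (fun A hA => ha₁ A (by omega) (by omega)),
        State.view_setReg, hfresh j' h1 h2]
  have hlt : j + C.queries < C.slots := by
    have := Nat.mul_le_mul_right C.queries hu0
    unfold slots
    omega
  have hloop := Program.Runs.loop (X := C.word) (e := .op .sub (.var 18) (.var 5))
    (p := queryStep p) (C.QueryInv u (u / 2 + 1) (j + C.queries) (s₁.arr 2))
    (fun s => (C.m * C.m - (s.reg 5).toNat) + active C.n (s.arr 3)) (fun _ _ _ => ⟨trivial, trivial⟩)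
    (fun s h h' => queryStep_runs hp (Nat.succ_pos _) (by omega) hlt h h') hinv
  refine Program.Runs.seq (hloop.mono ?_ fun _ _ h => h) ?_
  · refine Nat.add_le_add_right (Nat.add_le_add_right (Nat.mul_le_mul_right _ ?_) _) _
    have := active_le C.n (s₁.arr 3)
    simp only [State.arr_setReg, queries]
    omega
  rintro s₃ ⟨⟨consts₃, r3₃, -, arr2₃, ht₃, q, j₃, r5₃, hq, r9₃, hch, hj₃, hfresh₃⟩, he⟩
  simp only [Expr.eval, ArithOp.apply, consts₃.r18, r5₃] at he
  obtain rfl : q = C.m * C.m := by omega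
  refine Program.Runs.block (by decide) ?_
  have e3 : ((u : ℤ) / 2).toNat = u / 2 := by omega
  simp only [Program.wp, Expr.Readable, Expr.eval, ArithOp.apply, r3₃]
  refine ⟨by simp, by omega, ⟨consts₃.congr (fun x hx => ?_) rfl rfl, ht₃.outside, u / 2, j₃,
    by simp, by omega, by simpa using r9₃, fun k hk => ?_, ?_, fun j' h1 h2 => ?_⟩, ?_⟩
  · simp only [List.mem_cons, List.not_mem_nil, or_false] at hx
    simp [show x ≠ 3 by omega]
  · have := ht₃.halve hch hk
    rw [← arr2₃] at this
    exact this
  · have h1 := Nat.mul_le_mul_right C.queries (show u / 2 + 1 ≤ u by omega)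
    rw [add_mul] at h1
    omega
  · rw [State.view_setReg, hfresh₃ j' h1 h2]
  · rw [r3, State.reg_setReg, if_pos rfl, e3, Int.toNat_natCast]
    exact Nat.lt_of_succ_le (Nat.size_div_two hu0).le

end Convolution

/-! ### Setting up the convolution algorithm, and reading off the result -/

/-- The sum `1 + ∑ (a k ^ 2 + b k ^ 2)` over the first `i` indices. -/
def squareSum (a b : ℤ → ℤ) (i : ℕ) : ℕ :=
  1 + ∑ k ∈ Finset.range i, ((a k).natAbs ^ 2 + (b k).natAbs ^ 2)

theorem squareSum_mono (a b : ℤ → ℤ) {i j : ℕ} (h : i ≤ j) : squareSum a b i ≤ squareSum a b j :=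
  Nat.add_le_add_left (Finset.sum_le_sum_of_subset (by simpa using h)) _

theorem le_squareSum (a b : ℤ → ℤ) {k n : ℕ} (h : k < n) :
    (a k).natAbs ≤ squareSum a b n ∧ (b k).natAbs ≤ squareSum a b n := by
  have h1 := Finset.single_le_sum (f := fun k : ℕ => (a k).natAbs ^ 2 + (b k).natAbs ^ 2)
    (fun _ _ => Nat.zero_le _) (Finset.mem_range.2 h)
  have h2 := Nat.le_self_pow two_ne_zero (a k).natAbs
  have h3 := Nat.le_self_pow two_ne_zero (b k).natAbs
  simp only [squareSum]
  omega

theorem exists_isLeast_add (a b : ℤ → ℤ) (k : ℕ) :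
    ∃ c, IsLeast {v : ℤ | ∃ i j : ℕ, i + j = k ∧ v = a i + b j} c := by
  obtain ⟨x, hx, hmin⟩ := Finset.exists_min_image
    (Finset.HasAntidiagonal.antidiagonal k) (fun x : ℕ × ℕ => a x.1 + b x.2)
    ⟨(k, 0), Finset.HasAntidiagonal.mem_antidiagonal.2 (add_zero k)⟩
  refine ⟨_, ⟨x.1, x.2, Finset.HasAntidiagonal.mem_antidiagonal.1 hx, rfl⟩, ?_⟩
  rintro _ ⟨i, j, h, rfl⟩
  exact hmin (i, j) (Finset.HasAntidiagonal.mem_antidiagonal.2 h)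

/-- The instance of minimum convolution, with a bound for its entries and a block length. -/
noncomputable def SequencePair.toConvolution (I : SequencePair) : Convolution where
  n := I.n
  w := squareSum (arrayOf I.a) (arrayOf I.b) I.n
  m := Nat.sqrt (I.n - 1) + 1
  a := arrayOf I.a
  b := arrayOf I.b
  c k := (exists_isLeast_add (arrayOf I.a) (arrayOf I.b) k).choose
  m_pos := Nat.succ_pos _
  w_pos := by unfold squareSum; omega
  n_le := by
    have := Nat.lt_succ_sqrt (I.n - 1)
    simp only [Nat.succ_eq_add_one] at this
    omega
  a_le z := by
    by_cases hz : 0 ≤ z ∧ z < I.n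
    · obtain ⟨k, rfl⟩ := Int.eq_ofNat_of_zero_le hz.1
      exact (le_squareSum _ _ (by omega)).1
    · simp [arrayOf, hz]
  b_le z := by
    by_cases hz : 0 ≤ z ∧ z < I.n
    · obtain ⟨k, rfl⟩ := Int.eq_ofNat_of_zero_le hz.1
      exact (le_squareSum _ _ (by omega)).2
    · simp [arrayOf, hz]
  isLeast k _ := (exists_isLeast_add (arrayOf I.a) (arrayOf I.b) k).choose_spec

/-- Register `1` receives a bound for the entries of both sequences. -/
def boundEntries : Program :=
  .seq (.set 1 (.lit 1)) (.forLoop 6 0 (.set 1 (.op .add (.var 1) (.op .add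
    (.op .mul (.get 0 (.var 6)) (.get 0 (.var 6))) (.op .mul (.get 1 (.var 6)) (.get 1 (.var 6)))))))

/-- Register `2` receives the block length, the least positive number whose square is at least the
length of the sequences. -/
def findBlockLength : Program :=
  .seq (.set 2 (.lit 1)) (.loop (.op .sub (.var 0) (.op .mul (.var 2) (.var 2)))
    (.set 2 (.op .add (.var 2) (.lit 1))))

/-- Set the registers with constants. -/
def initConstants : Program :=
  .seq (.set 18 (.op .mul (.var 2) (.var 2)))
  (.seq (.set 11 (.op .mul (.lit 240) (.var 2)))
  (.seq (.set 17 (.op .mul (.lit 264) (.var 2)))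
  (.seq (.set 14 (.op .mul (.op .mul (.lit 2) (.var 2))
    (.op .add (.op .mul (.lit 12) (.var 1)) (.lit 1))))
  (.seq (.set 15 (.op .mul (.op .mul (.lit 8) (.op .mul (.lit 24) (.var 2)))
    (.op .add (.var 14) (.lit 1))))
  (.seq (.set 16 (.op .add (.op .add (.op .mul (.var 11) (.op .add (.op .mul (.lit 3) (.var 15))
    (.op .mul (.op .sub (.op .mul (.lit 26) (.var 2)) (.lit 2)) (.op .add (.var 14) (.lit 1)))))
    (.op .mul (.lit 144) (.var 2))) (.op .sub (.op .mul (.lit 26) (.var 2)) (.lit 2))))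
  (.seq (.set 3 (.op .mul (.lit 4) (.var 1)))
    (.set 8 (.op .add (.op .mul (.op .mul (.lit 4) (.var 1))
      (.op .add (.op .mul (.var 2) (.var 2)) (.var 0))) (.lit 1)))))))))

/-- Write the entry of the result whose index is in register `6`. -/
def writeResult : Program :=
  .seq keepThreshold
    (.put 2 (.var 6) (.op .sub (.get 2 (.var 6)) (.op .mul (.lit 2) (.var 1))))

/-- Minimum convolution with the program `p` for Frobenius numbers with known residue. -/
def convolutionFromFrobenius (p : Program) : Program :=
  .seq boundEntries (.seq findBlockLength (.seq initConstants
    (.seq (.loop (.var 3) (queryRound p)) (.forLoop 6 0 writeResult))))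

namespace Convolution

variable {C : Convolution}

theorem itemFloor_le_word : itemFloor C.m C.w ≤ C.word := by
  have := (frobenius_promise (C.query (fun _ => 0) (fun _ => le_rfl)
    (fun _ => by positivity) 0) (Nat.zero_le _)).2.2
  exact le_trans (Nat.le_add_right _ _) this

/-- The memory holds the input only, apart from constants and counters. -/
structure InputInv (C : Convolution) (s : State) : Prop where
  r0 : s.reg 0 = C.n
  r9 : s.reg 9 = 0
  arr0 : s.arr 0 = C.a
  arr1 : s.arr 1 = C.b
  arr2 : s.arr 2 = fun _ => 0
  arr3 : s.arr 3 = fun _ => 0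
  fresh : ∀ L j, s.view L j = State.zero

theorem InputInv.setReg {s : State} (h : C.InputInv s) {x : ℕ} (hx : x ≠ 0) (hx' : x ≠ 9) (v : ℤ) :
    C.InputInv (s.setReg x v) where
  r0 := by simp [hx.symm, h.r0]
  r9 := by simp [hx'.symm, h.r9]
  arr0 := h.arr0
  arr1 := h.arr1
  arr2 := h.arr2
  arr3 := h.arr3
  fresh := fun L j => by rw [State.view_setReg, h.fresh]

theorem boundEntries_runs (hw : C.w = squareSum C.a C.b C.n) {s : State} (hs : C.InputInv s) :
    boundEntries.Runs C.word s (5000 * (C.n + 1)) fun s' => C.InputInv s' ∧ s'.reg 1 = C.w := by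
  obtain ⟨hw1, hw2, hw3⟩ := C.small_le_word
  have hwp := C.w_pos
  refine Program.Runs.mono (N := 17 + forTime C.n 1000) ?_ (by unfold forTime; omega)
    fun _ _ h => h
  refine Program.Runs.seq (Program.Runs.block (Q := fun s' => s' = s.setReg 1 1) (by decide)
    ⟨trivial, by simp; omega, rfl⟩) ?_
  rintro _ rfl
  refine (Program.Runs.forLoop hw3 (fun i s' => C.InputInv s' ∧ s'.reg 1 = squareSum C.a C.b i)
    (by norm_num) (by simp [hs.r0])
    ⟨(hs.setReg (by norm_num) (by norm_num) _).setReg (by norm_num) (by norm_num) _,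
      by simp [squareSum]⟩ ?_).mono le_rfl ?_
  · rintro i hi s' h0 h6 ⟨h1, h2⟩
    refine Program.Runs.block (by decide) ?_
    have e : s'.reg 1 + (C.a i * C.a i + C.b i * C.b i) = squareSum C.a C.b (i + 1) := by
      rw [h2, squareSum, squareSum, Finset.sum_range_succ]
      push_cast
      rw [sq_abs, sq_abs]
      ring
    have hle := squareSum_mono C.a C.b (show i + 1 ≤ C.n by omega)
    simp only [Program.wp, Expr.Readable, Expr.eval, ArithOp.apply, h6, h1.arr0, h1.arr1, e]
    refine ⟨by simp, by omega, by simp [h6], by simp [h0],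
      (h1.setReg (by norm_num) (by norm_num) _).setReg (by norm_num) (by norm_num) _, by simp⟩
  · rintro s' - ⟨-, -, h1, h2⟩
    exact ⟨h1, by rw [h2, hw]⟩

theorem findBlockLength_runs (hn : 0 < C.n) (hm : C.m = Nat.sqrt (C.n - 1) + 1) {s : State}
    (hs : C.InputInv s) (r1 : s.reg 1 = C.w) :
    findBlockLength.Runs C.word s (1000 * (C.m + 1)) fun s' =>
      C.InputInv s' ∧ s'.reg 1 = C.w ∧ s'.reg 2 = C.m := by
  obtain ⟨hw1, hw2, hw3⟩ := C.small_le_word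
  have hmm : C.m ≤ C.m * C.m := Nat.le_mul_self _
  have hmp := C.m_pos
  refine Program.Runs.mono (N := 17 + (C.m * (100 + 100 + 1) + 100 + 1)) ?_ (by omega)
    fun _ _ h => h
  refine Program.Runs.seq (Program.Runs.block (Q := fun s' => s' = s.setReg 2 1) (by decide)
    ⟨trivial, by simp; omega, rfl⟩) ?_
  rintro _ rfl
  have hloop := Program.Runs.loop (X := C.word)
    (e := .op .sub (.var 0) (.op .mul (.var 2) (.var 2)))
    (p := .set 2 (.op .add (.var 2) (.lit 1))) (N := 100)
    (fun s' => C.InputInv s' ∧ s'.reg 1 = C.w ∧ ∃ x : ℕ, s'.reg 2 = x ∧ x ≤ C.m)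
    (fun s' => C.m - (s'.reg 2).toNat) (fun _ _ _ => by simp) ?_ (s := s.setReg 2 1)
    ⟨hs.setReg (by norm_num) (by norm_num) _, by simp [r1], 1, by simp, by omega⟩
  · refine hloop.mono ?_ ?_
    · refine Nat.add_le_add_right (Nat.add_le_add (Nat.mul_le_mul (Nat.sub_le _ _) ?_) ?_) _
      · exact Nat.add_le_add_right (Nat.add_le_add_left (by decide) _) _
      · decide
    · rintro s' - ⟨⟨h1, h2, x, h3, h4⟩, h5⟩
      refine ⟨h1, h2, ?_⟩
      simp only [Expr.eval, ArithOp.apply, h1.r0, h3] at h5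
      have h6 : C.n ≤ x * x := by
        zify; omega
      have h7 : Nat.sqrt (C.n - 1) < x := Nat.sqrt_lt.2 (by omega)
      rw [h3]
      norm_cast
      omega
  · rintro s' ⟨h1, h2, x, h3, h4⟩ h5
    simp only [Expr.eval, ArithOp.apply, h1.r0, h3] at h5
    have h6 : x * x < C.n := by zify; omega
    have h7 : x ≤ Nat.sqrt (C.n - 1) := Nat.le_sqrt.2 (by omega)
    refine Program.Runs.block (by decide) ?_
    simp only [Program.wp, Expr.Readable, Expr.eval, ArithOp.apply, h3]
    refine ⟨by simp, by omega, ⟨h1.setReg (by norm_num) (by norm_num) _, by simp [h2], x + 1,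
      by simp, by omega⟩, ?_⟩
    simp only [State.reg_setReg, if_true]
    omega

theorem initConstants_runs {s : State}
    (hs : C.InputInv s) (r1 : s.reg 1 = C.w) (r2 : s.reg 2 = C.m) :
    initConstants.Runs C.word s initConstants.weight fun s' =>
      C.RoundInv s' ∧ s'.reg 3 = (4 * C.w : ℕ) := by
  obtain ⟨hw1, hw2, hw3⟩ := C.small_le_word
  have hmm : C.m ≤ C.m * C.m := Nat.le_mul_self _
  have hmp := C.m_pos
  have hfl := C.itemFloor_le_word
  have hba := C.itemBase_le_word
  have hsl := C.slots_le_word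
  have hbo : 2 * C.m * (12 * C.w + 1) ≤ C.word := by
    refine le_trans ?_ hba
    unfold itemBase
    exact (Nat.le_succ _).trans (Nat.le_mul_of_pos_left _ (by omega))
  refine Program.Runs.of_wp ?_
  have e14 : (2 * C.m * (12 * C.w + 1) : ℤ) = (2 * C.m * (12 * C.w + 1) : ℕ) := by push_cast; rfl
  have e15 : (8 * (24 * C.m) * ((2 * C.m * (12 * C.w + 1) : ℕ) + 1) : ℤ) = itemBase C.m C.w := by
    unfold itemBase; push_cast; rfl
  have e26 : (26 * C.m - 2 : ℤ) = (26 * C.m - 2 : ℕ) := by omega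
  have e16 : ((240 * C.m * (3 * itemBase C.m C.w + (26 * C.m - 2) *
      ((2 * C.m * (12 * C.w + 1) : ℕ) + 1)) + 144 * C.m + (26 * C.m - 2) : ℤ)) =
      itemFloor C.m C.w := by
    rw [e26]
    unfold itemFloor
    push_cast
    ring
  have e8 : (4 * C.w * (C.m * C.m + C.n) + 1 : ℤ) = C.slots := by
    unfold slots queries; push_cast; rfl
  simp only [initConstants, Program.wp, Expr.Readable, Expr.eval, ArithOp.apply, State.reg_setReg]
  simp only [Nat.reduceEqDiff, if_false, reduceIte, r1, r2, hs.r0, e14, e15, e16, e8,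
    true_and]
  have em : (C.m * C.m : ℤ) = (C.m * C.m : ℕ) := by push_cast; rfl
  rw [em]
  refine ⟨by omega, by omega, by omega, by omega, by omega, by omega, by omega, by omega,
    ⟨⟨?_, ?_, ?_, ?_, ?_, ?_, ?_, ?_, ?_, ?_, hs.arr0, hs.arr1⟩, fun z _ => by simp [hs.arr3],
    4 * C.w, 0, by simp, le_rfl, by simp [hs.r9], fun k hk => ?_, by omega, fun j' _ _ => ?_⟩, ?_⟩
  · simp [hs.r0]
  · simp [r1]
  · simp [r2]
  · simp
  · simp
  · simp
  · simp
  · simp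
  · simp
  · simp
  · have := C.c_mem hk
    simp only [State.lower, State.arr_setReg, hs.arr3, hs.arr2, lt_irrefl, if_false]
    clear e14 e15 e16 e8
    omega
  · simp only [State.view_setReg, hs.fresh]
  · simp

theorem writeResult_runs {s : State} (hs : C.RoundInv s) (h3 : s.reg 3 ≤ 0) :
    (Program.forLoop 6 0 writeResult).Runs C.word s (forTime C.n writeResult.weight) fun s' =>
      ∀ k < C.n, s'.arr 2 (k : ℤ) = C.c k := by
  obtain ⟨consts, hout, u, j, r3, hu, r9, hb, hj, hfresh⟩ := hs
  obtain ⟨hw1, hw2, hw3⟩ := C.small_le_word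
  obtain rfl : u = 0 := by omega
  refine (Program.Runs.forLoop hw3 (fun i s' => s'.reg 1 = C.w ∧ s'.arr 3 = s.arr 3 ∧
    (∀ k < i, s'.arr 2 (k : ℤ) = C.c k) ∧ ∀ k : ℕ, i ≤ k → s'.arr 2 k = s.arr 2 k) (by norm_num)
    consts.r0 ⟨by simp [consts.r1], rfl, by simp, fun _ _ => rfl⟩ ?_).mono le_rfl ?_
  · rintro i hi s' h0 h6 ⟨h1, h2, h3, h4⟩
    refine Program.Runs.of_wp ?_
    obtain ⟨b1, b2, b3⟩ := hb i hi
    obtain ⟨b4, b5⟩ := C.c_mem hi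
    have e2 := h4 i le_rfl
    have hlow : s.lower i = if 0 < s.arr 3 i then s.arr 3 i else s.arr 2 i := rfl
    have hc : s.lower i - 2 * C.w = C.c i := by omega
    have hupd : ∀ v : ℤ → ℤ, (∀ z : ℤ, z ≠ i → v z = s'.arr 2 z) → v i = C.c i →
        (∀ k < i + 1, v (k : ℤ) = C.c k) ∧ ∀ k : ℕ, i + 1 ≤ k → v k = s.arr 2 k := by
      refine fun v hv hvi => ⟨fun k hk => ?_, fun k hk => ?_⟩
      · rcases Nat.lt_succ_iff_lt_or_eq.1 hk with hk | rfl
        · rw [hv _ (by omega), h3 k hk]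
        · exact hvi
      · rw [hv _ (by omega), h4 k (by omega)]
    simp only [writeResult, keepThreshold, Program.wp, Expr.Readable, Expr.eval, ArithOp.apply,
      h6, e2, h2, h1, State.reg_setArr, State.arr_setArr]
    norm_num
    refine ⟨fun hpos => ?_, fun hneg => ?_⟩
    · rw [if_pos hpos] at hlow
      rw [← hlow, hc]
      refine ⟨by omega, by omega, h0, h1, h2, ?_⟩
      have := hupd (Function.update (s'.arr 2) i (C.c i))
        (fun z hz => Function.update_of_ne hz _ _) (Function.update_self _ _ _)
      simpa using this
    · rw [if_neg (by omega)] at hlow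
      rw [← hlow, hc]
      refine ⟨by omega, h0, h1, h2, ?_⟩
      have := hupd (Function.update (s'.arr 2) i (C.c i))
        (fun z hz => Function.update_of_ne hz _ _) (Function.update_self _ _ _)
      simpa using this
  · rintro s' - ⟨-, -, -, -, h1, -⟩
    exact h1

end Convolution

theorem SequencePair.queries_le (I : SequencePair) : I.toConvolution.queries ≤ 5 * I.n := by
  have h1 := Nat.sqrt_le (I.n - 1)
  have h2 := I.pos
  have h3 : Nat.sqrt (I.n - 1) ≤ Nat.sqrt (I.n - 1) * Nat.sqrt (I.n - 1) := Nat.le_mul_self _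
  change (Nat.sqrt (I.n - 1) + 1) * (Nat.sqrt (I.n - 1) + 1) + I.n ≤ _
  rw [show (Nat.sqrt (I.n - 1) + 1) * (Nat.sqrt (I.n - 1) + 1) =
    Nat.sqrt (I.n - 1) * Nat.sqrt (I.n - 1) + 2 * Nat.sqrt (I.n - 1) + 1 by ring]
  omega

theorem SequencePair.inputInv (I : SequencePair) : I.toConvolution.InputInv (minConv.input I) where
  r0 := rfl
  r9 := rfl
  arr0 := rfl
  arr1 := rfl
  arr2 := rfl
  arr3 := rfl
  fresh L j := by
    ext x i
    · simp [State.view, State.zero, minConv]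
    · simp [State.view, State.zero, minConv, show 11 + x ≠ 1 by omega]

theorem SequencePair.input_bounded (I : SequencePair) :
    (minConv.input I).Bounded I.toConvolution.word where
  reg x := by
    have : I.n ≤ _ := I.toConvolution.small_le_word.2.2
    simp only [minConv]
    split_ifs
    · simpa using this
    · simp
  arr A _ z := by
    have hw := I.toConvolution.small_le_word.2.1
    have h1 := I.toConvolution.a_le z
    have h2 := I.toConvolution.b_le z
    have e1 : I.toConvolution.a = arrayOf I.a := rfl
    have e2 : I.toConvolution.b = arrayOf I.b := rfl
    rw [e1] at h1
    rw [e2] at h2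
    simp only [minConv]
    split_ifs
    · omega
    · omega
    · simp

theorem convolutionTime_le {n m q T x y v z z' : ℕ} (hn : 0 < n) (hm : 1 ≤ m) (hq : q ≤ 5 * n)
    (hz : z' ≤ z) :
    5000 * (n + 1) + (1000 * (m + 1) + (y + ((z' * (1000 * x * (q * (m + T)) + 4 + 1) + 4 + 1) +
      forTime n v))) ≤ (5000 * x + y + v + 20000) * (n * (m + T)) * (z + 1) := by
  set N := n * (m + T) with hN
  have h4 : n ≤ N := Nat.le_mul_of_pos_right _ (by omega)
  have h5 : m ≤ N := (Nat.le_add_right _ _).trans (Nat.le_mul_of_pos_left _ hn)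
  have h6 : q * (m + T) ≤ 5 * N := by
    rw [hN, ← mul_assoc]; exact Nat.mul_le_mul_right _ hq
  have h7 : 1000 * x * (q * (m + T)) + 4 + 1 ≤ (5000 * x + 5) * N := by
    have := Nat.mul_le_mul_left (1000 * x) h6
    rw [add_mul, show 5000 * x * N = 1000 * x * (5 * N) by ring]
    omega
  have h8 := Nat.mul_le_mul hz h7
  have h9 : y ≤ y * N := Nat.le_mul_of_pos_right _ (by omega)
  have h10 := Nat.mul_le_mul_right v h4
  have h11 := Nat.zero_le (z * ((y + v) * N))
  have h12 := Nat.zero_le (x * N)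
  have h13 := Nat.zero_le (z * N)
  rw [forTime, show (5000 * x + y + v + 20000) * N * (z + 1) = z * ((5000 * x + 5) * N) +
    z * ((y + v) * N) + 19995 * (z * N) + 5000 * (x * N) + y * N + v * N + 20000 * N by ring,
    show n * (v + 200) = n * v + 200 * n by ring, mul_comm v N]
  omega

/-- The number of queries is about `n` per round, and the number of rounds is logarithmic. -/
theorem convolutionFromFrobenius_solves (p : Program) : ∃ K, ∀ (I : SequencePair) (T : ℕ),
    I.toConvolution.SolvedBy p T → minConv.SolvedBy (convolutionFromFrobenius p) I
      (K * (I.n * (I.toConvolution.m + T)) * (Nat.size I.toConvolution.word + 1) ^ 2) := by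
  refine ⟨5000 * (loadInstance.weight + settleQuery.weight + raiseThreshold.weight + p.slowdown +
    1000) + initConstants.weight + writeResult.weight + 20000, fun I T hp => ?_⟩
  have hqueries := I.queries_le
  set C := I.toConvolution with hC
  obtain ⟨hw1, hw2, hw3⟩ := C.small_le_word
  have hwp := C.w_pos
  have key : (convolutionFromFrobenius p).Runs C.word (minConv.input I)
      (5000 * (C.n + 1) + (1000 * (C.m + 1) + (initConstants.weight +
        ((Nat.size (4 * C.w) * (C.roundTime p T + 4 + 1) + 4 + 1) +
          forTime C.n writeResult.weight)))) (minConv.Correct I) := by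
    refine Program.Runs.seq (Convolution.boundEntries_runs rfl I.inputInv) fun s₁ hs₁ =>
      Program.Runs.seq (Convolution.findBlockLength_runs I.pos rfl hs₁.1 hs₁.2) fun s₂ hs₂ =>
      Program.Runs.seq (Convolution.initConstants_runs hs₂.1 hs₂.2.1 hs₂.2.2) fun s₃ hs₃ =>
      Program.Runs.seq (Q' := fun s' => C.RoundInv s' ∧ s'.reg 3 ≤ 0) ?_ fun s₄ hs₄ =>
      (Convolution.writeResult_runs hs₄.1 hs₄.2).mono le_rfl ?_
    · have hloop := Program.Runs.loop (X := C.word) (e := .var 3) (p := queryRound p) C.RoundInv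
        (fun s => Nat.size (s.reg 3).toNat) (fun _ _ _ => trivial)
        (fun s h h' => Convolution.queryRound_runs hp h h') hs₃.1
      rw [hs₃.2, Int.toNat_natCast] at hloop
      exact hloop
    · rintro s' - hs' k
      have h1 := hs' k k.2
      have h2 := C.isLeast k k.2
      rw [h1]
      refine ⟨?_, ?_⟩
      · obtain ⟨i, j, hij, hc⟩ := h2.1
        have hi : i < I.n := by have := k.2; omega
        have hj : j < I.n := by have := k.2; omega
        refine ⟨⟨i, hi⟩, ⟨j, hj⟩, hij, ?_⟩
        rw [hc]
        change arrayOf I.a i + arrayOf I.b j = _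
        rw [arrayOf_apply _ hi, arrayOf_apply _ hj]
      · rintro _ ⟨i, j, hij, rfl⟩
        refine h2.2 ⟨i, j, hij, ?_⟩
        change _ = arrayOf I.a i + arrayOf I.b j
        rw [arrayOf_apply _ i.2, arrayOf_apply _ j.2]
  obtain ⟨T', s', h1, h2, h3⟩ := key.solvedBy I.input_bounded
  refine ⟨T', s', h1, h2.trans ?_, h3⟩
  rw [sq, ← mul_assoc]
  refine Nat.mul_le_mul_right _ ?_
  have hz : Nat.size (4 * C.w) ≤ Nat.size C.word := Nat.size_le_size (by omega)
  have hn : C.n = I.n := rfl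
  have hm : 1 ≤ C.m := C.m_pos
  have hn1 := I.pos
  rw [hn]
  exact convolutionTime_le hn1 hm hqueries hz

/-! ### Running times with polylogarithmic factors -/

/-- The factor whose powers are the polylogarithmic factors. -/
noncomputable def logFactor (W : ℕ) : ℝ := 1 + Real.log (1 + (W : ℝ))

theorem polylog_eq (k W : ℕ) : polylog k W = logFactor W ^ k := rfl

theorem one_le_logFactor (W : ℕ) : 1 ≤ logFactor W :=
  le_add_of_nonneg_right (Real.log_nonneg (by linarith [Nat.cast_nonneg (α := ℝ) W]))

theorem logFactor_mono {V W : ℕ} (h : V ≤ W) : logFactor V ≤ logFactor W := by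
  have h' : (V : ℝ) ≤ W := by exact_mod_cast h
  exact add_le_add_right (Real.log_le_log (by positivity) (by linarith)) _

theorem size_add_one_le (x : ℕ) : (x.size : ℝ) + 1 ≤ 2 * logFactor x := by
  have hl : 0 ≤ Real.log (1 + (x : ℝ)) := Real.log_nonneg (by linarith [Nat.cast_nonneg (α := ℝ) x])
  unfold logFactor
  rcases Nat.eq_zero_or_pos x.size with h | h
  · rw [h]; push_cast; linarith
  · have h1 : 2 ^ (x.size - 1) ≤ x := Nat.lt_size.1 (by omega)
    have h2 : (2 : ℝ) ^ (x.size - 1) ≤ 1 + x := by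
      have : ((2 ^ (x.size - 1) : ℕ) : ℝ) ≤ x := by exact_mod_cast h1
      push_cast at this
      linarith
    have h3 := Real.log_le_log (by positivity) h2
    rw [Real.log_pow, Nat.cast_sub h] at h3
    have h4 := Real.log_two_gt_d9
    have h5 : (1 : ℝ) ≤ x.size := by exact_mod_cast h
    push_cast at h3
    nlinarith

theorem logFactor_le_mul {x y z c i j : ℕ} (h : x + 1 ≤ c * (y + 1) ^ i * (z + 1) ^ j) :
    logFactor x ≤ (1 + c + i + j) * (logFactor y * logFactor z) := by
  have hy : 0 ≤ Real.log (1 + (y : ℝ)) := Real.log_nonneg (by linarith [Nat.cast_nonneg (α := ℝ) y])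
  have hz : 0 ≤ Real.log (1 + (z : ℝ)) := Real.log_nonneg (by linarith [Nat.cast_nonneg (α := ℝ) z])
  have hc : c ≠ 0 := by rintro rfl; simp at h
  have hc' : (0 : ℝ) < c := by exact_mod_cast Nat.pos_of_ne_zero hc
  have h1 : (1 : ℝ) + x ≤ c * (1 + y) ^ i * (1 + z) ^ j := by
    have : ((x + 1 : ℕ) : ℝ) ≤ (c * (y + 1) ^ i * (z + 1) ^ j : ℕ) := by exact_mod_cast h
    push_cast at this
    rw [add_comm (1 : ℝ) x, add_comm (1 : ℝ) y, add_comm (1 : ℝ) z]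
    exact this
  have h2 := Real.log_le_log (by positivity) h1
  rw [Real.log_mul (by positivity) (by positivity), Real.log_mul (by positivity) (by positivity),
    Real.log_pow, Real.log_pow] at h2
  have h3 := Real.log_le_sub_one_of_pos hc'
  unfold logFactor
  have h4 := mul_nonneg hy hz
  have hi : (0 : ℝ) ≤ i := Nat.cast_nonneg i
  have hj : (0 : ℝ) ≤ j := Nat.cast_nonneg j
  have h5 := mul_nonneg hi hz
  have h6 := mul_nonneg hj hy
  have h7 := mul_nonneg hi h4
  have h8 := mul_nonneg hj h4
  have h9 := mul_nonneg hc'.le (add_nonneg (add_nonneg hy hz) h4)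
  nlinarith

theorem logFactor_le {x y c j : ℕ} (h : x + 1 ≤ c * (y + 1) ^ j) :
    logFactor x ≤ (1 + c + j) * logFactor y := by
  have := logFactor_le_mul (x := x) (y := 0) (z := y) (c := c) (i := 0) (j := j) (by simpa using h)
  simpa [logFactor] using this

theorem size_sq_add_one_le (x : ℕ) : (Nat.size ((x + 2) ^ 2) : ℝ) + 1 ≤ 16 * logFactor x := by
  refine (size_add_one_le _).trans ?_
  have := logFactor_le (x := (x + 2) ^ 2) (y := x) (c := 5) (j := 2) (by nlinarith [Nat.zero_le (x * x)])
  norm_num at this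
  linarith

/-- The time of a reduction: `x` for own work, `T` for subprograms, and `e` factors `s` for the
word length and numbers of rounds. -/
theorem reduction_time_le {K x T s g l D d : ℝ} {k e : ℕ} (hK : 0 ≤ K) (hg : 0 ≤ g) (hl : 1 ≤ l)
    (hD : 0 ≤ D) (hx : x ≤ g) (hT : T ≤ D * g * l ^ k) (hs : 0 ≤ s) (hs' : s ≤ d * l) :
    K * (x + T) * s ^ e ≤ K * (1 + D) * d ^ e * g * l ^ (k + e) := by
  have h1 : (1 : ℝ) ≤ l ^ k := one_le_pow₀ hl
  have h2 : x + T ≤ (1 + D) * g * l ^ k := by nlinarith [mul_nonneg hD hg]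
  have h3 : s ^ e ≤ (d * l) ^ e := pow_le_pow_left₀ hs hs' e
  calc K * (x + T) * s ^ e ≤ K * ((1 + D) * g * l ^ k) * s ^ e :=
        mul_le_mul_of_nonneg_right (mul_le_mul_of_nonneg_left h2 hK) (pow_nonneg hs e)
    _ ≤ K * ((1 + D) * g * l ^ k) * (d * l) ^ e := mul_le_mul_of_nonneg_left h3 (by positivity)
    _ = _ := by rw [mul_pow, pow_add]; ring

theorem Problem.SolvedBy.mono {Q : Problem} {p : Program} {I : Q.Instance} {T T' : ℕ}
    (h : Q.SolvedBy p I T) (hT : T ≤ T') : Q.SolvedBy p I T' := by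
  obtain ⟨t, s, h1, h2, h3⟩ := h
  exact ⟨t, s, h1, h2.trans hT, h3⟩

/-- A program, with a rounded and possibly weakened time bound, for a problem that is solvable in
time `C * f * polylog`. -/
theorem Problem.exists_solvedBy {Q : Problem} {f g : Q.Instance → ℝ} {W : Q.Instance → ℕ}
    (hfg : ∀ I, f I ≤ g I) (hf : ∀ I, 0 ≤ f I) {C : ℝ} {k : ℕ}
    (h : Q.SolvableInTime fun I => C * f I * polylog k (W I)) :
    ∃ p, ∃ C : ℝ, 0 ≤ C ∧ ∀ I, Q.SolvedBy p I ⌊C * g I * logFactor (W I) ^ k⌋₊ := by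
  obtain ⟨p, hp⟩ := h
  refine ⟨p, max C 0, le_max_right _ _, fun I => ?_⟩
  obtain ⟨T, s, h1, h2, h3⟩ := hp I
  refine ⟨T, s, h1, Nat.le_floor (h2.trans ?_), h3⟩
  have hl : 0 ≤ logFactor (W I) ^ k := pow_nonneg (zero_le_one.trans (one_le_logFactor _)) _
  refine mul_le_mul_of_nonneg_right ?_ hl
  exact mul_le_mul (le_max_left _ _) (hfg I) (hf I) (le_max_right _ _)

theorem Problem.solvableInTime {Q : Problem} {b : Q.Instance → ℝ} {p : Program}
    (h : ∀ I, ∃ T, Q.SolvedBy p I T ∧ (T : ℝ) ≤ b I) : Q.SolvableInTime b := by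
  refine ⟨p, fun I => ?_⟩
  obtain ⟨T, ⟨t, s, h1, h2, h3⟩, h4⟩ := h I
  exact ⟨t, s, h1, le_trans (by exact_mod_cast h2) h4, h3⟩

/-- The main part of the time bounds for items. -/
noncomputable def Items.work (S : Items) (ε : ℝ) : ℝ := S.n + (S.a 0 : ℝ) ^ (2 - ε)

theorem Items.one_le (S : Items) : (1 : ℝ) ≤ S.a 0 := by exact_mod_cast S.pos

theorem Items.work_nonneg (S : Items) (ε : ℝ) : 0 ≤ S.work ε := by
  unfold Items.work; positivity

theorem Items.le_work (S : Items) {ε : ℝ} (hε : ε ≤ 1) : (S.n : ℝ) + S.a 0 ≤ S.work ε := by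
  have h := Real.rpow_le_rpow_of_exponent_le S.one_le (show (1 : ℝ) ≤ 2 - ε by linarith)
  rw [Real.rpow_one] at h
  exact add_le_add_right h _

theorem Items.work_anti (S : Items) {ε ε' : ℝ} (h : ε' ≤ ε) : S.work ε ≤ S.work ε' :=
  add_le_add_right (Real.rpow_le_rpow_of_exponent_le S.one_le (by linarith)) _

theorem allTargets_of_minConv {ε C : ℝ} {k : ℕ} (hε : 0 < ε)
    (h : minConv.SolvableInTime fun I : SequencePair => C * (I.n : ℝ) ^ (2 - ε) * polylog k I.maxAbs) :
    ∃ ε : ℝ, 0 < ε ∧ ∃ (C : ℝ) (k : ℕ), allTargets.SolvableInTime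
      (fun S : Items => C * ((S.n : ℝ) + (S.a 0 : ℝ) ^ (2 - ε)) * polylog k S.largest) := by
  obtain ⟨p, C, hC, hp⟩ := Problem.exists_solvedBy (Q := minConv)
    (g := fun I : SequencePair => (I.n : ℝ) ^ (2 - min ε 1)) (fun I =>
      Real.rpow_le_rpow_of_exponent_le (by exact_mod_cast I.pos) (by linarith [min_le_left ε 1]))
    (fun I => by positivity) h
  set δ := min ε 1 with hδ
  have hδ1 : δ ≤ 1 := min_le_right _ _
  obtain ⟨K, hK⟩ := tableFromMinConv_solves p
  refine ⟨δ, lt_min hε one_pos, K * (1 + 4 * C * 4 ^ k) * 16 ^ 2, k + 2,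
    Problem.solvableInTime (p := tableFromMinConv p) fun S => ?_⟩
  set L := S.largest with hL
  have hlog := one_le_logFactor L
  have ha := S.le_largest 0
  set T := ⌊C * ((2 * S.a 0 : ℕ) : ℝ) ^ (2 - δ) * logFactor (S.a 0 * L) ^ k⌋₊ with hT
  refine ⟨_, hK S T fun I hI hI' => (hp I).mono (Nat.floor_le_floor ?_), ?_⟩
  · rw [hI]
    have := one_le_logFactor I.maxAbs
    have := logFactor_mono hI'
    gcongr
  · have h1 : logFactor (S.a 0 * L) ≤ 4 * logFactor L := by
      have := logFactor_le (x := S.a 0 * L) (y := L) (c := 1) (j := 2) (by nlinarith)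
      norm_num at this
      exact this
    have h0 := one_le_logFactor (S.a 0 * L)
    have h2 : ((2 * S.a 0 : ℕ) : ℝ) ^ (2 - δ) ≤ 4 * (S.a 0 : ℝ) ^ (2 - δ) := by
      push_cast
      rw [Real.mul_rpow (by norm_num) (by positivity)]
      refine mul_le_mul_of_nonneg_right ?_ (by positivity)
      calc (2 : ℝ) ^ (2 - δ) ≤ 2 ^ (2 : ℝ) := Real.rpow_le_rpow_of_exponent_le (by norm_num)
            (by linarith [lt_min hε one_pos])
        _ = 4 := by norm_num
    have hTle : (T : ℝ) ≤ 4 * C * 4 ^ k * S.work δ * logFactor L ^ k := by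
      refine (Nat.floor_le (by positivity)).trans ?_
      calc _ ≤ C * (4 * (S.a 0 : ℝ) ^ (2 - δ)) * (4 * logFactor L) ^ k := by gcongr
        _ ≤ C * (4 * S.work δ) * (4 * logFactor L) ^ k := by
          have : (S.a 0 : ℝ) ^ (2 - δ) ≤ S.work δ := le_add_of_nonneg_left (by positivity)
          gcongr
        _ = _ := by rw [mul_pow]; ring
    have := reduction_time_le (K := K) (e := 2) (Nat.cast_nonneg K) (S.work_nonneg δ) hlog
      (by positivity) (S.le_work hδ1) hTle (by positivity) (size_sq_add_one_le L)
    push_cast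
    exact this

theorem unboundedSubsetSum_of_allTargets {ε C : ℝ} {k : ℕ} (hε : 0 < ε)
    (h : allTargets.SolvableInTime fun S : Items =>
      C * ((S.n : ℝ) + (S.a 0 : ℝ) ^ (2 - ε)) * polylog k S.largest) :
    ∃ ε : ℝ, 0 < ε ∧ ∃ (C : ℝ) (k : ℕ), unboundedSubsetSum.SolvableInTime
      (fun I : Items × ℕ =>
        C * ((I.1.n : ℝ) + (I.1.a 0 : ℝ) ^ (2 - ε)) * polylog k (max I.1.largest I.2)) := by
  obtain ⟨p, C, hC, hp⟩ := Problem.exists_solvedBy (Q := allTargets)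
    (f := fun S : Items => S.work ε) (g := fun S : Items => S.work (min ε 1))
    (fun S => S.work_anti (min_le_left _ _)) (fun S => S.work_nonneg _) h
  set δ := min ε 1 with hδ
  obtain ⟨K, hK⟩ := targetFromTable_solves p
  refine ⟨δ, lt_min hε one_pos, K * (1 + C) * 16 ^ 1, k + 1,
    Problem.solvableInTime (p := targetFromTable p) fun I => ⟨_, hK I.1 I.2 _ (hp I.1), ?_⟩⟩
  obtain ⟨S, t⟩ := I
  simp only
  set L := max S.largest t with hL
  have hlog := one_le_logFactor L
  have h1 := logFactor_mono (le_max_left S.largest t)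
  have h0 := one_le_logFactor S.largest
  have hw := S.work_nonneg δ
  have hT : ((⌊C * S.work δ * logFactor S.largest ^ k⌋₊ : ℕ) : ℝ) ≤
      C * S.work δ * logFactor L ^ k := by
    refine (Nat.floor_le (by positivity)).trans ?_
    gcongr
  have hx : (S.n : ℝ) + 1 ≤ S.work δ := by
    have := S.le_work (min_le_right ε 1)
    linarith [S.one_le]
  have := reduction_time_le (K := K) (e := 1) (Nat.cast_nonneg K) hw hlog hC hx hT
    (by positivity) (size_sq_add_one_le L)
  rw [pow_one] at this
  push_cast
  exact this

theorem frobenius_of_allTargets {ε C : ℝ} {k : ℕ} (hε : 0 < ε)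
    (h : allTargets.SolvableInTime fun S : Items =>
      C * ((S.n : ℝ) + (S.a 0 : ℝ) ^ (2 - ε)) * polylog k S.largest) :
    ∃ ε : ℝ, 0 < ε ∧ ∃ (C : ℝ) (k : ℕ), frobeniusProblem.SolvableInTime
      (fun S : {S : Items // 2 ≤ S.a 0} =>
        C * ((S.1.n : ℝ) + (S.1.a 0 : ℝ) ^ (2 - ε)) * polylog k S.1.largest) := by
  obtain ⟨p, C, hC, hp⟩ := Problem.exists_solvedBy (Q := allTargets)
    (f := fun S : Items => S.work ε) (g := fun S : Items => S.work (min ε 1))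
    (fun S => S.work_anti (min_le_left _ _)) (fun S => S.work_nonneg _) h
  set δ := min ε 1 with hδ
  obtain ⟨K, hK⟩ := frobeniusFromTable_solves p
  refine ⟨δ, lt_min hε one_pos, K * (1 + C) * 16 ^ 1, k + 1,
    Problem.solvableInTime (p := frobeniusFromTable p) fun S => ⟨_, hK S _ (hp S.1), ?_⟩⟩
  obtain ⟨S, hS⟩ := S
  simp only
  set L := S.largest with hL
  have hlog := one_le_logFactor L
  have hw := S.work_nonneg δ
  have := reduction_time_le (K := K) (k := k) (e := 1) (Nat.cast_nonneg K) hw hlog hC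
    (S.le_work (min_le_right ε 1)) (Nat.floor_le (by positivity)) (by positivity) (size_sq_add_one_le L)
  rw [pow_one] at this
  push_cast
  exact this

/-- Frobenius numbers with known residue are found in subquadratic time. -/
def SubquadraticFrobenius : Prop :=
  ∃ (p : Program) (ε C : ℝ) (k : ℕ), 0 < ε ∧ ε ≤ 1 ∧ 0 ≤ C ∧ ∀ I : frobeniusWithResidue.Instance,
    ∃ T : ℕ, frobeniusWithResidue.SolvedBy p I T ∧
      (T : ℝ) ≤ C * I.1.1.work ε * logFactor I.1.1.largest ^ k

theorem subquadraticFrobenius_of_frobenius {ε C : ℝ} {k : ℕ} (hε : 0 < ε)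
    (h : frobeniusProblem.SolvableInTime fun S : {S : Items // 2 ≤ S.a 0} =>
      C * ((S.1.n : ℝ) + (S.1.a 0 : ℝ) ^ (2 - ε)) * polylog k S.1.largest) :
    SubquadraticFrobenius := by
  obtain ⟨p, C, hC, hp⟩ := Problem.exists_solvedBy (Q := frobeniusProblem)
    (f := fun S : {S : Items // 2 ≤ S.a 0} => S.1.work ε)
    (g := fun S : {S : Items // 2 ≤ S.a 0} => S.1.work (min ε 1))
    (fun S => S.1.work_anti (min_le_left _ _)) (fun S => S.1.work_nonneg _) h
  refine ⟨.seq (.set 1 (.lit 0)) p, min ε 1, C + 2, k, lt_min hε one_pos, min_le_right _ _,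
    by positivity, fun I => ⟨_, frobeniusWithResidue_of_frobenius p I _ (hp ⟨I.1.1, I.2.1⟩), ?_⟩⟩
  obtain ⟨⟨S, ρ⟩, hS⟩ := I
  simp only
  have hw := S.work_nonneg (min ε 1)
  have hlog : 1 ≤ logFactor S.largest ^ k := one_le_pow₀ (one_le_logFactor _)
  have h1 : (1 : ℝ) ≤ S.work (min ε 1) := by
    have := S.le_work (min_le_right ε 1)
    linarith [S.one_le, Nat.cast_nonneg (α := ℝ) S.n]
  have h2 := Nat.floor_le (show 0 ≤ C * S.work (min ε 1) * logFactor S.largest ^ k by positivity)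
  push_cast
  nlinarith [mul_le_mul h1 hlog zero_le_one hw]

theorem subquadraticFrobenius_of_unboundedSubsetSum {ε C : ℝ} {k : ℕ} (hε : 0 < ε)
    (h : unboundedSubsetSum.SolvableInTime fun I : Items × ℕ =>
      C * ((I.1.n : ℝ) + (I.1.a 0 : ℝ) ^ (2 - ε)) * polylog k (max I.1.largest I.2)) :
    SubquadraticFrobenius := by
  obtain ⟨p, C, hC, hp⟩ := Problem.exists_solvedBy (Q := unboundedSubsetSum)
    (f := fun I : Items × ℕ => I.1.work ε) (g := fun I : Items × ℕ => I.1.work (min ε 1))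
    (fun I => I.1.work_anti (min_le_left _ _)) (fun I => I.1.work_nonneg _) h
  set δ := min ε 1 with hδ
  obtain ⟨K, hK⟩ := frobeniusBySearch_solves p
  refine ⟨frobeniusBySearch p, δ, K * (1 + C * 8 ^ k) * 16 ^ 2, k + 2, lt_min hε one_pos,
    min_le_right _ _, by positivity, fun I => ?_⟩
  obtain ⟨⟨S, ρ⟩, hS⟩ := I
  simp only
  set L := S.largest with hL
  have hlog := one_le_logFactor L
  have hw := S.work_nonneg δ
  have hbig : logFactor (4 * (L + 1) ^ 2) ≤ 8 * logFactor L := by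
    have := logFactor_le (x := 4 * (L + 1) ^ 2) (y := L) (c := 5) (j := 2) (by nlinarith)
    norm_num at this
    exact this
  have h0 := one_le_logFactor (4 * (L + 1) ^ 2)
  have hLL : L ≤ 4 * (L + 1) ^ 2 := by nlinarith
  refine ⟨_, hK ⟨(S, ρ), hS⟩ ⌊C * S.work δ * logFactor (4 * (L + 1) ^ 2) ^ k⌋₊ fun t ht =>
    (hp (S, t)).mono (Nat.floor_le_floor ?_), ?_⟩
  · have h1 := one_le_logFactor (max L t)
    have h2 := logFactor_mono (max_le hLL ht)
    simp only
    gcongr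
  · have hT : ((⌊C * S.work δ * logFactor (4 * (L + 1) ^ 2) ^ k⌋₊ : ℕ) : ℝ) ≤
        C * 8 ^ k * S.work δ * logFactor L ^ k := by
      refine (Nat.floor_le (by positivity)).trans ?_
      calc _ ≤ C * S.work δ * (8 * logFactor L) ^ k := by gcongr
        _ = _ := by rw [mul_pow]; ring
    have hs : ((Nat.size (4 * (L + 1) ^ 2) : ℝ) + 1) ≤ 16 * logFactor L :=
      (size_add_one_le _).trans (by linarith)
    have := reduction_time_le (K := K) (e := 2) (Nat.cast_nonneg K) hw hlog (by positivity)
      (S.le_work (min_le_right ε 1)) hT (by positivity) hs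
    push_cast
    exact this

/-! ### The time of the convolution algorithm, and the equivalence -/

theorem logFactor_pow_le {δ : ℝ} (hδ : 0 < δ) (k : ℕ) :
    ∃ E : ℝ, 0 ≤ E ∧ ∀ n : ℕ, 0 < n → logFactor n ^ k ≤ E * (n : ℝ) ^ δ := by
  set η := δ / (k + 1) with hη
  have hη0 : 0 < η := by positivity
  refine ⟨(1 + 2 ^ η / η) ^ (k + 1), by positivity, fun n hn => ?_⟩
  have hn1 : (1 : ℝ) ≤ n := by exact_mod_cast hn
  have h1 : logFactor n ≤ (1 + 2 ^ η / η) * (n : ℝ) ^ η := by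
    have h2 := Real.log_le_rpow_div (show (0 : ℝ) ≤ 1 + n by positivity) hη0
    have h3 : (1 + n : ℝ) ^ η ≤ 2 ^ η * (n : ℝ) ^ η := by
      rw [← Real.mul_rpow (by norm_num) (by positivity)]
      exact Real.rpow_le_rpow (by positivity) (by linarith) hη0.le
    have h4 : (1 : ℝ) ≤ (n : ℝ) ^ η := Real.one_le_rpow hn1 hη0.le
    have h5 : (1 + n : ℝ) ^ η / η ≤ 2 ^ η * (n : ℝ) ^ η / η := by gcongr
    unfold logFactor
    calc _ ≤ (n : ℝ) ^ η + 2 ^ η * (n : ℝ) ^ η / η := by linarith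
      _ = _ := by ring
  have h0 := one_le_logFactor n
  calc logFactor n ^ k ≤ logFactor n ^ (k + 1) := pow_le_pow_right₀ h0 (Nat.le_succ k)
    _ ≤ ((1 + 2 ^ η / η) * (n : ℝ) ^ η) ^ (k + 1) :=
      pow_le_pow_left₀ (zero_le_one.trans h0) h1 _
    _ = _ := by
      rw [mul_pow, ← Real.rpow_natCast ((n : ℝ) ^ η), ← Real.rpow_mul (by positivity)]
      congr 2
      push_cast
      rw [hη]
      field_simp

theorem SequencePair.natAbs_le_maxAbs (I : SequencePair) (i : Fin I.n) :
    (I.a i).natAbs ≤ I.maxAbs ∧ (I.b i).natAbs ≤ I.maxAbs := by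
  have := Finset.le_sup (f := fun i : Fin I.n => max (I.a i).natAbs (I.b i).natAbs)
    (Finset.mem_univ i)
  exact max_le_iff.1 this

theorem SequencePair.w_le (I : SequencePair) :
    I.toConvolution.w ≤ 2 * (I.n + 1) * (I.maxAbs + 1) ^ 2 := by
  have h : ∑ k ∈ Finset.range I.n, ((arrayOf I.a k).natAbs ^ 2 + (arrayOf I.b k).natAbs ^ 2) ≤
      I.n * (2 * I.maxAbs ^ 2) := by
    have := Finset.sum_le_card_nsmul (Finset.range I.n)
      (fun k : ℕ => (arrayOf I.a k).natAbs ^ 2 + (arrayOf I.b k).natAbs ^ 2) (2 * I.maxAbs ^ 2)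
      fun k hk => by
        have hk := Finset.mem_range.1 hk
        obtain ⟨h1, h2⟩ := I.natAbs_le_maxAbs ⟨k, hk⟩
        rw [arrayOf_apply _ hk, arrayOf_apply _ hk]
        have := Nat.pow_le_pow_left h1 2
        have := Nat.pow_le_pow_left h2 2
        omega
    simpa using this
  change 1 + _ ≤ _
  nlinarith [Nat.zero_le (I.n * I.maxAbs)]

theorem SequencePair.mul_m_le (I : SequencePair) :
    I.toConvolution.m * I.toConvolution.m ≤ 4 * I.n := by
  have h := I.queries_le
  change _ + I.n ≤ _ at h
  omega

theorem Convolution.word_le (C : Convolution) : C.word ≤ 4976640 * (C.m ^ 3 * C.w) := by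
  have hm := C.m_pos
  have hw := C.w_pos
  have h1 : 2 * C.m * (12 * C.w + 1) + 1 ≤ 27 * (C.m * C.w) := by
    have : C.m ≤ C.m * C.w := Nat.le_mul_of_pos_right _ hw
    rw [show 2 * C.m * (12 * C.w + 1) = 24 * (C.m * C.w) + 2 * C.m by ring]
    omega
  have h2 := Nat.mul_le_mul_left (960 * C.m * (8 * (24 * C.m))) h1
  calc C.word = 960 * C.m * (8 * (24 * C.m)) * (2 * C.m * (12 * C.w + 1) + 1) := by
        unfold word itemBase; ring
    _ ≤ _ := h2
    _ = _ := by ring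

theorem SequencePair.logFactor_word_le :
    ∃ B : ℝ, 1 ≤ B ∧ ∀ I : SequencePair,
      logFactor I.toConvolution.word ≤ B * (logFactor I.n * logFactor I.maxAbs) := by
  refine ⟨1 + (10000000 : ℕ) + (4 : ℕ) + (2 : ℕ), by norm_num, fun I => logFactor_le_mul ?_⟩
  have h1 := I.toConvolution.word_le
  have h2 := I.w_le
  have hm : I.toConvolution.m ≤ I.n + 1 := by
    have := Nat.sqrt_le_self (I.n - 1)
    change Nat.sqrt (I.n - 1) + 1 ≤ _
    omega
  have h3 := Nat.mul_le_mul (Nat.pow_le_pow_left hm 3) h2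
  have h4 : (I.n + 1) ^ 3 * (2 * (I.n + 1) * (I.maxAbs + 1) ^ 2) =
      2 * ((I.n + 1) ^ 4 * (I.maxAbs + 1) ^ 2) := by ring
  have h5 : 0 < (I.n + 1) ^ 4 * (I.maxAbs + 1) ^ 2 := by positivity
  rw [mul_assoc]
  omega

theorem minConv_of_subquadraticFrobenius (h : SubquadraticFrobenius) :
    ∃ ε : ℝ, 0 < ε ∧ ∃ (C : ℝ) (k : ℕ), minConv.SolvableInTime
      (fun I : SequencePair => C * (I.n : ℝ) ^ (2 - ε) * polylog k I.maxAbs) := by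
  obtain ⟨p, ε, C, k, hε, hε1, hC, hp⟩ := h
  obtain ⟨B, hB1, hB⟩ := SequencePair.logFactor_word_le
  obtain ⟨K, hK⟩ := convolutionFromFrobenius_solves p
  obtain ⟨E, hE, hEn⟩ := logFactor_pow_le (show 0 < ε / 4 by positivity) (k + 2)
  set D := 60000 * C * B ^ k with hD
  refine ⟨ε / 4, by positivity, K * (1 + D) * (2 * B) ^ 2 * 4 * E, k + 2,
    Problem.solvableInTime (p := convolutionFromFrobenius p) fun I => ?_⟩
  set m := I.toConvolution.m with hm
  set L := logFactor I.n * logFactor I.maxAbs with hL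
  have hn1 : (1 : ℝ) ≤ I.n := by exact_mod_cast I.pos
  have hm1 : (1 : ℝ) ≤ m := by exact_mod_cast I.toConvolution.m_pos
  have hln := one_le_logFactor I.n
  have hlw := one_le_logFactor I.maxAbs
  have hL1 : 1 ≤ L := one_le_mul_of_one_le_of_one_le hln hlw
  set T := ⌊D * (m : ℝ) ^ (2 - ε) * L ^ k⌋₊ with hT
  have hmε : (m : ℝ) ≤ (m : ℝ) ^ (2 - ε) := by
    have := Real.rpow_le_rpow_of_exponent_le hm1 (show (1 : ℝ) ≤ 2 - ε by linarith)
    rwa [Real.rpow_one] at this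
  refine ⟨_, hK I T fun J hJn hJ0 hJl => ?_, ?_⟩
  · obtain ⟨T', h1, h2⟩ := hp J
    refine h1.mono (Nat.le_floor (h2.trans ?_))
    have h3 : logFactor J.1.1.largest ≤ B * L :=
      (logFactor_mono (hJl.trans Convolution.itemFloor_le_word)).trans (hB I)
    have h0 := one_le_logFactor J.1.1.largest
    have h4 : J.1.1.work ε ≤ 60000 * (m : ℝ) ^ (2 - ε) := by
      have h5 : (J.1.1.n : ℝ) ≤ 264 * m := by
        have : J.1.1.n ≤ 264 * m := by omega
        exact_mod_cast this
      unfold Items.work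
      rw [hJ0, Nat.cast_mul, Real.mul_rpow (by positivity) (by positivity)]
      have h6 : ((240 : ℕ) : ℝ) ^ (2 - ε) ≤ 57600 := by
        calc ((240 : ℕ) : ℝ) ^ (2 - ε) ≤ ((240 : ℕ) : ℝ) ^ (2 : ℝ) :=
              Real.rpow_le_rpow_of_exponent_le (by norm_num) (by linarith)
          _ = 57600 := by norm_num
      have h7 := mul_le_mul_of_nonneg_right h6 (show 0 ≤ (m : ℝ) ^ (2 - ε) by positivity)
      linarith
    have hw := J.1.1.work_nonneg ε
    calc C * J.1.1.work ε * logFactor J.1.1.largest ^ k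
        ≤ C * (60000 * (m : ℝ) ^ (2 - ε)) * (B * L) ^ k := by gcongr
      _ = _ := by rw [hD, mul_pow]; ring
  · have hs : (Nat.size I.toConvolution.word : ℝ) + 1 ≤ 2 * B * L := by
      have := size_add_one_le I.toConvolution.word
      have := hB I
      linarith
    have hTle : (I.n : ℝ) * T ≤ D * (I.n * (m : ℝ) ^ (2 - ε)) * L ^ k := by
      have := Nat.floor_le (show 0 ≤ D * (m : ℝ) ^ (2 - ε) * L ^ k by positivity)
      calc _ ≤ (I.n : ℝ) * (D * (m : ℝ) ^ (2 - ε) * L ^ k) := by gcongr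
        _ = _ := by ring
    have h1 := reduction_time_le (K := K) (x := I.n * m) (e := 2) (Nat.cast_nonneg K)
      (show 0 ≤ (I.n : ℝ) * (m : ℝ) ^ (2 - ε) by positivity) hL1 (show 0 ≤ D by positivity)
      (by gcongr) hTle (by positivity) hs
    have h2 : (m : ℝ) ^ (2 - ε) ≤ 4 * (I.n : ℝ) ^ (1 - ε / 2) := by
      have h3 : (m : ℝ) ^ (2 : ℝ) ≤ 4 * I.n := by
        have : (m : ℝ) * m ≤ 4 * I.n := by exact_mod_cast I.mul_m_le
        rw [Real.rpow_two]
        nlinarith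
      have h4 := Real.rpow_le_rpow (by positivity) h3 (show 0 ≤ 1 - ε / 2 by linarith)
      rw [← Real.rpow_mul (by positivity), Real.mul_rpow (by norm_num) (by positivity),
        show 2 * (1 - ε / 2) = 2 - ε by ring] at h4
      refine h4.trans (mul_le_mul_of_nonneg_right ?_ (by positivity))
      calc (4 : ℝ) ^ (1 - ε / 2) ≤ 4 ^ (1 : ℝ) :=
            Real.rpow_le_rpow_of_exponent_le (by norm_num) (by linarith)
        _ = 4 := Real.rpow_one 4
    have h5 := hEn I.n I.pos
    have h6 : (I.n : ℝ) * (I.n : ℝ) ^ (1 - ε / 2) * (I.n : ℝ) ^ (ε / 4) =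
        (I.n : ℝ) ^ (2 - ε / 4) := by
      nth_rewrite 1 [← Real.rpow_one (I.n : ℝ)]
      rw [← Real.rpow_add (by linarith), ← Real.rpow_add (by linarith)]
      congr 1
      ring
    push_cast
    rw [mul_add, polylog_eq]
    refine h1.trans ?_
    rw [hL, mul_pow (logFactor I.n)]
    calc K * (1 + D) * (2 * B) ^ 2 * (I.n * (m : ℝ) ^ (2 - ε)) *
          (logFactor I.n ^ (k + 2) * logFactor I.maxAbs ^ (k + 2))
        ≤ K * (1 + D) * (2 * B) ^ 2 * (I.n * (4 * (I.n : ℝ) ^ (1 - ε / 2))) *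
          ((E * (I.n : ℝ) ^ (ε / 4)) * logFactor I.maxAbs ^ (k + 2)) := by gcongr
      _ = K * (1 + D) * (2 * B) ^ 2 * 4 * E * ((I.n : ℝ) * (I.n : ℝ) ^ (1 - ε / 2) *
          (I.n : ℝ) ^ (ε / 4)) * logFactor I.maxAbs ^ (k + 2) := by ring
      _ = _ := by rw [h6]

theorem theorem1 :
    List.TFAE [
      ∃ ε : ℝ, 0 < ε ∧ ∃ (C : ℝ) (k : ℕ), minConv.SolvableInTime
        (fun I : SequencePair => C * (I.n : ℝ) ^ (2 - ε) * polylog k I.maxAbs),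
      ∃ ε : ℝ, 0 < ε ∧ ∃ (C : ℝ) (k : ℕ), unboundedSubsetSum.SolvableInTime
        (fun I : Items × ℕ =>
          C * ((I.1.n : ℝ) + (I.1.a 0 : ℝ) ^ (2 - ε)) * polylog k (max I.1.largest I.2)),
      ∃ ε : ℝ, 0 < ε ∧ ∃ (C : ℝ) (k : ℕ), frobeniusProblem.SolvableInTime
        (fun S : {S : Items // 2 ≤ S.a 0} =>
          C * ((S.1.n : ℝ) + (S.1.a 0 : ℝ) ^ (2 - ε)) * polylog k S.1.largest),
      ∃ ε : ℝ, 0 < ε ∧ ∃ (C : ℝ) (k : ℕ), allTargets.SolvableInTime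
        (fun S : Items =>
          C * ((S.n : ℝ) + (S.a 0 : ℝ) ^ (2 - ε)) * polylog k S.largest)] := by
  tfae_have 1 → 4 := by
    rintro ⟨ε, hε, C, k, h⟩
    exact allTargets_of_minConv hε h
  tfae_have 4 → 2 := by
    rintro ⟨ε, hε, C, k, h⟩
    exact unboundedSubsetSum_of_allTargets hε h
  tfae_have 4 → 3 := by
    rintro ⟨ε, hε, C, k, h⟩
    exact frobenius_of_allTargets hε h
  tfae_have 2 → 1 := by
    rintro ⟨ε, hε, C, k, h⟩
    exact minConv_of_subquadraticFrobenius (subquadraticFrobenius_of_unboundedSubsetSum hε h)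
  tfae_have 3 → 1 := by
    rintro ⟨ε, hε, C, k, h⟩
    exact minConv_of_subquadraticFrobenius (subquadraticFrobenius_of_frobenius hε h)
  tfae_finish
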